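/- Let $2\le n\le d$ be integers and write $z=(x,y)\in\mathbb R^{d-n}\times\mathbb R^n=\mathbb R^d$. Let $a\in\mathbb R$ with $a+n>0$, let $\varepsilon\ge 0$, and let $A\in\mathbb R^{d\times d}$ be a constant symmetric matrix such that $\lambda|\xi|^2\le A\xi\cdot\xi\le\Lambda|\xi|^2$ for all $\xi\in\mathbb R^d$, for some constants $0<\lambda\le\Lambda$. Let $A_3\in\mathbb R^{n\times n}$ be the lower-right block of $A$ (acting on the variable $y$), and let $$\Sigma^A_\varepsilon=\{(x,y)\in\mathbb R^{d-n}\times\mathbb R^n:\ A_3^{-1}y\cdot y\le\varepsilon^2\}.$$ Let $\mu_1$ be the first nontrivial eigenvalue of the weighted Laplacian on $\mathbb S^{n-1}$ with weight $|A_3^{1/2}\sigma|^a$, that is, $$\mu_1=\inf\left\{\frac{\int_{\mathbb S^{n-1}}|A_3^{1/2}\sigma|^a|\nabla_\sigma g|^2\,d\sigma}{\int_{\mathbb S^{n-1}}|A_3^{1/2}\sigma|^a|g|^2\,d\sigma}:\ g\in H^1(\mathbb S^{n-1})\setminus\{0\},\ \int_{\mathbb S^{n-1}}|A_3^{1/2}\sigma|^a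 g\,d\sigma=0\right\},$$ and put $$\gamma_1^+=\frac{2-a-n+\sqrt{(2-a-n)^2+4\mu_1}}{2}.$$ For $R>0$ let $B_R\subset\mathbb R^d$ be the open ball of radius $R$ centred at $0$, and let $H^{1,a}(B_R\setminus\Sigma^A_\varepsilon)$ be the completion of the restrictions to $B_R\setminus\Sigma^A_\varepsilon$ of functions in $C^\infty(\mathbb R^d)$ with respect to the norm $\big(\int_{B_R\setminus\Sigma^A_\varepsilon}|y|^a(|u|^2+|\nabla u|^2)\,dz\big)^{1/2}$. Let $u$ be an entire solution of $-\operatorname{div}(|y|^aA\nabla u)=0$ in $\mathbb R^d\setminus\Sigma^A_\varepsilon$ with $|y|^aA\nabla u\cdot\nu=0$ on $\partial\Sigma^A_\varepsilon$; this means that for every $R>0$ one has $u\in H^{1,a}(B_R\setminus\Sigma^A_\varepsilon)$ and $$\int_{B_R\setminus\Sigma^A_\varepsilon}|y|^aA\nabla u\cdot\nabla\phi\,dz=0\qquad\text{for every }\phi\in C^\infty_c(B_R).$$ (For $\varepsilon=0$ the set $\Sigma^A_0=\{y=0\}$ is Lebesgue-null, and this is the weak equation in $\mathbb R^d$, across $\{y=0\}$.)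 Assume that there are constants $c>0$ and $\gamma\in(0,\gamma_1^+)$ such that $$|u(z)|\le c\,(1+|z|^\gamma)\qquad\text{for a.e. }z\in\mathbb R^d\setminus\Sigma^A_\varepsilon.$$ If $\gamma<2$, then $u$ is linear, that is, there are $c_0\in\mathbb R$ and $v\in\mathbb R^d$ with $u(z)=c_0+v\cdot z$ for a.e. $z\in\mathbb R^d\setminus\Sigma^A_\varepsilon$. Moreover, if $\gamma<1$, then $u$ is constant a.e. in $\mathbb R^d\setminus\Sigma^A_\varepsilon$. -/

import Mathlib

open MeasureTheory Filter Topology Matrix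
open scoped ContDiff

namespace PerforatedLiouville

noncomputable section

/-- The Euclidean space `ℝ^d = ℝ^m × ℝ^n`, `d = m + n`, with its Euclidean norm and Lebesgue
measure. A point is `z = (x, y)`, where `x` has the coordinates `Sum.inl j` and `y` the
coordinates `Sum.inr i`. -/
abbrev Space (m n : ℕ) : Type := EuclideanSpace ℝ (Fin m ⊕ Fin n)

/-- The component `y ∈ ℝ^n` of `z = (x, y)`. -/
def yPart {m n : ℕ} (z : Space m n) : EuclideanSpace ℝ (Fin n) :=
  WithLp.toLp 2 (fun i => z (Sum.inr i))

/-- `A` is a symmetric matrix with `lam |ξ|² ≤ A ξ · ξ ≤ Lam |ξ|²` for all `ξ`,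
where `0 < lam ≤ Lam`. -/
def IsElliptic {ι : Type*} [Fintype ι] (lam Lam : ℝ) (A : Matrix ι ι ℝ) : Prop :=
  0 < lam ∧ lam ≤ Lam ∧ A.IsSymm ∧
    ∀ ξ : EuclideanSpace ℝ ι,
      lam * ‖ξ‖ ^ 2 ≤ (A *ᵥ ξ.ofLp) ⬝ᵥ ξ.ofLp ∧ (A *ᵥ ξ.ofLp) ⬝ᵥ ξ.ofLp ≤ Lam * ‖ξ‖ ^ 2

/-- The lower-right `n × n` block `A₃` of `A`. -/
def blockThree {m n : ℕ} (A : Matrix (Fin m ⊕ Fin n) (Fin m ⊕ Fin n) ℝ) :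
    Matrix (Fin n) (Fin n) ℝ :=
  A.toBlocks₂₂

/-- The closed hole `Σ_ε^A = {(x, y) | A₃⁻¹ y · y ≤ ε²}`. For `ε = 0` and `A` elliptic it is
`{y = 0}`. -/
def hole {m n : ℕ} (A : Matrix (Fin m ⊕ Fin n) (Fin m ⊕ Fin n) ℝ) (ε : ℝ) :
    Set (Space m n) :=
  {z | ((blockThree A)⁻¹ *ᵥ (yPart z).ofLp) ⬝ᵥ (yPart z).ofLp ≤ ε ^ 2}

/-- The measure `|y|^a dz` on the set `Ω`. -/
def weightedMeasure {m n : ℕ} (a : ℝ) (Ω : Set (Space m n)) : Measure (Space m n) :=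
  (volume.restrict Ω).withDensity (fun z => ENNReal.ofReal (‖yPart z‖ ^ a))

/-- `u ∈ H^{1,a}(Ω)` with (weak) gradient `G`: the pair `(u, G)` is a limit in
`L²(Ω, |y|^a dz)` of pairs `(φ, ∇φ)` with `φ` the restriction of a smooth function on `ℝ^d`.
This is the completion of these restrictions for the norm
`(∫_Ω |y|^a (|u|² + |∇u|²))^{1/2}`. -/
def IsH1 {m n : ℕ} (a : ℝ) (Ω : Set (Space m n)) (u : Space m n → ℝ)
    (G : Space m n → Space m n) : Prop :=
  MemLp u 2 (weightedMeasure a Ω) ∧ MemLp G 2 (weightedMeasure a Ω) ∧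
    ∃ φ : ℕ → Space m n → ℝ,
      (∀ k, ContDiff ℝ ∞ (φ k) ∧ MemLp (φ k) 2 (weightedMeasure a Ω) ∧
        MemLp (gradient (φ k)) 2 (weightedMeasure a Ω)) ∧
      Tendsto (fun k => eLpNorm (φ k - u) 2 (weightedMeasure a Ω)) atTop (𝓝 0) ∧
      Tendsto (fun k => eLpNorm (gradient (φ k) - G) 2 (weightedMeasure a Ω)) atTop (𝓝 0)

/-- `u` is a weak solution of `-div(|y|^a A ∇u) = 0` in `B_R \ Σ_ε^A` with homogeneous conormal
condition on `∂Σ_ε^A ∩ B_R`: the test functions have compact support in the ball `B_R`, and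
need not vanish on the hole. For `ε = 0` the hole is Lebesgue-null and this is the weak equation
in `B_R`, across `{y = 0}`. -/
def IsWeakSolution {m n : ℕ} (a : ℝ) (A : Matrix (Fin m ⊕ Fin n) (Fin m ⊕ Fin n) ℝ)
    (ε R : ℝ) (u : Space m n → ℝ) : Prop :=
  ∃ G : Space m n → Space m n,
    IsH1 a (Metric.ball 0 R \ hole A ε) u G ∧
    ∀ φ : Space m n → ℝ, ContDiff ℝ ∞ φ → HasCompactSupport φ →
      tsupport φ ⊆ Metric.ball 0 R →
      ∫ z in Metric.ball 0 R \ hole A ε,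
        ‖yPart z‖ ^ a * ((A *ᵥ (G z).ofLp) ⬝ᵥ (gradient φ z).ofLp) = 0

/-- Entire solutions: weak solutions in `B_R \ Σ_ε^A` for every `R > 0`. -/
def IsEntireSolution {m n : ℕ} (a : ℝ) (A : Matrix (Fin m ⊕ Fin n) (Fin m ⊕ Fin n) ℝ)
    (ε : ℝ) (u : Space m n → ℝ) : Prop :=
  ∀ R : ℝ, 0 < R → IsWeakSolution a A ε R u

/-- The unit sphere `𝕊^{n-1}` of `ℝ^n`. -/
abbrev Sph (n : ℕ) : Type := Metric.sphere (0 : EuclideanSpace ℝ (Fin n)) 1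

/-- The surface measure on `𝕊^{n-1}`. -/
def surfaceMeasure (n : ℕ) : Measure (Sph n) :=
  (volume : Measure (EuclideanSpace ℝ (Fin n))).toSphere

/-- The tangential gradient `∇_σ φ` on the sphere of a differentiable function on `ℝ^n`: the
projection of `∇φ(σ)` to the orthogonal complement of `σ`. -/
def tangentialGradient {n : ℕ} (φ : EuclideanSpace ℝ (Fin n) → ℝ) (σ : Sph n) :
    EuclideanSpace ℝ (Fin n) :=
  gradient φ σ - inner ℝ (σ : EuclideanSpace ℝ (Fin n)) (gradient φ σ) •
    (σ : EuclideanSpace ℝ (Fin n))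

/-- `g ∈ H¹(𝕊^{n-1})` with (weak) tangential gradient `G`: the pair is a limit in `L²(𝕊^{n-1})`
of pairs `(φ, ∇_σ φ)` with `φ` smooth. -/
def IsSphereH1 {n : ℕ} (g : Sph n → ℝ) (G : Sph n → EuclideanSpace ℝ (Fin n)) : Prop :=
  MemLp g 2 (surfaceMeasure n) ∧ MemLp G 2 (surfaceMeasure n) ∧
    ∃ φ : ℕ → EuclideanSpace ℝ (Fin n) → ℝ,
      (∀ k, ContDiff ℝ ∞ (φ k)) ∧
      Tendsto (fun k => eLpNorm (fun σ : Sph n => φ k σ - g σ) 2 (surfaceMeasure n))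
        atTop (𝓝 0) ∧
      Tendsto (fun k => eLpNorm (fun σ : Sph n => tangentialGradient (φ k) σ - G σ) 2
        (surfaceMeasure n)) atTop (𝓝 0)

/-- The weight `|B^{1/2} σ|^a` on the sphere; for `B` symmetric and positive definite,
`|B^{1/2} σ|² = B σ · σ`. -/
def sphereWeight {n : ℕ} (a : ℝ) (B : Matrix (Fin n) (Fin n) ℝ) (σ : Sph n) : ℝ :=
  Real.sqrt ((B *ᵥ (σ : EuclideanSpace ℝ (Fin n)).ofLp) ⬝ᵥ
    (σ : EuclideanSpace ℝ (Fin n)).ofLp) ^ a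

/-- The first nontrivial eigenvalue `μ₁` of the weighted Laplacian of the sphere, that is the
infimum of the quotient `∫ |B^{1/2}σ|^a |∇_σ g|² / ∫ |B^{1/2}σ|^a |g|²` over the nonzero
`g ∈ H¹(𝕊^{n-1})` with `∫ |B^{1/2}σ|^a g = 0`. -/
def muOne {n : ℕ} (a : ℝ) (B : Matrix (Fin n) (Fin n) ℝ) : ℝ :=
  sInf {q : ℝ | ∃ (g : Sph n → ℝ) (G : Sph n → EuclideanSpace ℝ (Fin n)),
    IsSphereH1 g G ∧ ¬ (g =ᵐ[surfaceMeasure n] 0) ∧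
    ∫ σ, sphereWeight a B σ * g σ ∂(surfaceMeasure n) = 0 ∧
    q = (∫ σ, sphereWeight a B σ * ‖G σ‖ ^ 2 ∂(surfaceMeasure n)) /
      (∫ σ, sphereWeight a B σ * g σ ^ 2 ∂(surfaceMeasure n))}

/-- The exponent `γ₁⁺ = (2 - a - n + √((2 - a - n)² + 4 μ₁)) / 2`, with `μ₁` that of the block
`A₃`. -/
def gammaOne {m n : ℕ} (a : ℝ) (A : Matrix (Fin m ⊕ Fin n) (Fin m ⊕ Fin n) ℝ) : ℝ :=
  (2 - a - n + Real.sqrt ((2 - a - n) ^ 2 + 4 * muOne a (blockThree A))) / 2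

end

end PerforatedLiouville

/-!
The weight `|y|^a` and the hole are invariant under translations in `x`, which reduces the theorem to
solutions that depend on `y` only; for these the spectral gap `μ₁` on the sphere gives the result.

*Regularity in `x`.* By the Caccioppoli inequality (`caccioppoli`), the `L²` norm on `B_R` of a
difference of a solution along `x` is smaller, by a factor of order `1 / R`, than the norm of the
solution on `B_{4R}` (`exists_eLpNorm_fwdDiff_le`). Differences along `x` are again solutions, so a
solution of polynomial growth is annihilated by all `x`-differences of some high order
(`exists_fwdDiff_iterate_eq_zero`). Such a function is given on lines by a Newton series, and growth
of order `γ` kills the terms of order larger than `γ` (`fwdDiff_iterate_eq_zero_of_growth`). Hence `u`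
does not depend on `x` if `γ < 1`. If `γ < 2`, the second differences vanish, and the first ones do
not depend on `x` (`ae_mixed_difference_eq_zero`).

*Solutions that do not depend on `x`.* Let `S` be the symmetric square root of `A₃`. In the variable
`y' = S⁻¹ y` such a solution is a solution `v` of the equation in `ℝ^n ∖ B_ε` with identity
coefficients and the weight `|S y'|^a` (`exists_isSol_slice`), which is the product of `r^q dr`,
`q = n + a - 1`, and a measure `β` on the sphere. After subtraction of the spherical mean, which does
not depend on the radius (`exists_ae_mean_eq`), put `H(r) = ∫ v(r σ)² dβ` and let `F(r)` be the
Dirichlet energy in `B_r`. Testing the equation with `η(|y'|) v` gives `H' = 2 r^{-q} F`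
(`ae_integral_sq_sub`, `ae_radialFlux_eq_energy`). Write `ρ` for the radial derivative of `v`. On
almost every sphere the Poincaré inequality with constant `μ₁` (`muOne_mul_integral_sq_le`) bounds the
tangential energy below by `μ₁ r^{-2} H`, and `ρ² ≥ 2 (s / r) v ρ - (s / r)² v²` bounds the radial
energy; together `F' ≥ 2 s F / r + (μ₁ - s²) r^{q-2} H`. For `s ∈ (γ, γ₁⁺)` one has
`s² + (q - 1) s < μ₁`, and then a nonzero energy would force `H` to grow like `r^{2s}`, faster than
`r^{2γ}` (`energy_eq_zero_of_growth`). So the gradient of `v` vanishes (`gradient_eq_zero_of_growth`),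
and `v` is constant because `ℝ^n ∖ B_ε` is connected for `n ≥ 2` (`ae_eq_const_of_invariant`).

*Conclusion.* If `γ < 2`, the first `x`-differences of `u` are solutions that do not depend on `x`,
so they are constant, and linear in the step (`exists_linear_increment`). Inverting `A₃` one finds `ξ`
with the same increments along `x` and with `A ξ` tangent to the `x` directions
(`exists_matCLM_eq_coordEquiv`). Then `z ↦ ξ · z` is a solution (`isSol_inner`), and its difference
with `u` does not depend on `x`, so it is constant.

Weak gradients are handled as in the definition of the solutions: `H1Lim` is approximability by smooth
functions, for an arbitrary measure, and passes to differences, translates and slices.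
-/

namespace PerforatedLiouville

/-! ### Convergence in `L²` -/

lemma eLpNorm_two_sq {α F : Type*} [MeasurableSpace α] (μ : Measure α) [NormedAddCommGroup F]
    (f : α → F) : eLpNorm f 2 μ ^ 2 = ∫⁻ z, ‖f z‖ₑ ^ 2 ∂μ := by
  have := eLpNorm_nnreal_pow_eq_lintegral (μ := μ) (p := 2) (f := f) (by norm_num)
  simpa using this

/-- The pairing `∫ ⟪f, g⟫` is continuous for convergence in `L²` of both factors. -/
lemma tendsto_integral_inner {α F : Type*} [MeasurableSpace α] {μ : Measure α}
    [NormedAddCommGroup F] [InnerProductSpace ℝ F] {f g : α → F} {fs gs : ℕ → α → F}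
    (hf : MemLp f 2 μ) (hg : MemLp g 2 μ) (hfs : ∀ k, MemLp (fs k) 2 μ)
    (hgs : ∀ k, MemLp (gs k) 2 μ)
    (hft : Tendsto (fun k => eLpNorm (fs k - f) 2 μ) atTop (𝓝 0))
    (hgt : Tendsto (fun k => eLpNorm (gs k - g) 2 μ) atTop (𝓝 0)) :
    Tendsto (fun k => ∫ z, inner ℝ (fs k z) (gs k z) ∂μ) atTop (𝓝 (∫ z, inner ℝ (f z) (g z) ∂μ)) := by
  have h1 := (Lp.tendsto_Lp_iff_tendsto_eLpNorm'' fs hfs f hf).2 hft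
  have h2 := (Lp.tendsto_Lp_iff_tendsto_eLpNorm'' gs hgs g hg).2 hgt
  have key : ∀ (f g : α → F) (hf : MemLp f 2 μ) (hg : MemLp g 2 μ),
      ∫ z, inner ℝ (f z) (g z) ∂μ = inner ℝ (hf.toLp f) (hg.toLp g) := by
    intro f g hf hg
    rw [L2.inner_def]
    refine integral_congr_ae ?_
    filter_upwards [hf.coeFn_toLp, hg.coeFn_toLp] with z h1 h2
    rw [h1, h2]
  simp_rw [key _ _ hf hg, key _ _ (hfs _) (hgs _)]
  exact h1.inner h2

lemma integrable_inner_of_memLp {α F : Type*} [MeasurableSpace α] {μ : Measure α}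
    [NormedAddCommGroup F] [InnerProductSpace ℝ F] {f g : α → F}
    (hf : MemLp f 2 μ) (hg : MemLp g 2 μ) : Integrable (fun z => inner ℝ (f z) (g z)) μ := by
  refine (L2.integrable_inner (𝕜 := ℝ) (hf.toLp f) (hg.toLp g)).congr ?_
  filter_upwards [hf.coeFn_toLp, hg.coeFn_toLp] with z h1 h2
  rw [h1, h2]

section Gradient

variable {E : Type*} [NormedAddCommGroup E] [InnerProductSpace ℝ E] [FiniteDimensional ℝ E]

/-! ### Gradients -/

lemma gradient_sub' {f g : E → ℝ} (hf : Differentiable ℝ f) (hg : Differentiable ℝ g) (z : E) :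
    gradient (fun z => f z - g z) z = gradient f z - gradient g z := by
  refine ext_inner_right ℝ fun w => ?_
  rw [inner_sub_left, inner_gradient_left, inner_gradient_left, inner_gradient_left,
    fderiv_fun_sub (hf z) (hg z)]
  rfl

lemma gradient_mul' {f g : E → ℝ} (hf : Differentiable ℝ f) (hg : Differentiable ℝ g) (z : E) :
    gradient (fun z => f z * g z) z = f z • gradient g z + g z • gradient f z := by
  refine ext_inner_right ℝ fun w => ?_
  rw [inner_add_left, inner_smul_left, inner_smul_left, inner_gradient_left, inner_gradient_left,
    inner_gradient_left, fderiv_fun_mul (hf z) (hg z)]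
  rfl

/-- The chain rule for the gradient of `f ∘ (z ↦ z₀ + L z)`. -/
lemma gradient_comp_affine {F : Type*} [NormedAddCommGroup F] [InnerProductSpace ℝ F]
    [FiniteDimensional ℝ F] {f : E → ℝ} (hf : Differentiable ℝ f) (L : F →L[ℝ] E) (z₀ : E) (z : F) :
    gradient (fun z => f (z₀ + L z)) z = L.adjoint (gradient f (z₀ + L z)) := by
  refine ext_inner_right ℝ fun w => ?_
  rw [ContinuousLinearMap.adjoint_inner_left, inner_gradient_left, inner_gradient_left]
  have h1 : HasFDerivAt (fun z => z₀ + L z) L z := L.hasFDerivAt.const_add z₀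
  have h2 := ((hf (z₀ + L z)).hasFDerivAt).comp z h1
  have h3 : (f ∘ fun z => z₀ + L z) = fun z => f (z₀ + L z) := rfl
  rw [h3] at h2
  rw [h2.fderiv]
  rfl

lemma gradient_comp_add_right {f : E → ℝ} (h z : E) :
    gradient (fun z => f (z + h)) z = gradient f (z + h) := by
  refine ext_inner_right ℝ fun w => ?_
  rw [inner_gradient_left, inner_gradient_left, fderiv_comp_add_right]

lemma continuous_gradient {f : E → ℝ} (hf : ContDiff ℝ ∞ f) : Continuous (gradient f) :=
  (InnerProductSpace.toDual ℝ E).symm.continuous.comp (hf.continuous_fderiv (by simp))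

lemma hasCompactSupport_gradient {f : E → ℝ} (hf : HasCompactSupport f) :
    HasCompactSupport (gradient f) := by
  have := hf.fderiv (𝕜 := ℝ)
  exact this.comp_left (g := (InnerProductSpace.toDual ℝ E).symm) (map_zero _)

lemma gradient_inner_left (ξ z : E) : gradient (fun z => inner ℝ ξ z) z = ξ := by
  refine ext_inner_right ℝ fun w => ?_
  rw [inner_gradient_left]
  exact congrArg (fun L : E →L[ℝ] ℝ => L w) (innerSL ℝ ξ).hasFDerivAt.fderiv

end Gradient

section Generic

variable {E : Type*} [NormedAddCommGroup E] [InnerProductSpace ℝ E] [FiniteDimensional ℝ E]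
  [MeasurableSpace E]

/-! ### The space `H¹` of a measure -/

/-- `(u, G)` is a limit in `L²(μ)` of pairs `(φ, ∇φ)` with `φ` smooth. For `μ` the measure
`|y|^a dz` on `Ω` this is `IsH1 a Ω u G`. -/
def H1Lim (μ : Measure E) (u : E → ℝ) (G : E → E) : Prop :=
  MemLp u 2 μ ∧ MemLp G 2 μ ∧
    ∃ φ : ℕ → E → ℝ,
      (∀ k, ContDiff ℝ ∞ (φ k) ∧ MemLp (φ k) 2 μ ∧ MemLp (gradient (φ k)) 2 μ) ∧
      Tendsto (fun k => eLpNorm (φ k - u) 2 μ) atTop (𝓝 0) ∧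
      Tendsto (fun k => eLpNorm (gradient (φ k) - G) 2 μ) atTop (𝓝 0)

lemma H1Lim.mono_measure {μ μ' : Measure E} {u : E → ℝ} {G : E → E} (h : H1Lim μ u G)
    (hμ : μ' ≤ μ) : H1Lim μ' u G := by
  obtain ⟨h1, h2, φ, h3, h4, h5⟩ := h
  refine ⟨h1.mono_measure hμ, h2.mono_measure hμ, φ, fun k => ⟨(h3 k).1,
    (h3 k).2.1.mono_measure hμ, (h3 k).2.2.mono_measure hμ⟩, ?_, ?_⟩
  · exact tendsto_of_tendsto_of_tendsto_of_le_of_le tendsto_const_nhds h4 (fun _ => zero_le)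
      (fun _ => eLpNorm_mono_measure _ hμ)
  · exact tendsto_of_tendsto_of_tendsto_of_le_of_le tendsto_const_nhds h5 (fun _ => zero_le)
      (fun _ => eLpNorm_mono_measure _ hμ)

lemma H1Lim.congr {μ : Measure E} {u u' : E → ℝ} {G G' : E → E} (h : H1Lim μ u G)
    (hu : u =ᵐ[μ] u') (hG : G =ᵐ[μ] G') : H1Lim μ u' G' := by
  obtain ⟨h1, h2, φ, h3, h4, h5⟩ := h
  refine ⟨h1.ae_eq hu, h2.ae_eq hG, φ, h3, h4.congr fun k => eLpNorm_congr_ae ?_,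
    h5.congr fun k => eLpNorm_congr_ae ?_⟩
  · exact (ae_eq_refl _).sub hu
  · exact (ae_eq_refl _).sub hG

lemma tendsto_eLpNorm_sub_sub {α F : Type*} [MeasurableSpace α] {μ : Measure α}
    [NormedAddCommGroup F] {f g : α → F} {fs gs : ℕ → α → F}
    (hf : MemLp f 2 μ) (hg : MemLp g 2 μ) (hfs : ∀ k, MemLp (fs k) 2 μ)
    (hgs : ∀ k, MemLp (gs k) 2 μ)
    (hft : Tendsto (fun k => eLpNorm (fs k - f) 2 μ) atTop (𝓝 0))
    (hgt : Tendsto (fun k => eLpNorm (gs k - g) 2 μ) atTop (𝓝 0)) :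
    Tendsto (fun k => eLpNorm ((fs k - gs k) - (f - g)) 2 μ) atTop (𝓝 0) := by
  have h := hft.add hgt
  rw [add_zero] at h
  refine tendsto_of_tendsto_of_tendsto_of_le_of_le tendsto_const_nhds h (fun _ => zero_le) ?_
  intro k
  have : fs k - gs k - (f - g) = (fs k - f) - (gs k - g) := by abel
  simp only [this]
  exact eLpNorm_sub_le ((hfs k).sub hf).1 ((hgs k).sub hg).1 (by norm_num)

lemma H1Lim.sub {μ : Measure E} {u v : E → ℝ} {G K : E → E} (h : H1Lim μ u G)
    (h' : H1Lim μ v K) : H1Lim μ (u - v) (G - K) := by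
  obtain ⟨h1, h2, φ, h3, h4, h5⟩ := h
  obtain ⟨k1, k2, ψ, k3, k4, k5⟩ := h'
  have hg : ∀ k, gradient (φ k - ψ k) = gradient (φ k) - gradient (ψ k) := fun k => by
    ext1 z
    exact gradient_sub' ((h3 k).1.differentiable (by simp)) ((k3 k).1.differentiable (by simp)) z
  refine ⟨h1.sub k1, h2.sub k2, fun k => φ k - ψ k, fun k => ⟨(h3 k).1.sub (k3 k).1,
    (h3 k).2.1.sub (k3 k).2.1, ?_⟩, ?_, ?_⟩
  · rw [hg]; exact (h3 k).2.2.sub (k3 k).2.2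
  · exact tendsto_eLpNorm_sub_sub h1 k1 (fun k => (h3 k).2.1) (fun k => (k3 k).2.1) h4 k4
  · simp only [hg]
    exact tendsto_eLpNorm_sub_sub h2 k2 (fun k => (h3 k).2.2) (fun k => (k3 k).2.2) h5 k5

lemma h1Lim_of_contDiff {μ : Measure E} {u : E → ℝ} (hu : ContDiff ℝ ∞ u) (h1 : MemLp u 2 μ)
    (h2 : MemLp (gradient u) 2 μ) : H1Lim μ u (gradient u) :=
  ⟨h1, h2, fun _ => u, fun _ => ⟨hu, h1, h2⟩, by simp, by simp⟩

variable [BorelSpace E]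

lemma memLp_restrict_ball_of_continuous {F : Type*} [NormedAddCommGroup F] {ν : Measure E}
    [IsFiniteMeasureOnCompacts ν] {f : E → F} (hf : Continuous f) (R : ℝ) :
    MemLp f 2 (ν.restrict (Metric.ball 0 R)) := by
  have hfin : ν (Metric.ball (0 : E) R) < ⊤ := measure_ball_lt_top
  have : Fact (ν (Metric.ball (0 : E) R) < ⊤) := ⟨hfin⟩
  obtain ⟨C, hC⟩ := (isCompact_closedBall (0 : E) R).exists_bound_of_continuousOn hf.continuousOn
  refine MemLp.of_bound hf.aestronglyMeasurable C ?_
  filter_upwards [ae_restrict_mem Metric.isOpen_ball.measurableSet] with z hz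
  exact hC z (Metric.ball_subset_closedBall hz)

/-- The translation estimate for smooth functions: the difference `φ(· + h) - φ` is controlled by
`‖h‖ ∇φ` in `L²`, as soon as all the intermediate translates of `μ` are below `μ'`. -/
lemma eLpNorm_translate_sub_le_of_contDiff {μ μ' : Measure E} [SFinite μ] (h : E)
    (hμ : ∀ t ∈ Set.Icc (0 : ℝ) 1, μ.map (fun z => z + t • h) ≤ μ')
    {φ : E → ℝ} (hφ : ContDiff ℝ ∞ φ) :
    eLpNorm (fun z => φ (z + h) - φ z) 2 μ ≤ ‖h‖ₑ * eLpNorm (gradient φ) 2 μ' := by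
  have hcont := continuous_gradient hφ
  -- pointwise bound by the fundamental theorem of calculus and the Cauchy-Schwarz inequality
  have hpt : ∀ z, ‖φ (z + h) - φ z‖ₑ ^ 2
      ≤ ‖h‖ₑ ^ 2 * ∫⁻ t in Set.Icc (0 : ℝ) 1, ‖gradient φ (z + t • h)‖ₑ ^ 2 := by
    intro z
    have hderiv : ∀ t : ℝ, HasDerivAt (fun t : ℝ => φ (z + t • h))
        (inner ℝ (gradient φ (z + t • h)) h) t := by
      intro t
      have h1 : HasDerivAt (fun t : ℝ => z + t • h) h t := by
        simpa using ((hasDerivAt_id t).smul_const h).const_add z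
      have h2 := ((hφ.differentiable (by simp)) (z + t • h)).hasFDerivAt.comp_hasDerivAt t h1
      rw [inner_gradient_left]
      exact h2
    have hc : Continuous fun t : ℝ => inner ℝ (gradient φ (z + t • h)) h := by fun_prop
    have hftc := intervalIntegral.integral_eq_sub_of_hasDerivAt (a := 0) (b := 1)
      (fun t _ => hderiv t) (hc.intervalIntegrable _ _)
    simp only [one_smul, zero_smul, add_zero] at hftc
    rw [← hftc, intervalIntegral.integral_of_le zero_le_one]
    have : IsProbabilityMeasure ((volume : Measure ℝ).restrict (Set.Ioc 0 1)) :=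
      ⟨by simp⟩
    have h3 : ‖∫ t in Set.Ioc (0 : ℝ) 1, inner ℝ (gradient φ (z + t • h)) h‖ₑ
        ≤ ∫⁻ t in Set.Ioc (0 : ℝ) 1, ‖gradient φ (z + t • h)‖ₑ * ‖h‖ₑ := by
      refine (enorm_integral_le_lintegral_enorm _).trans (lintegral_mono fun t => ?_)
      simp only [← ofReal_norm]
      rw [← ENNReal.ofReal_mul (norm_nonneg _)]
      exact ENNReal.ofReal_le_ofReal (norm_inner_le_norm _ _)
    rw [lintegral_mul_const' _ _ enorm_ne_top] at h3
    have h4 : (∫⁻ t in Set.Ioc (0 : ℝ) 1, ‖gradient φ (z + t • h)‖ₑ) ^ 2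
        ≤ ∫⁻ t in Set.Ioc (0 : ℝ) 1, ‖gradient φ (z + t • h)‖ₑ ^ 2 := by
      have h5 := eLpNorm_le_eLpNorm_of_exponent_le
        (μ := (volume : Measure ℝ).restrict (Set.Ioc 0 1)) (p := 1) (q := 2)
        (f := fun t : ℝ => gradient φ (z + t • h)) (by norm_num)
        (by fun_prop)
      rw [eLpNorm_one_eq_lintegral_enorm] at h5
      have h6 := pow_le_pow_left' h5 2
      refine h6.trans (le_of_eq ?_)
      have := eLpNorm_nnreal_pow_eq_lintegral (μ := (volume : Measure ℝ).restrict (Set.Ioc 0 1))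
        (p := 2) (f := fun t : ℝ => gradient φ (z + t • h)) (by norm_num)
      simpa using this
    calc _ ≤ ((∫⁻ t in Set.Ioc (0 : ℝ) 1, ‖gradient φ (z + t • h)‖ₑ) * ‖h‖ₑ) ^ 2 :=
          pow_le_pow_left' h3 2
      _ = ‖h‖ₑ ^ 2 * (∫⁻ t in Set.Ioc (0 : ℝ) 1, ‖gradient φ (z + t • h)‖ₑ) ^ 2 := by ring
      _ ≤ _ := by
          rw [← restrict_Ioc_eq_restrict_Icc]
          gcongr
  have hmain : eLpNorm (fun z => φ (z + h) - φ z) 2 μ ^ 2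
      ≤ (‖h‖ₑ * eLpNorm (gradient φ) 2 μ') ^ 2 := by
    rw [mul_pow, eLpNorm_two_sq, eLpNorm_two_sq]
    calc _ ≤ ∫⁻ z, ‖h‖ₑ ^ 2 * (∫⁻ t in Set.Icc (0 : ℝ) 1, ‖gradient φ (z + t • h)‖ₑ ^ 2) ∂μ :=
          lintegral_mono hpt
      _ = ‖h‖ₑ ^ 2 * ∫⁻ z, (∫⁻ t in Set.Icc (0 : ℝ) 1, ‖gradient φ (z + t • h)‖ₑ ^ 2) ∂μ := by
          rw [lintegral_const_mul' _ _ (by simp)]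
      _ = ‖h‖ₑ ^ 2 * ∫⁻ t in Set.Icc (0 : ℝ) 1, (∫⁻ z, ‖gradient φ (z + t • h)‖ₑ ^ 2 ∂μ) := by
          rw [lintegral_lintegral_swap]
          refine Continuous.aemeasurable ?_
          fun_prop
      _ ≤ ‖h‖ₑ ^ 2 * ∫⁻ t in Set.Icc (0 : ℝ) 1, (∫⁻ z, ‖gradient φ z‖ₑ ^ 2 ∂μ') := by
          refine mul_le_mul_right ?_ _
          refine setLIntegral_mono' measurableSet_Icc fun t ht => ?_
          refine le_trans (le_of_eq ?_) (lintegral_mono' (hμ t ht) le_rfl)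
          rw [lintegral_map (by fun_prop) (by fun_prop)]
      _ = _ := by simp
  exact (ENNReal.pow_le_pow_left_iff two_ne_zero).1 hmain

/-- The translation estimate passes to limits of smooth functions. -/
lemma H1Lim.eLpNorm_translate_sub_le {μ μ' : Measure E} [SFinite μ] {u : E → ℝ} {G : E → E}
    (hu : H1Lim μ' u G) (h : E)
    (hμ : ∀ t ∈ Set.Icc (0 : ℝ) 1, μ.map (fun z => z + t • h) ≤ μ') :
    eLpNorm (fun z => u (z + h) - u z) 2 μ ≤ ‖h‖ₑ * eLpNorm G 2 μ' := by
  obtain ⟨h1, h2, φ, h3, h4, h5⟩ := hu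
  have hμ0 : μ ≤ μ' := by simpa using hμ 0 (by simp)
  have hμ1 : μ.map (fun z => z + h) ≤ μ' := by simpa using hμ 1 (by simp)
  have hmeas : Measurable fun z : E => z + h := by fun_prop
  have hcomp : ∀ f : E → ℝ, MemLp f 2 μ' →
      AEStronglyMeasurable (fun z => f (z + h)) μ ∧
        eLpNorm (fun z => f (z + h)) 2 μ ≤ eLpNorm f 2 μ' := by
    intro f hf
    have hf' := (hf.mono_measure hμ1).1
    refine ⟨hf'.comp_measurable hmeas, ?_⟩
    have := eLpNorm_map_measure (p := 2) hf' hmeas.aemeasurable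
    refine le_trans (le_of_eq this.symm) (eLpNorm_mono_measure _ hμ1)
  have hlim1 : Tendsto (fun k => eLpNorm (φ k - u) 2 μ' + ‖h‖ₑ * (eLpNorm (gradient (φ k) - G) 2 μ'
      + eLpNorm G 2 μ') + eLpNorm (φ k - u) 2 μ') atTop
      (𝓝 (0 + ‖h‖ₑ * (0 + eLpNorm G 2 μ') + 0)) := by
    refine (h4.add (ENNReal.Tendsto.const_mul (h5.add tendsto_const_nhds) ?_)).add h4
    exact Or.inr (by simp)
  simp only [zero_add, add_zero] at hlim1
  refine ge_of_tendsto' hlim1 fun k => ?_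
  have hd := ((h3 k).2.1.sub h1)
  have e1 : (fun z => u (z + h) - u z) = (fun z => (φ k (z + h) - φ k z))
      - (fun z => (φ k - u) (z + h)) + (φ k - u) := by
    ext z; simp
  have hφm : AEStronglyMeasurable (fun z => φ k (z + h) - φ k z) μ := by
    have := (h3 k).1.continuous
    exact Continuous.aestronglyMeasurable (by fun_prop)
  have hum := (hcomp _ hd).1
  rw [e1]
  refine (eLpNorm_add_le (hφm.sub hum) (hd.mono_measure hμ0).1 (by norm_num)).trans ?_
  refine add_le_add ?_ (eLpNorm_mono_measure _ hμ0)
  refine (eLpNorm_sub_le hφm hum (by norm_num)).trans ?_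
  rw [add_comm]
  refine add_le_add (hcomp _ hd).2 ?_
  refine (eLpNorm_translate_sub_le_of_contDiff h hμ (h3 k).1).trans ?_
  gcongr
  have e2 : gradient (φ k) = (gradient (φ k) - G) + G := by simp
  conv_lhs => rw [e2]
  exact eLpNorm_add_le ((h3 k).2.2.sub h2).1 h2.1 (by norm_num)

lemma tendsto_eLpNorm_of_le_smul {α F : Type*} [MeasurableSpace α] [NormedAddCommGroup F]
    {κ μ : Measure α} {c : ENNReal} (hc : c ≠ ⊤) (h : κ ≤ c • μ) {fs : ℕ → α → F}
    (hfs : Tendsto (fun k => eLpNorm (fs k) 2 μ) atTop (𝓝 0)) :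
    Tendsto (fun k => eLpNorm (fs k) 2 κ) atTop (𝓝 0) := by
  have h1 : Tendsto (fun k => c ^ (1 / (2 : ENNReal).toReal) * eLpNorm (fs k) 2 μ) atTop
      (𝓝 (c ^ (1 / (2 : ENNReal).toReal) * 0)) :=
    ENNReal.Tendsto.const_mul hfs (Or.inr (ENNReal.rpow_ne_top_of_nonneg (by norm_num) hc))
  rw [mul_zero] at h1
  refine tendsto_of_tendsto_of_tendsto_of_le_of_le tendsto_const_nhds h1 (fun _ => zero_le) ?_
  intro k
  refine (eLpNorm_mono_measure _ h).trans ?_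
  rw [eLpNorm_smul_measure_of_ne_top (by norm_num)]
  simp

/-- Integration by parts: on the region where `μ` controls the Lebesgue measure, the gradient `G`
pairs with test functions as `-u` with their derivatives. -/
lemma H1Lim.integral_inner_smul {μ : Measure E} {u : E → ℝ} {G : E → E} (hG : H1Lim μ u G)
    {ψ : E → ℝ} (hψ : ContDiff ℝ ∞ ψ) (hψc : HasCompactSupport ψ) {c : ENNReal} (hc : c ≠ ⊤)
    (hcK : volume.restrict (tsupport ψ) ≤ c • μ) (e : E) :
    ∫ z, inner ℝ (G z) (ψ z • e) = - ∫ z, u z * fderiv ℝ ψ z e := by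
  set κ := (volume : Measure E).restrict (tsupport ψ) with hκ
  obtain ⟨h1, h2, φ, h3, h4, h5⟩ := hG
  have hd : Continuous (fun z => fderiv ℝ ψ z e) :=
    (hψ.continuous_fderiv (by simp)).clm_apply continuous_const
  have hdc : HasCompactSupport (fun z => fderiv ℝ ψ z e) :=
    (hψc.fderiv (𝕜 := ℝ)).comp_left (g := fun L : E →L[ℝ] ℝ => L e) rfl
  have hψe : Continuous fun z => ψ z • e := by have := hψ.continuous; fun_prop
  have hψec : HasCompactSupport fun z => ψ z • e :=
    hψc.comp_left (g := fun t : ℝ => t • e) (by simp)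
  have : IsFiniteMeasureOnCompacts κ := by rw [hκ]; infer_instance
  have hm1 : MemLp (fun z => ψ z • e) 2 κ := hψe.memLp_of_hasCompactSupport hψec
  have hm2 : MemLp (fun z => fderiv ℝ ψ z e) 2 κ := hd.memLp_of_hasCompactSupport hdc
  have n1 : MemLp u 2 κ := (h1.smul_measure hc).mono_measure hcK
  have n2 : MemLp G 2 κ := (h2.smul_measure hc).mono_measure hcK
  have n3 : ∀ k, MemLp (φ k) 2 κ := fun k => ((h3 k).2.1.smul_measure hc).mono_measure hcK
  have n4 : ∀ k, MemLp (gradient (φ k)) 2 κ :=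
    fun k => ((h3 k).2.2.smul_measure hc).mono_measure hcK
  have L1 := tendsto_integral_inner n2 hm1 n4 (fun _ => hm1)
    (tendsto_eLpNorm_of_le_smul hc hcK h5) (by simp)
  have L2 := tendsto_integral_inner n1 hm2 n3 (fun _ => hm2)
    (tendsto_eLpNorm_of_le_smul hc hcK h4) (by simp)
  have s1 : ∀ G : E → E, ∫ z, inner ℝ (G z) (ψ z • e) ∂κ = ∫ z, inner ℝ (G z) (ψ z • e) := by
    intro G
    refine setIntegral_eq_integral_of_forall_compl_eq_zero fun z hz => ?_
    rw [image_eq_zero_of_notMem_tsupport hz]; simp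
  have s2 : ∀ u : E → ℝ, ∫ z, inner ℝ (u z) (fderiv ℝ ψ z e) ∂κ
      = ∫ z, u z * fderiv ℝ ψ z e := by
    intro u
    have : ∀ z, inner ℝ (u z) (fderiv ℝ ψ z e) = u z * fderiv ℝ ψ z e := fun z => by
      simp [mul_comm]
    simp_rw [this]
    refine setIntegral_eq_integral_of_forall_compl_eq_zero fun z hz => ?_
    have : fderiv ℝ ψ z = 0 := image_eq_zero_of_notMem_tsupport
      (fun h => hz (tsupport_fderiv_subset ℝ h))
    rw [this]; simp
  simp_rw [s1] at L1
  simp_rw [s2] at L2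
  have hk : ∀ k, ∫ z, inner ℝ (gradient (φ k) z) (ψ z • e)
      = - ∫ z, φ k z * fderiv ℝ ψ z e := by
    intro k
    have hφ := (h3 k).1
    have hφd : Continuous fun z => fderiv ℝ (φ k) z e :=
      (hφ.continuous_fderiv (by simp)).clm_apply continuous_const
    rw [integral_mul_fderiv_eq_neg_fderiv_mul_of_integrable]
    · rw [neg_neg]
      refine integral_congr_ae (Eventually.of_forall fun z => ?_)
      simp only [inner_smul_right, inner_gradient_left]
      ring
    · exact (hφd.mul hψ.continuous).integrable_of_hasCompactSupport hψc.mul_left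
    · exact (hφ.continuous.mul hd).integrable_of_hasCompactSupport hdc.mul_left
    · exact (hφ.continuous.mul hψ.continuous).integrable_of_hasCompactSupport hψc.mul_left
    · exact fun z _ => hφ.differentiable (by simp) z
    · exact fun z _ => hψ.differentiable (by simp) z
  simp_rw [hk] at L1
  exact tendsto_nhds_unique L1 L2.neg

/-- The gradient of a limit of smooth functions is determined on an open set on which `μ` is
locally bounded below by the Lebesgue measure. -/
lemma H1Lim.gradient_unique {μ : Measure E} {u : E → ℝ} {G G' : E → E} (h : H1Lim μ u G)
    (h' : H1Lim μ u G') {U : Set E} (hU : IsOpen U)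
    (hμ : ∀ K ⊆ U, IsCompact K → ∃ c : ENNReal, c ≠ ⊤ ∧ volume.restrict K ≤ c • μ) :
    ∀ᵐ z, z ∈ U → G z = G' z := by
  have hloc : ∀ f : E → E, MemLp f 2 μ → LocallyIntegrableOn f U := by
    intro f hf
    rw [locallyIntegrableOn_iff hU.isLocallyClosed]
    intro K hK hKc
    obtain ⟨c, hc, hcK⟩ := hμ K hK hKc
    have : Fact ((volume : Measure E) K < ⊤) := ⟨hKc.measure_lt_top⟩
    exact ((hf.smul_measure hc).mono_measure hcK).integrable (by norm_num)
  have hdiff : ∀ᵐ z, z ∈ U → G z - G' z = 0 := by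
    refine hU.ae_eq_zero_of_integral_contDiff_smul_eq_zero
      (f := fun z => G z - G' z) ((hloc G h.2.1).sub (hloc G' h'.2.1)) fun ψ hψ hψc hψU => ?_
    refine ext_inner_right ℝ fun e => ?_
    have hint : ∀ G : E → E, H1Lim μ u G → Integrable fun z => ψ z • G z := by
      intro G hG
      have h1 : IntegrableOn G (tsupport ψ) :=
        (hloc G hG.2.1).integrableOn_compact_subset hψU hψc
      have h2 : IntegrableOn (fun z => ψ z • G z) (tsupport ψ) :=
        h1.continuousOn_smul hψ.continuous.continuousOn hψc
      refine (integrableOn_iff_integrable_of_support_subset fun z hz => ?_).1 h2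
      by_contra hz'
      exact hz (by simp [image_eq_zero_of_notMem_tsupport hz'])
    obtain ⟨c, hc, hcK⟩ := hμ _ hψU hψc
    simp only [smul_sub]
    rw [integral_sub (hint G h) (hint G' h'), inner_sub_left, inner_zero_left, real_inner_comm,
      real_inner_comm e (∫ z, ψ z • G' z), ← integral_inner (hint G h), ← integral_inner (hint G' h')]
    have e1 := h.integral_inner_smul hψ hψc hc hcK e
    have e2 := h'.integral_inner_smul hψ hψc hc hcK e
    have c : ∀ G : E → E, ∫ z, inner ℝ e (ψ z • G z) = ∫ z, inner ℝ (G z) (ψ z • e) := fun G =>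
      integral_congr_ae (Eventually.of_forall fun z => by
        simp only [inner_smul_right, real_inner_comm])
    rw [c, c, e1, e2, sub_self]
  filter_upwards [hdiff] with z hz hzU
  exact sub_eq_zero.1 (hz hzU)

/-! ### Solutions -/

/-- `u`, with weak gradient `G`, is locally in `H¹` for the measure `ν` and solves
`∫ A G · ∇φ dν = 0` for all test functions. -/
def IsSol (ν : Measure E) (A : E →L[ℝ] E) (u : E → ℝ) (G : E → E) : Prop :=
  (∀ R : ℝ, H1Lim (ν.restrict (Metric.ball 0 R)) u G) ∧
    ∀ φ : E → ℝ, ContDiff ℝ ∞ φ → HasCompactSupport φ →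
      ∫ z, inner ℝ (A (G z)) (gradient φ z) ∂ν = 0

lemma exists_tsupport_subset_ball {X F : Type*} [NormedAddCommGroup X] [Zero F] {η : X → F}
    (h : HasCompactSupport η) : ∃ R : ℝ, tsupport η ⊆ Metric.ball 0 R := by
  obtain ⟨R, hR⟩ := h.isBounded.subset_ball (0 : X)
  exact ⟨R, hR⟩

lemma memLp_two_of_bounded_mul {α F F' : Type*} [MeasurableSpace α] {μ : Measure α}
    [NormedAddCommGroup F] [NormedAddCommGroup F'] {f : α → F} {g : α → F'} (hg : MemLp g 2 μ)
    (hf : AEStronglyMeasurable f μ) (C : ℝ) (h : ∀ z, ‖f z‖ ≤ C * ‖g z‖) : MemLp f 2 μ :=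
  MemLp.of_le_mul hg hf (Eventually.of_forall h)

lemma IsSol.integrable_inner_gradient {ν : Measure E} {A : E →L[ℝ] E} [IsFiniteMeasureOnCompacts ν]
    {u : E → ℝ} {G : E → E} (h : IsSol ν A u G) {φ : E → ℝ} (hφ : ContDiff ℝ ∞ φ)
    (hφc : HasCompactSupport φ) : Integrable (fun z => inner ℝ (A (G z)) (gradient φ z)) ν := by
  obtain ⟨R, hR⟩ := exists_tsupport_subset_ball (hasCompactSupport_gradient hφc)
  have hG := (h.1 R).2.1
  have hAG : MemLp (fun z => A (G z)) 2 (ν.restrict (Metric.ball 0 R)) :=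
    memLp_two_of_bounded_mul hG (A.continuous.comp_aestronglyMeasurable hG.1) ‖A‖
      fun z => A.le_opNorm _
  have h1 := integrable_inner_of_memLp hAG
    (memLp_restrict_ball_of_continuous (ν := ν) (continuous_gradient hφ) R)
  refine (integrableOn_iff_integrable_of_support_subset fun z hz => ?_).1 h1
  by_contra hz'
  exact hz (by simp [image_eq_zero_of_notMem_tsupport (fun h => hz' (hR h))])

lemma IsSol.sub {ν : Measure E} [IsFiniteMeasureOnCompacts ν] {A : E →L[ℝ] E} {u v : E → ℝ}
    {G K : E → E} (h : IsSol ν A u G) (h' : IsSol ν A v K) : IsSol ν A (u - v) (G - K) := by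
  refine ⟨fun R => (h.1 R).sub (h'.1 R), fun φ hφ hφc => ?_⟩
  simp only [Pi.sub_apply, map_sub, inner_sub_left]
  rw [integral_sub (h.integrable_inner_gradient hφ hφc) (h'.integrable_inner_gradient hφ hφc),
    h.2 φ hφ hφc, h'.2 φ hφ hφc, sub_zero]

lemma isSol_const (ν : Measure E) [IsFiniteMeasureOnCompacts ν] (A : E →L[ℝ] E) (c : ℝ) :
    IsSol ν A (fun _ => c) 0 := by
  have hg : gradient (fun _ : E => c) = 0 := gradient_fun_const' c
  refine ⟨fun R => ?_, fun φ _ _ => by simp⟩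
  rw [← hg]
  refine h1Lim_of_contDiff contDiff_const (memLp_restrict_ball_of_continuous continuous_const R) ?_
  rw [hg]
  exact MemLp.zero

/-- Testing the equation with `η u`. -/
lemma IsSol.integral_cutoff {ν : Measure E} [IsFiniteMeasureOnCompacts ν] {A : E →L[ℝ] E}
    {u : E → ℝ} {G : E → E} (h : IsSol ν A u G) {η : E → ℝ} (hη : ContDiff ℝ ∞ η)
    (hηc : HasCompactSupport η) :
    Integrable (fun z => η z * inner ℝ (A (G z)) (G z)) ν ∧
    Integrable (fun z => u z * inner ℝ (A (G z)) (gradient η z)) ν ∧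
    ∫ z, η z * inner ℝ (A (G z)) (G z) ∂ν + ∫ z, u z * inner ℝ (A (G z)) (gradient η z) ∂ν = 0 := by
  obtain ⟨R, hR⟩ := exists_tsupport_subset_ball hηc
  have hRg : ∀ z ∉ Metric.ball (0 : E) R, gradient η z = 0 := by
    intro z hz
    have : fderiv ℝ η z = 0 := image_eq_zero_of_notMem_tsupport
        (fun h => hz (hR (tsupport_fderiv_subset ℝ h)))
    simp [gradient, this]
  have hR0 : ∀ z ∉ Metric.ball (0 : E) R, η z = 0 := fun z hz =>
    image_eq_zero_of_notMem_tsupport (fun h => hz (hR h))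
  set κ := ν.restrict (Metric.ball (0 : E) R) with hκ
  have hH : H1Lim κ u G := h.1 R
  obtain ⟨hu, hG, φ, h3, h4, h5⟩ := hH
  have hAGm := A.continuous.comp_aestronglyMeasurable hG.1
  obtain ⟨C1, hC1⟩ := hηc.exists_bound_of_continuous hη.continuous
  obtain ⟨C2, hC2⟩ := (hasCompactSupport_gradient hηc).exists_bound_of_continuous
    (continuous_gradient hη)
  have m1 : MemLp (fun z => η z • A (G z)) 2 κ := by
    refine memLp_two_of_bounded_mul hG (hη.continuous.aestronglyMeasurable.smul hAGm) (C1 * ‖A‖) ?_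
    intro z
    rw [norm_smul, mul_assoc]
    exact mul_le_mul (hC1 z) (A.le_opNorm _) (norm_nonneg _) ((norm_nonneg _).trans (hC1 z))
  have m2 : MemLp (fun z => inner ℝ (A (G z)) (gradient η z)) 2 κ := by
    refine memLp_two_of_bounded_mul hG
      (hAGm.inner (continuous_gradient hη).aestronglyMeasurable) (‖A‖ * C2) ?_
    intro z
    refine (norm_inner_le_norm _ _).trans ?_
    calc ‖A (G z)‖ * ‖gradient η z‖ ≤ (‖A‖ * ‖G z‖) * C2 :=
          mul_le_mul (A.le_opNorm _) (hC2 z) (norm_nonneg _) (by positivity)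
      _ = _ := by ring
  have sw1 : ∀ K : E → E, (fun z => inner ℝ (K z) (η z • A (G z)))
      = fun z => η z * inner ℝ (A (G z)) (K z) := by
    intro K; ext z; rw [inner_smul_right, real_inner_comm]
  have sw2 : ∀ w : E → ℝ, (fun z => inner ℝ (w z) (inner ℝ (A (G z)) (gradient η z)))
      = fun z => w z * inner ℝ (A (G z)) (gradient η z) := by
    intro w; ext z; simp [mul_comm]
  have supp1 : ∀ K : E → E, Function.support (fun z => η z * inner ℝ (A (G z)) (K z))
      ⊆ Metric.ball (0 : E) R := by
    intro K z hz; by_contra hz'; exact hz (by simp [hR0 z hz'])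
  have supp2 : ∀ w : E → ℝ, Function.support (fun z => w z * inner ℝ (A (G z)) (gradient η z))
      ⊆ Metric.ball (0 : E) R := by
    intro w z hz; by_contra hz'; exact hz (by simp [hRg z hz'])
  have int1 : ∀ K : E → E, MemLp K 2 κ → Integrable (fun z => η z * inner ℝ (A (G z)) (K z)) ν := by
    intro K hK
    have := integrable_inner_of_memLp hK m1
    rw [sw1] at this
    exact (integrableOn_iff_integrable_of_support_subset (supp1 K)).1 this
  have int2 : ∀ w : E → ℝ, MemLp w 2 κ →
      Integrable (fun z => w z * inner ℝ (A (G z)) (gradient η z)) ν := by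
    intro w hw
    have := integrable_inner_of_memLp hw m2
    rw [sw2] at this
    exact (integrableOn_iff_integrable_of_support_subset (supp2 w)).1 this
  refine ⟨int1 G hG, int2 u hu, ?_⟩
  have L1 := tendsto_integral_inner hG m1 (fun k => (h3 k).2.2) (fun _ => m1) h5 (by simp)
  have L2 := tendsto_integral_inner hu m2 (fun k => (h3 k).2.1) (fun _ => m2) h4 (by simp)
  have r1 : ∀ K : E → E, ∫ z, inner ℝ (K z) (η z • A (G z)) ∂κ
      = ∫ z, η z * inner ℝ (A (G z)) (K z) ∂ν := fun K => by
    rw [sw1]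
    exact setIntegral_eq_integral_of_forall_compl_eq_zero fun z hz => by simp [hR0 z hz]
  have r2 : ∀ w : E → ℝ, ∫ z, inner ℝ (w z) (inner ℝ (A (G z)) (gradient η z)) ∂κ
      = ∫ z, w z * inner ℝ (A (G z)) (gradient η z) ∂ν := fun w => by
    rw [sw2]
    exact setIntegral_eq_integral_of_forall_compl_eq_zero fun z hz => by simp [hRg z hz]
  simp_rw [r1] at L1
  simp_rw [r2] at L2
  refine tendsto_nhds_unique (L1.add L2) ?_
  refine tendsto_const_nhds.congr fun k => ?_
  rw [← integral_add (int1 _ (h3 k).2.2) (int2 _ (h3 k).2.1)]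
  have := h.2 (fun z => η z * φ k z) (hη.mul (h3 k).1) hηc.mul_right
  rw [← this]
  refine integral_congr_ae (Eventually.of_forall fun z => ?_)
  simp only
  rw [gradient_mul' (hη.differentiable (by simp)) ((h3 k).1.differentiable (by simp)),
    inner_add_right, inner_smul_right, inner_smul_right]

lemma IsSol.translate {ν : Measure E} {A : E →L[ℝ] E} {u : E → ℝ} {G : E → E} {h : E}
    (hν : MeasurePreserving (fun z => z + h) ν ν) (hs : IsSol ν A u G) :
    IsSol ν A (fun z => u (z + h)) (fun z => G (z + h)) := by
  have hemb : MeasurableEmbedding (fun z : E => z + h) := measurableEmbedding_addRight h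
  constructor
  · intro R
    have hsub : Metric.ball (0 : E) R ⊆ (fun z => z + h) ⁻¹' Metric.ball (0 : E) (R + ‖h‖) := by
      intro z hz
      simp only [Set.mem_preimage, Metric.mem_ball, dist_zero_right] at hz ⊢
      exact (norm_add_le _ _).trans_lt (by linarith)
    have hmp := hν.restrict_preimage_emb hemb (Metric.ball (0 : E) (R + ‖h‖))
    obtain ⟨h1, h2, φ, h3, h4, h5⟩ := hs.1 (R + ‖h‖)
    refine H1Lim.mono_measure ?_ (Measure.restrict_mono_set ν hsub)
    have hgrad : ∀ k, gradient (fun z => φ k (z + h)) = gradient (φ k) ∘ (fun z => z + h) :=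
      fun k => by ext1 z; exact gradient_comp_add_right h z
    refine ⟨h1.comp_measurePreserving hmp, h2.comp_measurePreserving hmp,
      fun k z => φ k (z + h), fun k => ⟨(h3 k).1.comp (contDiff_id.add contDiff_const),
        (h3 k).2.1.comp_measurePreserving hmp, ?_⟩, ?_, ?_⟩
    · rw [hgrad]; exact (h3 k).2.2.comp_measurePreserving hmp
    · refine h4.congr fun k => ?_
      rw [← eLpNorm_comp_measurePreserving ((h3 k).2.1.sub h1).1 hmp]
      rfl
    · refine h5.congr fun k => ?_
      rw [← eLpNorm_comp_measurePreserving ((h3 k).2.2.sub h2).1 hmp, hgrad]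
      rfl
  · intro φ hφ hφc
    have h1 := hs.2 (fun z => φ (z + -h)) (hφ.comp (contDiff_id.add contDiff_const))
      (hφc.comp_homeomorph (Homeomorph.addRight (-h)))
    rw [← hν.integral_comp hemb] at h1
    rw [← h1]
    refine integral_congr_ae (Eventually.of_forall fun z => ?_)
    have e := gradient_comp_add_right (f := φ) (-h) (z + h)
    simp only [e, add_neg_cancel_right]

end Generic

/-! ### The Caccioppoli inequality -/

section Generic

variable {E : Type*} [NormedAddCommGroup E] [InnerProductSpace ℝ E] [FiniteDimensional ℝ E]

/-- Cutoff functions between `B_R` and `B_{2R}`, with gradients bounded by `K / R`. -/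
lemma exists_cutoff (E : Type*) [NormedAddCommGroup E] [InnerProductSpace ℝ E]
    [FiniteDimensional ℝ E] : ∃ K : ℝ, 0 ≤ K ∧ ∀ R : ℝ, 0 < R → ∃ η : E → ℝ,
    ContDiff ℝ ∞ η ∧ HasCompactSupport η ∧ (∀ z ∈ Metric.ball (0 : E) R, η z = 1) ∧
    (∀ z ∉ Metric.ball (0 : E) (2 * R), η z = 0) ∧ (∀ z ∉ Metric.ball (0 : E) (2 * R),
      gradient η z = 0) ∧ ∀ z, ‖gradient η z‖ ≤ K / R := by
  let f : ContDiffBump (0 : E) := ⟨1, 3 / 2, by norm_num, by norm_num⟩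
  have hf : ContDiff ℝ ∞ f := f.contDiff
  obtain ⟨K, hK⟩ := (hasCompactSupport_gradient f.hasCompactSupport).exists_bound_of_continuous
    (continuous_gradient hf)
  refine ⟨K, (norm_nonneg _).trans (hK 0), fun R hR => ?_⟩
  let L : E →L[ℝ] E := R⁻¹ • ContinuousLinearMap.id ℝ E
  have hR' : R⁻¹ ≠ 0 := by positivity
  have hLz : ∀ z, (0 : E) + L z = R⁻¹ • z := fun z => by simp [L]
  have hgrad : ∀ z, gradient (fun z => f (0 + L z)) z = R⁻¹ • gradient f (R⁻¹ • z) := by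
    intro z
    rw [gradient_comp_affine (hf.differentiable (by simp)), hLz]
    refine ext_inner_right ℝ fun w => ?_
    rw [ContinuousLinearMap.adjoint_inner_left]
    simp [L, inner_smul_left, inner_smul_right]
  have hsupp : ∀ z ∉ Metric.ball (0 : E) (2 * R), R⁻¹ • z ∉ tsupport f := by
    intro z hz
    rw [f.tsupport_eq]
    simp only [Metric.mem_ball, dist_zero_right, not_lt, Metric.mem_closedBall, norm_smul,
      norm_inv, Real.norm_eq_abs, abs_of_pos hR, not_le] at hz ⊢
    have : (3 : ℝ) / 2 < 2 := by norm_num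
    refine this.trans_le ?_
    rw [inv_mul_eq_div, le_div_iff₀ hR]
    exact hz
  refine ⟨fun z => f (0 + L z), hf.comp (contDiff_const.add L.contDiff), ?_, ?_, ?_, ?_, ?_⟩
  · simp only [hLz]
    exact f.hasCompactSupport.comp_smul hR'
  · intro z hz
    simp only [hLz]
    refine f.one_of_mem_closedBall ?_
    simp only [Metric.mem_ball, dist_zero_right, Metric.mem_closedBall, norm_smul,
      norm_inv, Real.norm_eq_abs, abs_of_pos hR] at hz ⊢
    change _ ≤ (1 : ℝ)
    rw [inv_mul_eq_div, div_le_iff₀ hR]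
    linarith
  · intro z hz
    simp only [hLz]
    exact image_eq_zero_of_notMem_tsupport (hsupp z hz)
  · intro z hz
    rw [hgrad]
    have : fderiv ℝ f (R⁻¹ • z) = 0 := image_eq_zero_of_notMem_tsupport
      (fun h => hsupp z hz (tsupport_fderiv_subset ℝ h))
    simp [gradient, this]
  · intro z
    rw [hgrad, norm_smul, norm_inv, Real.norm_eq_abs, abs_of_pos hR, inv_mul_eq_div]
    gcongr
    exact hK _

variable [MeasurableSpace E] [BorelSpace E]

lemma integrable_norm_sq_of_memLp {α F : Type*} [MeasurableSpace α] {μ : Measure α}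
    [NormedAddCommGroup F] {f : α → F} (hf : MemLp f 2 μ) : Integrable (fun z => ‖f z‖ ^ 2) μ := by
  simpa using hf.integrable_norm_rpow (by norm_num) (by norm_num)

lemma eLpNorm_two_sq_eq_ofReal {α F : Type*} [MeasurableSpace α] {μ : Measure α}
    [NormedAddCommGroup F] {f : α → F} (hf : MemLp f 2 μ) :
    eLpNorm f 2 μ ^ 2 = ENNReal.ofReal (∫ z, ‖f z‖ ^ 2 ∂μ) := by
  rw [eLpNorm_two_sq, ofReal_integral_eq_lintegral_ofReal (integrable_norm_sq_of_memLp hf)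
    (Eventually.of_forall fun z => by positivity)]
  simp_rw [ENNReal.ofReal_pow (norm_nonneg _), ofReal_norm]

/-- The Caccioppoli inequality. -/
theorem caccioppoli {ν : Measure E} [IsFiniteMeasureOnCompacts ν] {A : E →L[ℝ] E} {lam : ℝ}
    (hlam : 0 < lam) (hA : ∀ ξ, lam * ‖ξ‖ ^ 2 ≤ inner ℝ (A ξ) ξ) :
    ∃ C : ℝ, 0 ≤ C ∧ ∀ (u : E → ℝ) (G : E → E), IsSol ν A u G → ∀ R : ℝ, 0 < R →
      eLpNorm G 2 (ν.restrict (Metric.ball 0 R))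
        ≤ ENNReal.ofReal (C / R) * eLpNorm u 2 (ν.restrict (Metric.ball 0 (2 * R))) := by
  obtain ⟨K, hK0, hK⟩ := exists_cutoff E
  refine ⟨2 * ‖A‖ / lam * K, by positivity, fun u G hs R hR => ?_⟩
  obtain ⟨η, hη, hηc, hη1, hη0, hηg0, hηg⟩ := hK R hR
  obtain ⟨i1, i2, hid⟩ := hs.integral_cutoff (η := fun z => η z * η z) (hη.mul hη) hηc.mul_left
  have hηd : Differentiable ℝ η := hη.differentiable (by simp)
  have hg2 : ∀ z, gradient (fun z => η z * η z) z = (2 * η z) • gradient η z := by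
    intro z; rw [gradient_mul' hηd hηd, two_mul, add_smul]
  simp only [hg2, inner_smul_right] at i2 hid
  set κ := ν.restrict (Metric.ball (0 : E) (2 * R)) with hκ
  have hu : MemLp u 2 κ := (hs.1 (2 * R)).1
  have hG : MemLp G 2 κ := (hs.1 (2 * R)).2.1
  obtain ⟨C1, hC1⟩ := hηc.exists_bound_of_continuous hη.continuous
  have hηG : MemLp (fun z => η z • G z) 2 κ := by
    refine memLp_two_of_bounded_mul hG (hη.continuous.aestronglyMeasurable.smul hG.1) C1 ?_
    intro z
    rw [norm_smul]
    gcongr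
    exact hC1 z
  have hzero : ∀ f : E → ℝ, (∀ z, η z = 0 → f z = 0) →
      ∫ z, f z ∂ν = ∫ z, f z ∂κ := fun f hf =>
    (setIntegral_eq_integral_of_forall_compl_eq_zero fun z hz => hf z (hη0 z hz)).symm
  rw [hzero _ (fun z hz => by simp [hz]), hzero _ (fun z hz => by simp [hz])] at hid
  have i1' : Integrable (fun z => η z * η z * inner ℝ (A (G z)) (G z)) κ := i1.restrict
  have i2' : Integrable (fun z => u z * (2 * η z * inner ℝ (A (G z)) (gradient η z))) κ :=
    i2.restrict
  have i3 : Integrable (fun z => ‖η z • G z‖ ^ 2) κ := integrable_norm_sq_of_memLp hηG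
  have i4 : Integrable (fun z => ‖u z‖ ^ 2) κ := integrable_norm_sq_of_memLp hu
  -- pointwise form of Young's inequality
  have hpt : ∀ z, lam / 2 * ‖η z • G z‖ ^ 2 ≤ η z * η z * inner ℝ (A (G z)) (G z)
      + u z * (2 * η z * inner ℝ (A (G z)) (gradient η z))
      + 2 * ‖A‖ ^ 2 / lam * (K / R) ^ 2 * ‖u z‖ ^ 2 := by
    intro z
    have h1 := hA (G z)
    have h2 : |inner ℝ (A (G z)) (gradient η z)| ≤ ‖A‖ * ‖G z‖ * (K / R) :=
      (abs_real_inner_le_norm _ _).trans (mul_le_mul (A.le_opNorm _) (hηg z) (norm_nonneg _)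
        (by positivity))
    have h3 : -(u z * (2 * η z * inner ℝ (A (G z)) (gradient η z)))
        ≤ 2 * (|u z| * (‖A‖ * (K / R))) * (|η z| * ‖G z‖) := by
      refine (neg_le_abs _).trans ?_
      rw [abs_mul, abs_mul, abs_mul, abs_two]
      calc |u z| * (2 * |η z| * |inner ℝ (A (G z)) (gradient η z)|)
          ≤ |u z| * (2 * |η z| * (‖A‖ * ‖G z‖ * (K / R))) := by gcongr
        _ = _ := by ring
    have h4 : 2 * (|u z| * (‖A‖ * (K / R))) * (|η z| * ‖G z‖)
        ≤ lam / 2 * (|η z| * ‖G z‖) ^ 2 + 2 / lam * (|u z| * (‖A‖ * (K / R))) ^ 2 := by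
      have : 0 ≤ (lam * (|η z| * ‖G z‖) - 2 * (|u z| * (‖A‖ * (K / R)))) ^ 2 / (2 * lam) := by
        positivity
      have e : lam / 2 * (|η z| * ‖G z‖) ^ 2 + 2 / lam * (|u z| * (‖A‖ * (K / R))) ^ 2
          = 2 * (|u z| * (‖A‖ * (K / R))) * (|η z| * ‖G z‖)
            + (lam * (|η z| * ‖G z‖) - 2 * (|u z| * (‖A‖ * (K / R)))) ^ 2 / (2 * lam) := by
        field_simp; ring
      linarith
    have h5 : ‖η z • G z‖ = |η z| * ‖G z‖ := by rw [norm_smul, Real.norm_eq_abs]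
    have h6 : lam * (|η z| * ‖G z‖) ^ 2 ≤ η z * η z * inner ℝ (A (G z)) (G z) := by
      have := mul_le_mul_of_nonneg_left h1 (mul_self_nonneg (η z))
      calc lam * (|η z| * ‖G z‖) ^ 2 = η z * η z * (lam * ‖G z‖ ^ 2) := by
            rw [mul_pow, sq_abs]; ring
        _ ≤ _ := this
    rw [h5, Real.norm_eq_abs]
    have e2 : 2 / lam * (|u z| * (‖A‖ * (K / R))) ^ 2
        = 2 * ‖A‖ ^ 2 / lam * (K / R) ^ 2 * |u z| ^ 2 := by ring
    linarith
  have i5 : Integrable (fun z => η z * η z * inner ℝ (A (G z)) (G z)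
      + u z * (2 * η z * inner ℝ (A (G z)) (gradient η z))) κ := i1'.add i2'
  have hint := integral_mono (i3.const_mul (lam / 2))
    (i5.add (i4.const_mul (2 * ‖A‖ ^ 2 / lam * (K / R) ^ 2))) hpt
  rw [integral_const_mul, integral_add' i5 (i4.const_mul _), integral_add i1' i2', hid,
    integral_const_mul, zero_add] at hint
  have hfin : ∫ z, ‖η z • G z‖ ^ 2 ∂κ
      ≤ (2 * ‖A‖ / lam * K / R) ^ 2 * ∫ z, ‖u z‖ ^ 2 ∂κ := by
    have e : (2 * ‖A‖ / lam * K / R) ^ 2 * ∫ z, ‖u z‖ ^ 2 ∂κ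
        = 2 / lam * (2 * ‖A‖ ^ 2 / lam * (K / R) ^ 2 * ∫ z, ‖u z‖ ^ 2 ∂κ) := by
      field_simp
    rw [e]
    have := mul_le_mul_of_nonneg_left hint (show (0 : ℝ) ≤ 2 / lam by positivity)
    refine le_trans (le_of_eq ?_) this
    field_simp
  have hle : eLpNorm G 2 (ν.restrict (Metric.ball 0 R)) ≤ eLpNorm (fun z => η z • G z) 2 κ := by
    have hsub : Metric.ball (0 : E) R ⊆ Metric.ball 0 (2 * R) := Metric.ball_subset_ball (by linarith)
    refine le_trans (le_of_eq ?_) (eLpNorm_mono_measure (fun z => η z • G z)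
      (Measure.restrict_mono_set ν hsub))
    refine eLpNorm_congr_ae ?_
    filter_upwards [ae_restrict_mem Metric.isOpen_ball.measurableSet] with z hz
    rw [hη1 z hz, one_smul]
  refine hle.trans ((ENNReal.pow_le_pow_left_iff two_ne_zero).1 ?_)
  rw [mul_pow, eLpNorm_two_sq_eq_ofReal hηG, eLpNorm_two_sq_eq_ofReal hu,
    ← ENNReal.ofReal_pow (by positivity), ← ENNReal.ofReal_mul (by positivity)]
  exact ENNReal.ofReal_le_ofReal hfin

/-! ### Differences of solutions -/

lemma IsSol.fwdDiff_iterate {ν : Measure E} [IsFiniteMeasureOnCompacts ν] {A : E →L[ℝ] E}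
    {u : E → ℝ} {G : E → E} {h : E} (hν : MeasurePreserving (fun z => z + h) ν ν)
    (hs : IsSol ν A u G) (k : ℕ) :
    ∃ G', IsSol ν A ((fwdDiff h)^[k] u) G' := by
  induction k with
  | zero => exact ⟨G, hs⟩
  | succ k ih =>
    obtain ⟨G', hG'⟩ := ih
    rw [Function.iterate_succ_apply']
    exact ⟨_, (hG'.translate hν).sub hG'⟩

/-- The forward difference of a solution in a direction of translation invariance, over `B_R`, is
smaller than the solution over `B_{4R}` by a factor of order `1 / R`. -/
lemma exists_eLpNorm_fwdDiff_le {ν : Measure E} [IsFiniteMeasureOnCompacts ν] [SFinite ν]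
    {A : E →L[ℝ] E} {lam : ℝ}
    (hlam : 0 < lam) (hA : ∀ ξ, lam * ‖ξ‖ ^ 2 ≤ inner ℝ (A ξ) ξ) {h : E}
    (hν : ∀ t : ℝ, MeasurePreserving (fun z => z + t • h) ν ν) :
    ∃ C : ℝ, 0 ≤ C ∧ ∀ (u : E → ℝ) (G : E → E), IsSol ν A u G → ∀ R : ℝ, 0 < R → ‖h‖ ≤ R →
      eLpNorm (fwdDiff h u) 2 (ν.restrict (Metric.ball 0 R))
        ≤ ENNReal.ofReal (C / R) * eLpNorm u 2 (ν.restrict (Metric.ball 0 (4 * R))) := by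
  obtain ⟨C, hC0, hC⟩ := caccioppoli (ν := ν) hlam hA
  refine ⟨‖h‖ * C, by positivity, fun u G hs R hR hhR => ?_⟩
  have h1 := (hs.1 (2 * R)).eLpNorm_translate_sub_le (μ := ν.restrict (Metric.ball 0 R)) h ?_
  · refine h1.trans ?_
    have h2 := hC u G hs (2 * R) (by linarith)
    calc _ ≤ ‖h‖ₑ * (ENNReal.ofReal (C / (2 * R))
            * eLpNorm u 2 (ν.restrict (Metric.ball 0 (2 * (2 * R))))) := by gcongr
      _ ≤ ENNReal.ofReal ‖h‖ * (ENNReal.ofReal (C / R)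
            * eLpNorm u 2 (ν.restrict (Metric.ball 0 (2 * (2 * R))))) := by
          rw [ofReal_norm]
          gcongr
          linarith
      _ = _ := by
          rw [← mul_assoc, ← ENNReal.ofReal_mul (norm_nonneg _), mul_div_assoc, ← mul_assoc]
          norm_num
  · intro t ht
    have hemb : MeasurableEmbedding (fun z : E => z + t • h) := measurableEmbedding_addRight _
    have hsub : Metric.ball (0 : E) R ⊆ (fun z => z + t • h) ⁻¹' Metric.ball (0 : E) (2 * R) := by
      intro z hz
      simp only [Set.mem_preimage, Metric.mem_ball, dist_zero_right] at hz ⊢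
      have : ‖t • h‖ ≤ ‖h‖ := by
        rw [norm_smul, Real.norm_eq_abs, abs_of_nonneg ht.1]
        exact mul_le_of_le_one_left (norm_nonneg _) ht.2
      exact (norm_add_le _ _).trans_lt (by linarith)
    rw [← ((hν t).restrict_preimage_emb hemb (Metric.ball (0 : E) (2 * R))).map_eq]
    exact Measure.map_mono (Measure.restrict_mono_set ν hsub) hemb.measurable

lemma ae_of_forall_ae_restrict_ball {X : Type*} [NormedAddCommGroup X] [MeasurableSpace X]
    {ν : Measure X} {p : X → Prop}
    (h : ∀ R : ℝ, 0 < R → ∀ᵐ z ∂(ν.restrict (Metric.ball 0 R)), p z) : ∀ᵐ z ∂ν, p z := by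
  have h1 : ∀ᵐ z ∂(ν.restrict (⋃ k : ℕ, Metric.ball (0 : X) (k + 1))), p z := by
    rw [ae_restrict_iUnion_iff]
    exact fun k => h _ (by positivity)
  have h2 : (⋃ k : ℕ, Metric.ball (0 : X) (k + 1)) = Set.univ := by
    refine Set.eq_univ_of_forall fun z => Set.mem_iUnion.2 ⟨⌈‖z‖⌉₊, ?_⟩
    simp only [Metric.mem_ball, dist_zero_right]
    linarith [Nat.le_ceil ‖z‖]
  rwa [h2, Measure.restrict_univ] at h1

/-- A solution of polynomial growth in mean is annihilated by iterated differences in the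
directions of translation invariance. -/
theorem exists_fwdDiff_iterate_eq_zero {ν : Measure E} [IsFiniteMeasureOnCompacts ν] [SFinite ν]
    {A : E →L[ℝ] E} {lam : ℝ}
    (hlam : 0 < lam) (hA : ∀ ξ, lam * ‖ξ‖ ^ 2 ≤ inner ℝ (A ξ) ξ) {h : E}
    (hν : ∀ t : ℝ, MeasurePreserving (fun z => z + t • h) ν ν) {u : E → ℝ} {G : E → E}
    (hs : IsSol ν A u G) {M : ℝ} (hM : 0 ≤ M) {p : ℕ}
    (hgrow : ∀ R : ℝ, 1 ≤ R →
      eLpNorm u 2 (ν.restrict (Metric.ball 0 R)) ≤ ENNReal.ofReal (M * R ^ p)) :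
    ∀ᵐ z ∂ν, (fwdDiff h)^[p + 1] u z = 0 := by
  obtain ⟨C, hC0, hC⟩ := exists_eLpNorm_fwdDiff_le (ν := ν) hlam hA hν
  have hν1 : MeasurePreserving (fun z => z + h) ν ν := by simpa using hν 1
  have hiter : ∀ (k : ℕ) (R : ℝ), 1 ≤ R → ‖h‖ ≤ R →
      eLpNorm ((fwdDiff h)^[k] u) 2 (ν.restrict (Metric.ball 0 R))
        ≤ ENNReal.ofReal ((C / R) ^ k * (M * (4 ^ k * R) ^ p)) := by
    intro k
    induction k with
    | zero => intro R hR _; simpa using hgrow R hR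
    | succ k ih =>
      intro R hR hhR
      obtain ⟨G', hG'⟩ := hs.fwdDiff_iterate hν1 k
      rw [Function.iterate_succ_apply']
      refine (hC _ _ hG' R (by linarith) hhR).trans ?_
      have h1 := ih (4 * R) (by linarith) (by linarith)
      calc _ ≤ ENNReal.ofReal (C / R)
            * ENNReal.ofReal ((C / (4 * R)) ^ k * (M * (4 ^ k * (4 * R)) ^ p)) := by gcongr
        _ ≤ ENNReal.ofReal (C / R)
            * ENNReal.ofReal ((C / R) ^ k * (M * (4 ^ k * (4 * R)) ^ p)) := by
            gcongr
            linarith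
        _ = _ := by
            rw [← ENNReal.ofReal_mul (by positivity)]
            congr 1
            ring
  refine ae_of_forall_ae_restrict_ball fun R₀ hR₀ => ?_
  have hzero : eLpNorm ((fwdDiff h)^[p + 1] u) 2 (ν.restrict (Metric.ball 0 R₀)) = 0 := by
    have hlim : Tendsto (fun R : ℝ => ENNReal.ofReal (C ^ (p + 1) * M * (4 ^ (p + 1)) ^ p * R⁻¹))
        atTop (𝓝 0) := by
      have := (tendsto_inv_atTop_zero (𝕜 := ℝ)).const_mul (C ^ (p + 1) * M * (4 ^ (p + 1)) ^ p)
      rw [mul_zero] at this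
      simpa using ENNReal.tendsto_ofReal this
    refine le_antisymm (ge_of_tendsto hlim ?_) zero_le
    filter_upwards [eventually_ge_atTop (max (max 1 ‖h‖) R₀)] with R hR
    have r1 : 1 ≤ R := (le_max_left _ _).trans ((le_max_left _ _).trans hR)
    have r2 : ‖h‖ ≤ R := (le_max_right _ _).trans ((le_max_left _ _).trans hR)
    have r3 : R₀ ≤ R := (le_max_right _ _).trans hR
    refine (eLpNorm_mono_measure _ (Measure.restrict_mono_set ν
      (Metric.ball_subset_ball r3))).trans ((hiter _ R r1 r2).trans (le_of_eq ?_))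
    congr 1
    have : R ≠ 0 := by positivity
    rw [div_pow, mul_pow, pow_succ R p]
    field_simp
  obtain ⟨G', hG'⟩ := hs.fwdDiff_iterate hν1 (p + 1)
  exact (eLpNorm_eq_zero_iff (hG'.1 R₀).1.1 (by norm_num)).1 hzero

/-! ### Forward differences of functions of bounded growth -/

/-- If a Newton series `∑ i, (N choose i) a i` is finite and `O(N^γ)`, its coefficients of index
larger than `γ` vanish. -/
lemma newton_coeff_eq_zero {a : ℕ → ℝ} {c γ : ℝ} (K : ℕ) (ha : ∀ i, K < i → a i = 0)
    (hgrow : ∀ N : ℕ, |∑ i ∈ Finset.range (N + 1), (N.choose i : ℝ) * a i| ≤ c * (1 + (N : ℝ) ^ γ))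
    {j : ℕ} (hj : γ < j) (hγ : 0 < γ) : a j = 0 := by
  induction K with
  | zero =>
    refine ha j ?_
    exact_mod_cast hγ.trans hj
  | succ K ih =>
    by_cases hK : γ < K + 1
    swap
    · refine ha j ?_
      have : ((K + 1 : ℕ) : ℝ) < j := by push_cast; linarith
      exact_mod_cast this
    refine ih fun i hi => ?_
    rcases Nat.lt_or_ge (K + 1) i with h1 | h1
    · exact ha i h1
    obtain rfl : i = K + 1 := by omega
    have hsum : ∀ N : ℕ, ∑ i ∈ Finset.range (N + 1), (N.choose i : ℝ) * a i
        = ∑ i ∈ Finset.range (K + 2), (N.choose i : ℝ) * a i := by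
      intro N
      have e1 : ∑ i ∈ Finset.range (N + 1), (N.choose i : ℝ) * a i
          = ∑ i ∈ Finset.range (N + 1 + (K + 2)), (N.choose i : ℝ) * a i := by
        refine Finset.sum_subset (Finset.range_mono (by omega)) fun i _ hi => ?_
        rw [Nat.choose_eq_zero_of_lt (by simpa using hi)]; simp
      have e2 : ∑ i ∈ Finset.range (K + 2), (N.choose i : ℝ) * a i
          = ∑ i ∈ Finset.range (N + 1 + (K + 2)), (N.choose i : ℝ) * a i := by
        refine Finset.sum_subset (Finset.range_mono (by omega)) fun i _ hi => ?_
        rw [ha i (by simp at hi; omega)]; simp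
      rw [e1, e2]
    have hcast : Tendsto (fun N : ℕ => (N : ℝ)) atTop atTop := tendsto_natCast_atTop_atTop
    -- the leading term of the series, divided by `N ^ (K + 1)`
    have hlim1 : Tendsto (fun N : ℕ => (∑ i ∈ Finset.range (K + 2), (N.choose i : ℝ) * a i)
        / (N : ℝ) ^ (K + 1)) atTop (𝓝 (∑ i ∈ Finset.range (K + 2),
          (if i = K + 1 then ((K + 1).factorial : ℝ)⁻¹ else 0) * a i)) := by
      simp only [Finset.sum_div, mul_div_right_comm]
      refine tendsto_finsetSum _ fun i hi => Tendsto.mul_const _ ?_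
      have h2 : Tendsto (fun N : ℕ => (N.choose i : ℝ) / ((N : ℝ) ^ i / i.factorial)) atTop
          (𝓝 1) := by
        refine (Asymptotics.isEquivalent_iff_tendsto_one ?_).1 (isEquivalent_choose i)
        filter_upwards [eventually_gt_atTop 0] with N hN
        positivity
      have h3 : Tendsto (fun N : ℕ => (N : ℝ) ^ i / (N : ℝ) ^ (K + 1)) atTop
          (𝓝 (if i = K + 1 then 1 else 0)) := by
        split_ifs with h
        · subst h
          refine tendsto_const_nhds.congr' ?_
          filter_upwards [eventually_gt_atTop 0] with N hN
          have : (N : ℝ) ≠ 0 := by positivity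
          field_simp
        · have hi' : i < K + 1 := by simp at hi; omega
          have := (tendsto_pow_neg_atTop (𝕜 := ℝ) (n := K + 1 - i) (by omega)).comp hcast
          refine this.congr' ?_
          filter_upwards [eventually_gt_atTop 0] with N hN
          have hN' : (N : ℝ) ≠ 0 := by positivity
          have : (N : ℝ) ^ (K + 1) = (N : ℝ) ^ (K + 1 - i) * (N : ℝ) ^ i := by
            rw [← pow_add]; congr 1; omega
          simp only [Function.comp_apply, _root_.zpow_neg, zpow_natCast, this]
          field_simp
      have h4 := (h2.mul h3).div_const (i.factorial : ℝ)
      have e : (1 * (if i = K + 1 then (1 : ℝ) else 0)) / (i.factorial : ℝ)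
          = if i = K + 1 then ((K + 1).factorial : ℝ)⁻¹ else 0 := by
        split_ifs with h
        · subst h; simp
        · simp
      rw [e] at h4
      refine h4.congr' ?_
      filter_upwards [eventually_gt_atTop 0] with N hN
      have : (N : ℝ) ≠ 0 := by positivity
      field_simp
    have hlim2 : Tendsto (fun N : ℕ => c * ((N : ℝ) ^ (-((K : ℝ) + 1)) + (N : ℝ) ^ (-(K + 1 - γ))))
        atTop (𝓝 (c * (0 + 0))) :=
      (((tendsto_rpow_neg_atTop (by positivity)).comp hcast).add
        ((tendsto_rpow_neg_atTop (by linarith)).comp hcast)).const_mul c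
    have hlim3 : Tendsto (fun N : ℕ => (∑ i ∈ Finset.range (K + 2), (N.choose i : ℝ) * a i)
        / (N : ℝ) ^ (K + 1)) atTop (𝓝 0) := by
      simp only [add_zero, mul_zero] at hlim2
      refine squeeze_zero_norm' ?_ hlim2
      filter_upwards [eventually_gt_atTop 0] with N hN
      have hN' : (0 : ℝ) < N := by positivity
      rw [← hsum, Real.norm_eq_abs, abs_div, abs_of_pos (pow_pos hN' (K + 1)),
        div_le_iff₀ (pow_pos hN' _)]
      refine (hgrow N).trans (le_of_eq ?_)
      have e1 : (N : ℝ) ^ (K + 1) = (N : ℝ) ^ ((K : ℝ) + 1) := by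
        rw [← Real.rpow_natCast]; push_cast; rfl
      rw [mul_assoc, add_mul, e1, ← Real.rpow_add hN', ← Real.rpow_add hN']
      simp
    have := tendsto_nhds_unique hlim1 hlim3
    simp only [ite_mul, zero_mul, Finset.sum_ite_eq', Finset.mem_range] at this
    have hf : ((K + 1).factorial : ℝ)⁻¹ ≠ 0 := by positivity
    simpa [hf] using this

/-- If a function of growth `γ` is annihilated by a high difference, then it is annihilated by
all differences of order larger than `γ`. -/
lemma fwdDiff_iterate_eq_zero_of_growth {X : Type*} [NormedAddCommGroup X] [NormedSpace ℝ X]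
    [MeasurableSpace X] {ν : Measure X} {u : X → ℝ} {h : X}
    (hν : MeasurePreserving (fun z => z + h) ν ν) {c γ : ℝ} (hγ : 0 < γ) (hc : 0 ≤ c)
    (hgrow : ∀ᵐ z ∂ν, |u z| ≤ c * (1 + ‖z‖ ^ γ)) {K : ℕ}
    (hK : ∀ᵐ z ∂ν, (fwdDiff h)^[K] u z = 0) {j : ℕ} (hj : γ < j) :
    ∀ᵐ z ∂ν, (fwdDiff h)^[j] u z = 0 := by
  have hshift : ∀ N : ℕ, MeasurePreserving (fun z => z + N • h) ν ν := by
    intro N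
    induction N with
    | zero => simpa using! MeasurePreserving.id ν
    | succ N ih =>
      have := hν.comp ih
      refine (congrArg (fun f => MeasurePreserving f ν ν) ?_).mp this
      ext z; simp [succ_nsmul, add_assoc]
  have hall : ∀ i, ∀ᵐ z ∂ν, (fwdDiff h)^[K + i] u z = 0 := by
    intro i
    induction i with
    | zero => simpa using hK
    | succ i ih =>
      have h2 := hν.quasiMeasurePreserving.ae ih
      filter_upwards [ih, h2] with z h3 h4
      rw [← add_assoc, Function.iterate_succ_apply', fwdDiff, h3, h4, sub_zero]
  have hg : ∀ᵐ z ∂ν, ∀ N : ℕ, |u (z + N • h)| ≤ c * (1 + ‖z + N • h‖ ^ γ) :=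
    ae_all_iff.2 fun N => (hshift N).quasiMeasurePreserving.ae hgrow
  filter_upwards [ae_all_iff.2 hall, hg] with z hz1 hz2
  set b := ‖z‖ + ‖h‖ with hb
  have hb0 : 0 ≤ b := by positivity
  refine newton_coeff_eq_zero (a := fun i => (fwdDiff h)^[i] u z) (c := c * (1 + b ^ γ)) (γ := γ)
    K (fun i hi => ?_) (fun N => ?_) hj hγ
  · have := hz1 (i - K)
    rwa [Nat.add_sub_of_le hi.le] at this
  · have h1 := shift_eq_sum_fwdDiff_iter h u N z
    simp only [nsmul_eq_mul] at h1
    rw [← h1]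
    refine (hz2 N).trans ?_
    rw [mul_assoc]
    refine mul_le_mul_of_nonneg_left ?_ hc
    rcases Nat.eq_zero_or_pos N with rfl | hN
    · have : ‖z‖ ^ γ ≤ b ^ γ := Real.rpow_le_rpow (norm_nonneg _) (by simp [hb]) hγ.le
      simp [Real.zero_rpow hγ.ne']
      linarith
    · have hN1 : (1 : ℝ) ≤ N := by exact_mod_cast hN
      have : ‖z + N • h‖ ≤ b * N := by
        refine (norm_add_le _ _).trans ?_
        rw [← Nat.cast_smul_eq_nsmul ℝ, norm_smul]
        simp only [Real.norm_natCast, hb]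
        nlinarith [norm_nonneg z, norm_nonneg h]
      have h2 : ‖z + N • h‖ ^ γ ≤ b ^ γ * (N : ℝ) ^ γ := by
        rw [← Real.mul_rpow hb0 (by positivity)]
        exact Real.rpow_le_rpow (norm_nonneg _) this hγ.le
      have h3 : 0 ≤ b ^ γ := Real.rpow_nonneg hb0 _
      have h4 : 0 ≤ (N : ℝ) ^ γ := by positivity
      nlinarith

end Generic

/-! ### The differential inequality for the energy -/

/-- Let `H' = 2 r^{-q} F` with `F ≥ 0` nondecreasing and
`F' ≥ 2 s F / r + (μ - s²) r^{q-2} H`, where `s² + (q - 1) s < μ`. If `H` grows more slowly than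
`r^{2s}`, then `F = 0`. The proof compares `F` with `s r^{q-1} H`. -/
theorem energy_eq_zero_of_growth {ε q s μ γ C : ℝ} (hε : 0 ≤ ε) {F H : ℝ → ℝ} (hγ : 0 < γ)
    (hs : γ < s) (hδ : 0 < μ - s ^ 2 - s * (q - 1))
    (hF0 : ∀ r, ε < r → 0 ≤ F r) (hH0 : ∀ r, ε < r → 0 ≤ H r)
    (hFm : MonotoneOn F (Set.Ioi ε)) (hFc : ContinuousOn F (Set.Ioi ε))
    (hH : ∀ r, ε < r → HasDerivAt H (2 * r ^ (-q) * F r) r)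
    (hineq : ∀ r₁ r₂, ε < r₁ → r₁ ≤ r₂ →
      ∫ r in r₁..r₂, (2 * s * F r / r + (μ - s ^ 2) * r ^ (q - 2) * H r) ≤ F r₂ - F r₁)
    (hgrow : ∀ r, ε < r → H r ≤ C * (1 + r ^ γ) ^ 2) :
    ∀ r, ε < r → F r = 0 := by
  have hs0 : 0 < s := hγ.trans hs
  have hpos : ∀ {r}, ε < r → 0 < r := fun h => hε.trans_lt h
  have hHc : ContinuousOn H (Set.Ioi ε) := fun r hr => (hH r hr).continuousAt.continuousWithinAt
  have hrc : ∀ p : ℝ, ContinuousOn (fun r : ℝ => r ^ p) (Set.Ioi ε) := fun p r hr =>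
    (Real.continuousAt_rpow_const _ _ (Or.inl (hpos hr).ne')).continuousWithinAt
  have hinvc : ContinuousOn (fun r : ℝ => r⁻¹) (Set.Ioi ε) := fun r hr =>
    (continuousAt_inv₀ (hpos hr).ne').continuousWithinAt
  have hii : ∀ {f : ℝ → ℝ}, ContinuousOn f (Set.Ioi ε) → ∀ {r₁ r₂}, ε < r₁ → r₁ ≤ r₂ →
      IntervalIntegrable f volume r₁ r₂ := by
    intro f hf r₁ r₂ h1 h2
    refine (hf.mono ?_).intervalIntegrable
    rw [Set.uIcc_of_le h2]
    exact fun r hr => h1.trans_le hr.1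
  by_contra hcon
  push Not at hcon
  obtain ⟨r₀, hr₀, hFr₀⟩ := hcon
  have hF₀ : 0 < F r₀ := lt_of_le_of_ne (hF0 r₀ hr₀) (Ne.symm hFr₀)
  have hFge : ∀ r, r₀ ≤ r → F r₀ ≤ F r := fun r hr => hFm hr₀ (hr₀.trans_le hr) hr
  set K : ℝ → ℝ := fun r => F r - s * (r ^ (q - 1) * H r) with hK
  have hKineq : ∀ r₁ r₂, ε < r₁ → r₁ ≤ r₂ →
      ∫ r in r₁..r₂, (μ - s ^ 2 - s * (q - 1)) * (r ^ (q - 2) * H r) ≤ K r₂ - K r₁ := by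
    intro r₁ r₂ h1 h2
    have hd : ∀ r ∈ Set.uIcc r₁ r₂, HasDerivAt (fun r => r ^ (q - 1) * H r)
        ((q - 1) * (r ^ (q - 2) * H r) + 2 * (F r * r⁻¹)) r := by
      intro r hr
      rw [Set.uIcc_of_le h2] at hr
      have hr' : ε < r := h1.trans_le hr.1
      have h0 := hpos hr'
      have hd1 := (Real.hasDerivAt_rpow_const (p := q - 1) (Or.inl h0.ne')).mul (hH r hr')
      refine hd1.congr_deriv ?_
      have e1 : r ^ (q - 1) * r ^ (-q) = r⁻¹ := by
        rw [← Real.rpow_add h0, ← Real.rpow_neg_one]; congr 1; ring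
      have e2 : q - 1 - 1 = q - 2 := by ring
      rw [e2]
      calc _ = (q - 1) * (r ^ (q - 2) * H r) + 2 * (F r * (r ^ (q - 1) * r ^ (-q))) := by ring
        _ = _ := by rw [e1]
    have c1 : ContinuousOn (fun r => (q - 1) * (r ^ (q - 2) * H r) + 2 * (F r * r⁻¹))
        (Set.Ioi ε) :=
      (continuousOn_const.mul ((hrc _).mul hHc)).add (continuousOn_const.mul (hFc.mul hinvc))
    have c2 : ContinuousOn (fun r => 2 * s * F r / r + (μ - s ^ 2) * r ^ (q - 2) * H r)
        (Set.Ioi ε) := by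
      simp only [div_eq_mul_inv]
      exact ((continuousOn_const.mul hFc).mul hinvc).add ((continuousOn_const.mul (hrc _)).mul hHc)
    have hftc := intervalIntegral.integral_eq_sub_of_hasDerivAt hd (hii c1 h1 h2)
    have h3 := hineq r₁ r₂ h1 h2
    have h4 : ∫ r in r₁..r₂, (μ - s ^ 2 - s * (q - 1)) * (r ^ (q - 2) * H r)
        = (∫ r in r₁..r₂, (2 * s * F r / r + (μ - s ^ 2) * r ^ (q - 2) * H r))
          - s * ∫ r in r₁..r₂, ((q - 1) * (r ^ (q - 2) * H r) + 2 * (F r * r⁻¹)) := by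
      rw [← intervalIntegral.integral_const_mul, ← intervalIntegral.integral_sub (hii c2 h1 h2)
        ((hii c1 h1 h2).const_mul s)]
      congr 1
      ext r
      rw [div_eq_mul_inv]
      ring
    rw [h4, hftc]
    simp only [hK]
    linarith
  have hKmono : ∀ r₁ r₂, ε < r₁ → r₁ ≤ r₂ → K r₁ ≤ K r₂ := by
    intro r₁ r₂ h1 h2
    have h3 : 0 ≤ ∫ r in r₁..r₂, (μ - s ^ 2 - s * (q - 1)) * (r ^ (q - 2) * H r) := by
      refine intervalIntegral.integral_nonneg h2 fun r hr => ?_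
      have hr' := h1.trans_le hr.1
      exact mul_nonneg hδ.le (mul_nonneg (Real.rpow_nonneg (hpos hr').le _) (hH0 r hr'))
    linarith [hKineq r₁ r₂ h1 h2]
  -- if `K ≥ 0` from some radius on, then `r H' ≥ 2 s H` there, so `H` grows at least like `r^{2s}`;
  -- if `K < 0` throughout, then `s r^{q-1} H > F ≥ F r₀`, so `K'` is at least a multiple of `1 / r`
  -- and `K` becomes positive
  by_cases hcase : ∃ r₁, r₀ ≤ r₁ ∧ 0 ≤ K r₁
  · -- `H` grows at least as fast as `r^{2s}`
    obtain ⟨r₁, hr₁, hK1⟩ := hcase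
    have hεr₁ : ε < r₁ := hr₀.trans_le hr₁
    have hsub : Set.Ici r₁ ⊆ Set.Ioi ε := fun r hr => hεr₁.trans_le hr
    have hsm : StrictMonoOn H (Set.Ici r₁) := by
      refine strictMonoOn_of_deriv_pos (convex_Ici r₁) (hHc.mono hsub) fun r hr => ?_
      rw [interior_Ici] at hr
      have hr' : ε < r := hεr₁.trans hr
      rw [(hH r hr').deriv]
      have := hF₀.trans_le (hFge r (hr₁.trans hr.le))
      have := Real.rpow_pos_of_pos (hpos hr') (-q)
      positivity
    set r₂ := r₁ + 1 with hr₂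
    have hH2 : 0 < H r₂ := (hH0 r₁ hεr₁).trans_lt (hsm Set.self_mem_Ici
      (by simp [hr₂]) (by simp [hr₂]))
    have hr₂0 : 0 < r₂ := by linarith [hpos hεr₁]
    have hmono : MonotoneOn (fun r => H r * r ^ (-(2 * s))) (Set.Ici r₂) := by
      have hd : ∀ r, r₂ ≤ r → HasDerivAt (fun r => H r * r ^ (-(2 * s)))
          (2 * r ^ (-q) * F r * r ^ (-(2 * s)) + H r * (-(2 * s) * r ^ (-(2 * s) - 1))) r := by
        intro r hr
        have hr' : ε < r := by linarith
        exact (hH r hr').mul (Real.hasDerivAt_rpow_const (Or.inl (hpos hr').ne'))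
      refine monotoneOn_of_deriv_nonneg (convex_Ici r₂)
        (fun r hr => (hd r hr).continuousAt.continuousWithinAt) (fun r hr => ?_) fun r hr => ?_
      · rw [interior_Ici] at hr
        exact (hd r hr.le).differentiableAt.differentiableWithinAt
      · rw [interior_Ici] at hr
        rw [(hd r hr.le).deriv]
        have hrr : r₂ < r := hr
        have hr' : ε < r := by linarith
        have h0 := hpos hr'
        have hKr : 0 ≤ K r := hK1.trans (hKmono r₁ r hεr₁ (by linarith))
        have e1 : r ^ (-q) * r ^ (q - 1) = r⁻¹ := by
          rw [← Real.rpow_add h0, ← Real.rpow_neg_one]; congr 1; ring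
        have e2 : r ^ (-(2 * s) - 1) = r ^ (-(2 * s)) * r⁻¹ := by
          rw [← Real.rpow_neg_one, ← Real.rpow_add h0]; congr 1
        have e3 : 2 * r ^ (-q) * F r * r ^ (-(2 * s)) + H r * (-(2 * s) * r ^ (-(2 * s) - 1))
            = 2 * r ^ (-q) * r ^ (-(2 * s)) * K r := by
          rw [e2, ← e1]; simp only [hK]; ring
        rw [e3]
        have := Real.rpow_nonneg h0.le (-q)
        have := Real.rpow_nonneg h0.le (-(2 * s))
        positivity
    set c := H r₂ * r₂ ^ (-(2 * s)) with hc
    have hc0 : 0 < c := mul_pos hH2 (Real.rpow_pos_of_pos hr₂0 _)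
    have hC0 : 0 ≤ C := by
      have := hgrow r₂ (by linarith)
      have h3 : 0 < (1 + r₂ ^ γ) ^ 2 := by
        have := Real.rpow_nonneg hr₂0.le γ
        positivity
      by_contra hneg
      push Not at hneg
      nlinarith
    have hlim : Tendsto (fun r : ℝ => c * r ^ (2 * s - 2 * γ)) atTop atTop :=
      (tendsto_rpow_atTop (by linarith)).const_mul_atTop hc0
    obtain ⟨r, hr1, hr2⟩ := ((hlim.eventually_gt_atTop (4 * C)).and
      (eventually_ge_atTop (max 1 r₂))).exists
    have hr1' : 1 ≤ r := (le_max_left _ _).trans hr2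
    have hrr2 : r₂ ≤ r := (le_max_right _ _).trans hr2
    have h0 : 0 < r := by linarith
    have h3 : c ≤ H r * r ^ (-(2 * s)) := hmono Set.self_mem_Ici hrr2 hrr2
    have h4 : H r ≤ C * (2 * r ^ γ) ^ 2 := by
      refine (hgrow r (by linarith)).trans ?_
      have h5 : 1 ≤ r ^ γ := Real.one_le_rpow hr1' hγ.le
      have h6 : 1 + r ^ γ ≤ 2 * r ^ γ := by linarith
      gcongr
    have h5 : (r ^ γ) ^ 2 * (r ^ (-(2 * s)) * r ^ (2 * s - 2 * γ)) = 1 := by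
      rw [← Real.rpow_natCast, ← Real.rpow_mul h0.le, ← Real.rpow_add h0, ← Real.rpow_add h0]
      have : γ * ((2 : ℕ) : ℝ) + (-(2 * s) + (2 * s - 2 * γ)) = 0 := by push_cast; ring
      rw [this, Real.rpow_zero]
    have h6 : 0 < r ^ (-(2 * s)) := Real.rpow_pos_of_pos h0 _
    have h7 : 0 < r ^ (2 * s - 2 * γ) := Real.rpow_pos_of_pos h0 _
    have h8 : c * r ^ (2 * s - 2 * γ) ≤ 4 * C := by
      calc c * r ^ (2 * s - 2 * γ) ≤ H r * r ^ (-(2 * s)) * r ^ (2 * s - 2 * γ) := by gcongr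
        _ ≤ C * (2 * r ^ γ) ^ 2 * r ^ (-(2 * s)) * r ^ (2 * s - 2 * γ) := by gcongr
        _ = 4 * C * ((r ^ γ) ^ 2 * (r ^ (-(2 * s)) * r ^ (2 * s - 2 * γ))) := by ring
        _ = 4 * C := by rw [h5, mul_one]
    linarith
  · -- `K` is bounded above by `0` but grows like the logarithm
    push Not at hcase
    set d := (μ - s ^ 2 - s * (q - 1)) * (F r₀ / s) with hd
    have hd0 : 0 < d := mul_pos hδ (div_pos hF₀ hs0)
    have hr₀0 := hpos hr₀
    have hlog : ∀ r, r₀ ≤ r → d * Real.log (r / r₀) ≤ K r - K r₀ := by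
      intro r hr
      refine le_trans ?_ (hKineq r₀ r hr₀ hr)
      rw [← integral_inv_of_pos hr₀0 (hr₀0.trans_le hr), ← intervalIntegral.integral_const_mul]
      refine intervalIntegral.integral_mono_on hr ?_ ?_ fun t ht => ?_
      · exact (hii hinvc hr₀ hr).const_mul d
      · exact (hii ((hrc _).mul hHc) hr₀ hr).const_mul _
      · have ht0 : 0 < t := hr₀0.trans_le ht.1
        have hKt := hcase t ht.1
        simp only [hK] at hKt
        have h1 : F r₀ / s ≤ t ^ (q - 1) * H t := by
          rw [div_le_iff₀ hs0]
          have := hFge t ht.1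
          linarith
        have e : t ^ (q - 2) = t ^ (q - 1) * t⁻¹ := by
          rw [← Real.rpow_neg_one, ← Real.rpow_add ht0]; congr 1; ring
        rw [hd, mul_assoc, e]
        have h2 : F r₀ / s * t⁻¹ ≤ t ^ (q - 1) * H t * t⁻¹ := by gcongr
        have h3 := mul_le_mul_of_nonneg_left h2 hδ.le
        refine h3.trans (le_of_eq ?_)
        ring
    have hlim : Tendsto (fun r : ℝ => d * Real.log (r / r₀)) atTop atTop :=
      (Real.tendsto_log_atTop.comp (tendsto_id.atTop_div_const hr₀0)).const_mul_atTop hd0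
    obtain ⟨r, h1, h2⟩ := ((hlim.eventually_gt_atTop (-K r₀)).and (eventually_ge_atTop r₀)).exists
    have := hlog r h2
    have := hcase r h2
    linarith

/-! ### Slices of functions on product spaces -/

/-- Convergence to `0` in `L¹` of a product implies, along a subsequence, convergence to `0` in
`L¹` of almost every slice. -/
lemma exists_subseq_tendsto_slice {X Y : Type*} [MeasurableSpace X] [MeasurableSpace Y]
    {α : Measure X} {β : Measure Y} [SFinite β] {f : ℕ → X × Y → ENNReal}
    (hf : ∀ k, AEMeasurable (f k) (α.prod β))
    (hlim : Tendsto (fun k => ∫⁻ p, f k p ∂(α.prod β)) atTop (𝓝 0)) :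
    ∃ ns : ℕ → ℕ, StrictMono ns ∧
      ∀ᵐ x ∂α, Tendsto (fun j => ∫⁻ y, f (ns j) (x, y) ∂β) atTop (𝓝 0) := by
  have hev : ∀ j : ℕ, ∀ᶠ k in atTop, ∫⁻ p, f k p ∂(α.prod β) ≤ (2 : ENNReal)⁻¹ ^ j := fun j =>
    hlim.eventually_le_const (by
      refine pos_iff_ne_zero.2 (pow_ne_zero _ ?_)
      simp)
  obtain ⟨ns, hns, hle⟩ := extraction_forall_of_eventually hev
  refine ⟨ns, hns, ?_⟩
  have hm : ∀ j, AEMeasurable (fun x => ∫⁻ y, f (ns j) (x, y) ∂β) α := fun j =>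
    (hf (ns j)).lintegral_prod_right'
  have hsum : ∫⁻ x, ∑' j, ∫⁻ y, f (ns j) (x, y) ∂β ∂α ≠ ⊤ := by
    rw [lintegral_tsum hm]
    have h1 : ∀ j, ∫⁻ x, ∫⁻ y, f (ns j) (x, y) ∂β ∂α = ∫⁻ p, f (ns j) p ∂(α.prod β) := fun j =>
      (lintegral_prod _ (hf (ns j))).symm
    simp_rw [h1]
    refine ne_top_of_le_ne_top ?_ (ENNReal.tsum_le_tsum hle)
    rw [ENNReal.tsum_geometric]
    simp
  filter_upwards [ae_lt_top' (AEMeasurable.tsum hm) hsum] with x hx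
  exact ENNReal.tendsto_atTop_zero_of_tsum_ne_top hx.ne

/-- Almost every slice of a function in `L²` of a product is in `L²`. -/
lemma ae_memLp_slice {X Y F : Type*} [MeasurableSpace X] [MeasurableSpace Y] [NormedAddCommGroup F]
    {α : Measure X} {β : Measure Y} [SFinite α] [SFinite β] {f : X × Y → F}
    (hf : MemLp f 2 (α.prod β)) : ∀ᵐ x ∂α, MemLp (fun y => f (x, y)) 2 β := by
  have h1 : ∫⁻ p, ‖f p‖ₑ ^ 2 ∂(α.prod β) ≠ ⊤ := by
    rw [← eLpNorm_two_sq]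
    exact ENNReal.pow_ne_top hf.2.ne
  have hm : AEMeasurable (fun p => ‖f p‖ₑ ^ 2) (α.prod β) := hf.1.enorm.pow_const 2
  rw [lintegral_prod _ hm] at h1
  filter_upwards [ae_lt_top' hm.lintegral_prod_right' h1, hf.1.prodMk_left] with x hx hx2
  refine ⟨hx2, ?_⟩
  rw [← eLpNorm_two_sq] at hx
  exact (ENNReal.pow_lt_top_iff (n := 2)).1 hx |>.resolve_right (by norm_num)

/-- `L²` convergence on a product implies, along a common subsequence, `L²` convergence of almost
every slice, for two sequences simultaneously. -/
lemma exists_subseq_tendsto_slice_eLpNorm {X Y F F' : Type*} [MeasurableSpace X]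
    [MeasurableSpace Y] [NormedAddCommGroup F] [NormedAddCommGroup F']
    {α : Measure X} {β : Measure Y} [SFinite β] {f : ℕ → X × Y → F} {g : ℕ → X × Y → F'}
    (hf : ∀ k, AEStronglyMeasurable (f k) (α.prod β))
    (hg : ∀ k, AEStronglyMeasurable (g k) (α.prod β))
    (hft : Tendsto (fun k => eLpNorm (f k) 2 (α.prod β)) atTop (𝓝 0))
    (hgt : Tendsto (fun k => eLpNorm (g k) 2 (α.prod β)) atTop (𝓝 0)) :
    ∃ ns : ℕ → ℕ, StrictMono ns ∧
      ∀ᵐ x ∂α, Tendsto (fun j => eLpNorm (fun y => f (ns j) (x, y)) 2 β) atTop (𝓝 0) ∧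
        Tendsto (fun j => eLpNorm (fun y => g (ns j) (x, y)) 2 β) atTop (𝓝 0) := by
  have hm1 : ∀ k, AEMeasurable (fun p => ‖f k p‖ₑ ^ 2) (α.prod β) := fun k =>
    (hf k).enorm.pow_const 2
  have hm2 : ∀ k, AEMeasurable (fun p => ‖g k p‖ₑ ^ 2) (α.prod β) := fun k =>
    (hg k).enorm.pow_const 2
  have hsq : ∀ {φ : ℕ → ENNReal}, Tendsto φ atTop (𝓝 0) → Tendsto (fun k => φ k ^ 2) atTop (𝓝 0) :=
    fun h => by simpa using ENNReal.Tendsto.pow (n := 2) h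
  have hlim : Tendsto (fun k => ∫⁻ p, (‖f k p‖ₑ ^ 2 + ‖g k p‖ₑ ^ 2) ∂(α.prod β)) atTop (𝓝 0) := by
    have := (hsq hft).add (hsq hgt)
    simp_rw [eLpNorm_two_sq] at this
    rw [add_zero] at this
    exact this.congr fun k => (lintegral_add_left' (hm1 k) _).symm
  obtain ⟨ns, hns, h⟩ := exists_subseq_tendsto_slice (fun k => (hm1 k).add (hm2 k)) hlim
  refine ⟨ns, hns, ?_⟩
  have hroot : ∀ {φ : ℕ → ENNReal}, Tendsto (fun k => φ k ^ 2) atTop (𝓝 0) →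
      Tendsto φ atTop (𝓝 0) := by
    intro φ hφ
    have := ((ENNReal.continuous_rpow_const (y := 1 / 2)).tendsto 0).comp hφ
    rw [ENNReal.zero_rpow_of_pos (by norm_num)] at this
    refine this.congr fun k => ?_
    simp only [Function.comp_apply]
    rw [← ENNReal.rpow_natCast, ← ENNReal.rpow_mul]
    norm_num
  filter_upwards [h] with x hx
  constructor
  · refine hroot (tendsto_of_tendsto_of_tendsto_of_le_of_le tendsto_const_nhds hx
      (fun _ => zero_le) fun j => ?_)
    simp only
    rw [eLpNorm_two_sq]
    exact lintegral_mono fun y => le_self_add (a := ‖f (ns j) (x, y)‖ₑ ^ 2)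
  · refine hroot (tendsto_of_tendsto_of_tendsto_of_le_of_le tendsto_const_nhds hx
      (fun _ => zero_le) fun j => ?_)
    simp only
    rw [eLpNorm_two_sq]
    exact lintegral_mono fun y => le_add_self (a := ‖g (ns j) (x, y)‖ₑ ^ 2)

/-! ### Measures in polar coordinates -/

/-- On a set where a density is bounded below, the measure is controlled by the weighted one. -/
lemma restrict_le_smul_withDensity {X : Type*} [MeasurableSpace X] {μ : Measure X} {K Ω : Set X}
    (hK : MeasurableSet K) (hKΩ : K ⊆ Ω) {w : X → ENNReal} {c : ENNReal} (hc : c ≠ 0) (hc' : c ≠ ⊤)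
    (hw : ∀ x ∈ K, c ≤ w x) : μ.restrict K ≤ c⁻¹ • (μ.restrict Ω).withDensity w := by
  have h1 : c • μ.restrict K ≤ (μ.restrict Ω).withDensity w := by
    rw [← withDensity_const]
    calc (μ.restrict K).withDensity (fun _ => c) ≤ (μ.restrict K).withDensity w := by
          refine withDensity_mono ?_
          filter_upwards [ae_restrict_mem hK] with x hx using hw x hx
      _ = ((μ.restrict Ω).withDensity w).restrict K := by
          rw [restrict_withDensity hK, Measure.restrict_restrict hK, Set.inter_eq_left.2 hKΩ]
      _ ≤ _ := Measure.restrict_le_self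
  calc μ.restrict K = c⁻¹ • c • μ.restrict K := by
        rw [smul_smul, ENNReal.inv_mul_cancel hc hc', one_smul]
    _ ≤ _ := by gcongr

/-- The measure `r^q dr` on `(ε, ∞)`. -/
noncomputable def radialMeasure (q ε : ℝ) : Measure ℝ :=
  (volume.restrict (Set.Ioi ε)).withDensity fun r => ENNReal.ofReal (r ^ q)

/-- Polar coordinates `(r, σ) ↦ r σ`. -/
def polarMap {n : ℕ} (p : ℝ × Sph n) : EuclideanSpace ℝ (Fin n) := p.1 • (p.2 : EuclideanSpace ℝ _)

/-- The measure on `ℝ^n ∖ B_ε` that is `r^q dr` in the radial variable and `β` in the angular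
one. -/
noncomputable def polarMeasure {n : ℕ} (q ε : ℝ) (β : Measure (Sph n)) :
    Measure (EuclideanSpace ℝ (Fin n)) :=
  ((radialMeasure q ε).prod β).map polarMap

lemma continuous_polarMap {n : ℕ} : Continuous (polarMap (n := n)) := by
  unfold polarMap; fun_prop

instance (q ε : ℝ) : SigmaFinite (radialMeasure q ε) := by
  unfold radialMeasure; infer_instance

lemma norm_polarMap {n : ℕ} {r : ℝ} (hr : 0 ≤ r) (σ : Sph n) : ‖polarMap (r, σ)‖ = r := by
  simp [polarMap, norm_smul, abs_of_nonneg hr]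

lemma ae_radialMeasure_iff {q ε : ℝ} (hε : 0 ≤ ε) {p : ℝ → Prop} :
    (∀ᵐ r ∂(radialMeasure q ε), p r) ↔ ∀ᵐ r ∂(volume.restrict (Set.Ioi ε)), p r := by
  unfold radialMeasure
  rw [ae_withDensity_iff (by fun_prop), ae_restrict_iff' measurableSet_Ioi,
    ae_restrict_iff' measurableSet_Ioi]
  refine eventually_congr (Eventually.of_forall fun r => ?_)
  refine imp_congr_right fun hr => ?_
  have : ENNReal.ofReal (r ^ q) ≠ 0 := by
    have h0 : 0 < r := hε.trans_lt hr
    simpa using Real.rpow_pos_of_pos h0 q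
  simp [this]

lemma radialMeasure_restrict_Iio (q ε R : ℝ) : (radialMeasure q ε).restrict (Set.Iio R)
    = (volume.restrict (Set.Ioo ε R)).withDensity fun r => ENNReal.ofReal (r ^ q) := by
  unfold radialMeasure
  rw [restrict_withDensity measurableSet_Iio, Measure.restrict_restrict measurableSet_Iio,
    Set.Iio_inter_Ioi]

lemma integrableOn_rpow_Ioo {q ε : ℝ} (hq : -1 < q) (R : ℝ) :
    IntegrableOn (fun r : ℝ => r ^ q) (Set.Ioo ε R) := by
  rcases le_total R ε with h | h
  · rw [Set.Ioo_eq_empty (not_lt.2 h)]; exact integrableOn_empty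
  · have := (intervalIntegral.intervalIntegrable_rpow' (a := ε) (b := R) hq)
    rw [intervalIntegrable_iff_integrableOn_Ioo_of_le h] at this
    exact this

lemma radialMeasure_Iio_lt_top {q ε : ℝ} (hq : -1 < q) (hε : 0 ≤ ε) (R : ℝ) :
    radialMeasure q ε (Set.Iio R) < ⊤ := by
  rw [← Measure.restrict_apply_univ, radialMeasure_restrict_Iio, withDensity_apply _ .univ,
    Measure.restrict_univ]
  have h := (integrableOn_rpow_Ioo (ε := ε) hq R).2
  rw [hasFiniteIntegral_iff_ofReal] at h
  · exact h
  · filter_upwards [ae_restrict_mem measurableSet_Ioo] with r hr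
    exact Real.rpow_nonneg (hε.trans hr.1.le) _

lemma polarMeasure_restrict_ball {n : ℕ} {q ε : ℝ} (hε : 0 ≤ ε) (β : Measure (Sph n)) [SFinite β]
    (R : ℝ) : (polarMeasure q ε β).restrict (Metric.ball 0 R)
      = (((radialMeasure q ε).restrict (Set.Iio R)).prod β).map polarMap := by
  unfold polarMeasure
  rw [Measure.restrict_map continuous_polarMap.measurable Metric.isOpen_ball.measurableSet]
  congr 1
  rw [← Measure.restrict_univ (μ := β), Measure.prod_restrict, Measure.restrict_univ]
  refine Measure.restrict_congr_set ?_
  have h1 : ∀ᵐ p ∂((radialMeasure q ε).prod β), ε < p.1 := by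
    refine Measure.quasiMeasurePreserving_fst.ae ?_
    rw [ae_radialMeasure_iff hε]
    exact ae_restrict_mem measurableSet_Ioi
  filter_upwards [h1] with p hp
  refine propext ?_
  change polarMap p ∈ Metric.ball _ R ↔ p ∈ Set.Iio R ×ˢ Set.univ
  rw [Metric.mem_ball, dist_zero_right, norm_polarMap (r := p.1) (hε.trans hp.le) p.2]
  simp

lemma isFiniteMeasureOnCompacts_polarMeasure {n : ℕ} {q ε : ℝ} (hq : -1 < q) (hε : 0 ≤ ε)
    (β : Measure (Sph n)) [IsFiniteMeasure β] :
    IsFiniteMeasureOnCompacts (polarMeasure q ε β) := by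
  refine ⟨fun K hK => ?_⟩
  obtain ⟨R, hR⟩ := hK.isBounded.subset_ball (0 : EuclideanSpace ℝ (Fin n))
  refine (measure_mono hR).trans_lt ?_
  rw [← Measure.restrict_apply_univ, polarMeasure_restrict_ball hε,
    Measure.map_apply continuous_polarMap.measurable .univ, Set.preimage_univ,
    ← Set.univ_prod_univ, Measure.prod_prod, Measure.restrict_apply_univ]
  exact ENNReal.mul_lt_top (radialMeasure_Iio_lt_top hq hε R) (measure_lt_top _ _)

/-- Integration in polar coordinates over a ball. -/
lemma integral_polarMeasure_ball {n : ℕ} {q ε : ℝ} (hε : 0 ≤ ε) {β : Measure (Sph n)}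
    [SFinite β] {f : EuclideanSpace ℝ (Fin n) → ℝ} {R : ℝ}
    (hf : Integrable f ((polarMeasure q ε β).restrict (Metric.ball 0 R))) :
    IntegrableOn (fun r => r ^ q * ∫ σ, f (polarMap (r, σ)) ∂β) (Set.Ioo ε R) ∧
    ∫ y in Metric.ball 0 R, f y ∂(polarMeasure q ε β)
      = ∫ r in Set.Ioo ε R, r ^ q * ∫ σ, f (polarMap (r, σ)) ∂β := by
  rw [polarMeasure_restrict_ball hε] at hf ⊢
  have hf' : Integrable (fun p => f (polarMap p)) (((radialMeasure q ε).restrict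
    (Set.Iio R)).prod β) := hf.comp_measurable continuous_polarMap.measurable
  rw [integral_map continuous_polarMap.aemeasurable hf.1, integral_prod _ hf',
    radialMeasure_restrict_Iio]
  have h1 := hf'.integral_prod_left
  rw [radialMeasure_restrict_Iio] at h1
  have hw : ∀ᵐ r ∂(volume.restrict (Set.Ioo ε R)), ENNReal.ofReal (r ^ q) < ⊤ :=
    Eventually.of_forall fun _ => ENNReal.ofReal_lt_top
  have heq : ∀ᵐ r ∂(volume.restrict (Set.Ioo ε R)),
      (ENNReal.ofReal (r ^ q)).toReal • ∫ σ, f (polarMap (r, σ)) ∂β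
        = r ^ q * ∫ σ, f (polarMap (r, σ)) ∂β := by
    filter_upwards [ae_restrict_mem measurableSet_Ioo] with r hr
    rw [ENNReal.toReal_ofReal (Real.rpow_nonneg (hε.trans hr.1.le) _), smul_eq_mul]
  constructor
  · have h2 := (integrable_withDensity_iff_integrable_smul₀' (by fun_prop) hw).1 h1
    exact h2.congr heq
  · rw [integral_withDensity_eq_integral_toReal_smul₀ (by fun_prop) hw]
    exact integral_congr_ae heq

/-! ### Spherical slices of solutions -/

lemma memLp_comp_of_map {X Y F : Type*} [MeasurableSpace X] [MeasurableSpace Y]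
    [NormedAddCommGroup F] {κ : Measure X} {P : X → Y} (hP : Measurable P) {f : Y → F}
    (hf : MemLp f 2 (κ.map P)) : MemLp (fun p => f (P p)) 2 κ :=
  (memLp_map_measure_iff hf.1 hP.aemeasurable).1 hf

section Slices

variable {n : ℕ} {q ε : ℝ} {β : Measure (Sph n)} [IsFiniteMeasure β]
  {v : EuclideanSpace ℝ (Fin n) → ℝ} {G : EuclideanSpace ℝ (Fin n) → EuclideanSpace ℝ (Fin n)}

/-- The approximating sequence of an `H¹` function on a punctured ball can be chosen so that the
functions and their gradients also converge on almost every sphere. -/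
lemma exists_slice_approx (hε : 0 ≤ ε) {R : ℝ}
    (h : H1Lim ((polarMeasure q ε β).restrict (Metric.ball 0 R)) v G) :
    let κ := ((radialMeasure q ε).restrict (Set.Iio R)).prod β
    MemLp (fun p => v (polarMap p)) 2 κ ∧ MemLp (fun p => G (polarMap p)) 2 κ ∧
    ∃ φ : ℕ → EuclideanSpace ℝ (Fin n) → ℝ, (∀ k, ContDiff ℝ ∞ (φ k)) ∧
      (∀ k, MemLp (fun p => φ k (polarMap p)) 2 κ) ∧
      (∀ k, MemLp (fun p => gradient (φ k) (polarMap p)) 2 κ) ∧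
      Tendsto (fun k => eLpNorm ((fun p => φ k (polarMap p)) - fun p => v (polarMap p)) 2 κ)
        atTop (𝓝 0) ∧
      Tendsto (fun k => eLpNorm ((fun p => gradient (φ k) (polarMap p))
        - fun p => G (polarMap p)) 2 κ) atTop (𝓝 0) ∧
      ∀ᵐ r ∂((radialMeasure q ε).restrict (Set.Iio R)),
        MemLp (fun σ => v (polarMap (r, σ))) 2 β ∧ MemLp (fun σ => G (polarMap (r, σ))) 2 β ∧
        Tendsto (fun k => eLpNorm ((fun σ => φ k (polarMap (r, σ)))
          - fun σ => v (polarMap (r, σ))) 2 β) atTop (𝓝 0) ∧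
        Tendsto (fun k => eLpNorm ((fun σ => gradient (φ k) (polarMap (r, σ)))
          - fun σ => G (polarMap (r, σ))) 2 β) atTop (𝓝 0) := by
  intro κ
  rw [polarMeasure_restrict_ball hε] at h
  obtain ⟨hv, hG, φ, h3, h4, h5⟩ := h
  have hm := (continuous_polarMap (n := n)).measurable
  have hv' : MemLp (fun p => v (polarMap p)) 2 κ := memLp_comp_of_map hm hv
  have hG' : MemLp (fun p => G (polarMap p)) 2 κ := memLp_comp_of_map hm hG
  have hφ : ∀ k, MemLp (fun p => φ k (polarMap p)) 2 κ := fun k => memLp_comp_of_map hm (h3 k).2.1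
  have hφ' : ∀ k, MemLp (fun p => gradient (φ k) (polarMap p)) 2 κ :=
    fun k => memLp_comp_of_map hm (h3 k).2.2
  have t1 : Tendsto (fun k => eLpNorm ((fun p => φ k (polarMap p)) - fun p => v (polarMap p)) 2 κ)
      atTop (𝓝 0) := h4.congr fun k =>
    eLpNorm_map_measure (g := φ k - v) (f := polarMap) ((h3 k).2.1.sub hv).1 hm.aemeasurable
  have t2 : Tendsto (fun k => eLpNorm ((fun p => gradient (φ k) (polarMap p))
      - fun p => G (polarMap p)) 2 κ) atTop (𝓝 0) := h5.congr fun k =>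
    eLpNorm_map_measure (g := gradient (φ k) - G) (f := polarMap) ((h3 k).2.2.sub hG).1
      hm.aemeasurable
  obtain ⟨ns, hns, hsl⟩ := exists_subseq_tendsto_slice_eLpNorm
    (f := fun k => (fun p => φ k (polarMap p)) - fun p => v (polarMap p))
    (g := fun k => (fun p => gradient (φ k) (polarMap p)) - fun p => G (polarMap p))
    (fun k => ((hφ k).sub hv').1) (fun k => ((hφ' k).sub hG').1) t1 t2
  refine ⟨hv', hG', fun k => φ (ns k), fun k => (h3 _).1, fun k => hφ _,
    fun k => hφ' _, t1.comp hns.tendsto_atTop, t2.comp hns.tendsto_atTop, ?_⟩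
  filter_upwards [hsl, ae_memLp_slice hv', ae_memLp_slice hG'] with r h1 h2 h3
  exact ⟨h2, h3, h1.1, h1.2⟩

lemma memLp_slice_of_continuous {F : Type*} [NormedAddCommGroup F]
    {f : EuclideanSpace ℝ (Fin n) → F} (hf : Continuous f) (r : ℝ) :
    MemLp (fun σ => f (polarMap (r, σ))) 2 β := by
  have hc : Continuous fun σ : Sph n => f (polarMap (r, σ)) :=
    hf.comp (continuous_polarMap.comp (by fun_prop))
  exact hc.memLp_of_hasCompactSupport (HasCompactSupport.of_compactSpace _)

/-- The derivative in `r` of the mean of the square of a smooth function over the sphere of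
radius `r`. -/
lemma integral_sq_sub_of_contDiff {φ : EuclideanSpace ℝ (Fin n) → ℝ} (hφ : ContDiff ℝ ∞ φ)
    {r₁ r₂ : ℝ} (h : r₁ ≤ r₂) :
    (∫ σ, φ (polarMap (r₂, σ)) * φ (polarMap (r₂, σ)) ∂β)
      - ∫ σ, φ (polarMap (r₁, σ)) * φ (polarMap (r₁, σ)) ∂β
    = 2 * ∫ p, φ (polarMap p) * inner ℝ (gradient φ (polarMap p))
        (p.2 : EuclideanSpace ℝ (Fin n)) ∂((volume.restrict (Set.Ioc r₁ r₂)).prod β) := by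
  have hφc := hφ.continuous
  have hgc := continuous_gradient hφ
  have hc : Continuous fun p : ℝ × Sph n => φ (polarMap p) * inner ℝ (gradient φ (polarMap p))
      (p.2 : EuclideanSpace ℝ (Fin n)) := by
    have := continuous_polarMap (n := n)
    fun_prop
  have hint : Integrable (fun p : ℝ × Sph n => φ (polarMap p) * inner ℝ (gradient φ (polarMap p))
      (p.2 : EuclideanSpace ℝ (Fin n))) ((volume.restrict (Set.Ioc r₁ r₂)).prod β) := by
    obtain ⟨C, hC⟩ := ((isCompact_Icc (a := r₁) (b := r₂)).prod
      (isCompact_univ (X := Sph n))).exists_bound_of_continuousOn hc.continuousOn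
    refine Integrable.of_bound hc.aestronglyMeasurable C ?_
    have h1 : ∀ᵐ p ∂((volume.restrict (Set.Ioc r₁ r₂)).prod β), p.1 ∈ Set.Ioc r₁ r₂ :=
      Measure.quasiMeasurePreserving_fst.ae (ae_restrict_mem measurableSet_Ioc)
    filter_upwards [h1] with p hp
    exact hC p ⟨Set.Ioc_subset_Icc_self hp, Set.mem_univ _⟩
  have hpt : ∀ σ : Sph n, φ (polarMap (r₂, σ)) * φ (polarMap (r₂, σ))
      - φ (polarMap (r₁, σ)) * φ (polarMap (r₁, σ))
      = 2 * ∫ r in Set.Ioc r₁ r₂, φ (polarMap (r, σ)) * inner ℝ (gradient φ (polarMap (r, σ)))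
        (σ : EuclideanSpace ℝ (Fin n)) := by
    intro σ
    have hd : ∀ r : ℝ, HasDerivAt (fun r : ℝ => φ (polarMap (r, σ)))
        (inner ℝ (gradient φ (polarMap (r, σ))) (σ : EuclideanSpace ℝ (Fin n))) r := by
      intro r
      have h1 : HasDerivAt (fun r : ℝ => polarMap (r, σ)) (σ : EuclideanSpace ℝ (Fin n)) r := by
        simpa [polarMap] using (hasDerivAt_id r).smul_const (σ : EuclideanSpace ℝ (Fin n))
      rw [inner_gradient_left]
      exact ((hφ.differentiable (by simp)) _).hasFDerivAt.comp_hasDerivAt r h1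
    have hc' : Continuous fun r : ℝ => 2 * (φ (polarMap (r, σ))
        * inner ℝ (gradient φ (polarMap (r, σ))) (σ : EuclideanSpace ℝ (Fin n))) :=
      continuous_const.mul (hc.comp (by fun_prop : Continuous fun r : ℝ => (r, σ)))
    rw [← integral_const_mul, ← intervalIntegral.integral_of_le h]
    refine (intervalIntegral.integral_eq_sub_of_hasDerivAt
      (f := fun r => φ (polarMap (r, σ)) * φ (polarMap (r, σ))) (fun r _ => ?_)
      (hc'.intervalIntegrable _ _)).symm
    refine ((hd r).mul (hd r)).congr_deriv ?_
    ring
  have hm : ∀ r : ℝ, Integrable (fun σ => φ (polarMap (r, σ)) * φ (polarMap (r, σ))) β := by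
    intro r
    exact (memLp_slice_of_continuous hφc r).integrable_mul (memLp_slice_of_continuous hφc r)
  rw [← integral_sub (hm r₂) (hm r₁), integral_prod_symm _ hint]
  simp_rw [hpt]
  rw [integral_const_mul]

/-- The mean of `v²` over spheres is an absolutely continuous function of the radius. -/
lemma ae_integral_sq_sub (hε : 0 ≤ ε) {R : ℝ}
    (h : H1Lim ((polarMeasure q ε β).restrict (Metric.ball 0 R)) v G) :
    ∀ᵐ r₁ ∂((radialMeasure q ε).restrict (Set.Iio R)),
    ∀ᵐ r₂ ∂((radialMeasure q ε).restrict (Set.Iio R)),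
      (∫ σ, v (polarMap (r₂, σ)) ^ 2 ∂β) - ∫ σ, v (polarMap (r₁, σ)) ^ 2 ∂β
      = 2 * ∫ r in r₁..r₂, ∫ σ, v (polarMap (r, σ)) * inner ℝ (G (polarMap (r, σ)))
        (σ : EuclideanSpace ℝ (Fin n)) ∂β := by
  obtain ⟨hv, hG, φ, hφ, hφm, hφgm, t1, t2, hsl⟩ := exists_slice_approx hε h
  have hle : ∀ r₁ r₂ : ℝ, ε < r₁ → r₂ < R → ∃ c : ENNReal, c ≠ ⊤ ∧
      (volume.restrict (Set.Ioc r₁ r₂)).prod β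
        ≤ c • ((radialMeasure q ε).restrict (Set.Iio R)).prod β := by
    intro r₁ r₂ h1 h2
    have h0 : 0 < r₁ := hε.trans_lt h1
    have hpos : 0 < min (r₁ ^ q) (r₂ ^ q) ∨ r₂ < r₁ := by
      rcases le_or_gt r₁ r₂ with h | h
      · exact Or.inl (lt_min (Real.rpow_pos_of_pos h0 _) (Real.rpow_pos_of_pos (h0.trans_le h) _))
      · exact Or.inr h
    rcases hpos with hpos | hlt
    · set c := ENNReal.ofReal (min (r₁ ^ q) (r₂ ^ q)) with hc
      have hc0 : c ≠ 0 := by simpa [hc] using hpos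
      refine ⟨c⁻¹, ENNReal.inv_ne_top.2 hc0, ?_⟩
      rw [radialMeasure_restrict_Iio, ← Measure.prod_smul_left]
      refine Measure.prod_mono ?_ le_rfl
      refine restrict_le_smul_withDensity measurableSet_Ioc
        (fun r (hr : r ∈ Set.Ioc r₁ r₂) =>
          (⟨h1.trans hr.1, hr.2.trans_lt h2⟩ : r ∈ Set.Ioo ε R)) hc0 ENNReal.ofReal_ne_top fun r hr => ?_
      refine ENNReal.ofReal_le_ofReal ?_
      have hr0 := h0.trans hr.1
      rcases le_total 0 q with hq | hq
      · exact (min_le_left _ _).trans (Real.rpow_le_rpow h0.le hr.1.le hq)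
      · exact (min_le_right _ _).trans (Real.rpow_le_rpow_of_nonpos hr0 hr.2 hq)
    · refine ⟨1, by simp, ?_⟩
      rw [Set.Ioc_eq_empty (by linarith)]
      simp [Measure.zero_le]
  -- the identity for ordered pairs of radii on whose spheres the approximations converge
  have key : ∀ r₁ r₂ : ℝ, ε < r₁ → r₁ ≤ r₂ → r₂ < R →
      MemLp (fun σ => v (polarMap (r₁, σ))) 2 β → MemLp (fun σ => v (polarMap (r₂, σ))) 2 β →
      Tendsto (fun k => eLpNorm ((fun σ => φ k (polarMap (r₁, σ)))
          - fun σ => v (polarMap (r₁, σ))) 2 β) atTop (𝓝 0) →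
      Tendsto (fun k => eLpNorm ((fun σ => φ k (polarMap (r₂, σ)))
          - fun σ => v (polarMap (r₂, σ))) 2 β) atTop (𝓝 0) →
      (∫ σ, v (polarMap (r₂, σ)) ^ 2 ∂β) - ∫ σ, v (polarMap (r₁, σ)) ^ 2 ∂β
      = 2 * ∫ r in r₁..r₂, ∫ σ, v (polarMap (r, σ)) * inner ℝ (G (polarMap (r, σ)))
        (σ : EuclideanSpace ℝ (Fin n)) ∂β := by
    intro r₁ r₂ h1 h12 h2 m1 m2 s1 s2
    obtain ⟨c, hc, hcl⟩ := hle r₁ r₂ h1 h2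
    set lam := (volume.restrict (Set.Ioc r₁ r₂)).prod β with hlam
    have L1 := tendsto_integral_inner m1 m1 (fun k => memLp_slice_of_continuous (hφ k).continuous r₁)
      (fun k => memLp_slice_of_continuous (hφ k).continuous r₁) s1 s1
    have L2 := tendsto_integral_inner m2 m2 (fun k => memLp_slice_of_continuous (hφ k).continuous r₂)
      (fun k => memLp_slice_of_continuous (hφ k).continuous r₂) s2 s2
    have mv : MemLp (fun p => v (polarMap p)) 2 lam := (hv.smul_measure hc).mono_measure hcl
    have mφ : ∀ k, MemLp (fun p => φ k (polarMap p)) 2 lam :=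
      fun k => ((hφm k).smul_measure hc).mono_measure hcl
    have radial : ∀ {K : EuclideanSpace ℝ (Fin n) → EuclideanSpace ℝ (Fin n)},
        MemLp (fun p => K (polarMap p)) 2 (((radialMeasure q ε).restrict (Set.Iio R)).prod β) →
        MemLp (fun p : ℝ × Sph n => inner ℝ (K (polarMap p)) (p.2 : EuclideanSpace ℝ (Fin n)))
          2 lam := by
      intro K hK
      have hK' : MemLp (fun p => K (polarMap p)) 2 lam := (hK.smul_measure hc).mono_measure hcl
      have hs : Continuous fun p : ℝ × Sph n => (p.2 : EuclideanSpace ℝ (Fin n)) := by fun_prop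
      refine memLp_two_of_bounded_mul hK' (hK'.1.inner hs.aestronglyMeasurable) 1 fun p => ?_
      refine (norm_inner_le_norm _ _).trans ?_
      simp
    have tv := tendsto_eLpNorm_of_le_smul hc hcl t1
    have tg : Tendsto (fun k => eLpNorm ((fun p : ℝ × Sph n => inner ℝ (gradient (φ k) (polarMap p))
        (p.2 : EuclideanSpace ℝ (Fin n))) - fun p => inner ℝ (G (polarMap p))
        (p.2 : EuclideanSpace ℝ (Fin n))) 2 lam) atTop (𝓝 0) := by
      refine tendsto_of_tendsto_of_tendsto_of_le_of_le tendsto_const_nhds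
        (tendsto_eLpNorm_of_le_smul hc hcl t2) (fun _ => zero_le) fun k => ?_
      refine eLpNorm_mono fun p => ?_
      simp only [Pi.sub_apply]
      rw [← inner_sub_left]
      refine (norm_inner_le_norm _ _).trans ?_
      simp
    have L3 := tendsto_integral_inner mv (radial hG) mφ (fun k => radial (hφgm k)) tv tg
    have hin : ∀ a b : ℝ, inner ℝ a b = a * b := fun a b => by simp [mul_comm]
    simp only [hin] at L1 L2 L3
    have h4 := tendsto_nhds_unique (L2.sub L1) ((L3.const_mul 2).congr fun k =>
      (integral_sq_sub_of_contDiff (hφ k) h12).symm)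
    simp only [pow_two]
    rw [h4, intervalIntegral.integral_of_le h12, integral_prod]
    have := integrable_inner_of_memLp mv (radial hG)
    simpa only [hin] using this
  have hmem : ∀ᵐ r ∂((radialMeasure q ε).restrict (Set.Iio R)), ε < r ∧ r < R := by
    have h1 : ∀ᵐ r ∂(radialMeasure q ε), ε < r := by
      rw [ae_radialMeasure_iff hε]; exact ae_restrict_mem measurableSet_Ioi
    filter_upwards [ae_restrict_of_ae h1, ae_restrict_mem measurableSet_Iio] with r h1 h2
    exact ⟨h1, h2⟩
  filter_upwards [hsl, hmem] with r₁ a1 b1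
  filter_upwards [hsl, hmem] with r₂ a2 b2
  rcases le_total r₁ r₂ with h12 | h12
  · exact key r₁ r₂ b1.1 h12 b2.2 a1.1 a2.1 a1.2.2.1 a2.2.2.1
  · have := key r₂ r₁ b2.1 h12 b1.2 a2.1 a1.1 a2.2.2.1 a1.2.2.1
    rw [intervalIntegral.integral_symm]
    linarith

/-- Approximability in `L²(β)` by smooth functions together with their tangential gradients. -/
def IsSphereH1Lim (β : Measure (Sph n)) (g : Sph n → ℝ) (K : Sph n → EuclideanSpace ℝ (Fin n)) :
    Prop :=
  MemLp g 2 β ∧ MemLp K 2 β ∧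
    ∃ φ : ℕ → EuclideanSpace ℝ (Fin n) → ℝ,
      (∀ k, ContDiff ℝ ∞ (φ k)) ∧
      Tendsto (fun k => eLpNorm (fun σ : Sph n => φ k σ - g σ) 2 β) atTop (𝓝 0) ∧
      Tendsto (fun k => eLpNorm (fun σ : Sph n => tangentialGradient (φ k) σ - K σ) 2 β)
        atTop (𝓝 0)

lemma norm_sub_inner_smul_sq (X : EuclideanSpace ℝ (Fin n)) (σ : Sph n) :
    ‖X - inner ℝ (σ : EuclideanSpace ℝ (Fin n)) X • (σ : EuclideanSpace ℝ (Fin n))‖ ^ 2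
      = ‖X‖ ^ 2 - inner ℝ X (σ : EuclideanSpace ℝ (Fin n)) ^ 2 := by
  rw [norm_sub_sq_real, inner_smul_right, norm_smul, real_inner_comm]
  have : ‖(σ : EuclideanSpace ℝ (Fin n))‖ = 1 := by simp
  rw [this, Real.norm_eq_abs, mul_one, sq_abs]
  ring

lemma norm_sub_inner_smul_le (X : EuclideanSpace ℝ (Fin n)) (σ : Sph n) :
    ‖X - inner ℝ (σ : EuclideanSpace ℝ (Fin n)) X • (σ : EuclideanSpace ℝ (Fin n))‖ ≤ ‖X‖ := by
  refine (sq_le_sq₀ (norm_nonneg _) (norm_nonneg _)).1 ?_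
  rw [norm_sub_inner_smul_sq]
  linarith [sq_nonneg (inner ℝ X (σ : EuclideanSpace ℝ (Fin n)))]

/-- Almost every spherical slice of an `H¹` function is an `H¹` function on the sphere, whose
tangential gradient is `r` times the tangential part of the gradient. -/
lemma ae_isSphereH1Lim_slice (hε : 0 ≤ ε) {R : ℝ}
    (h : H1Lim ((polarMeasure q ε β).restrict (Metric.ball 0 R)) v G) :
    ∀ᵐ r ∂((radialMeasure q ε).restrict (Set.Iio R)),
      MemLp (fun σ => G (polarMap (r, σ))) 2 β ∧
      IsSphereH1Lim β (fun σ => v (polarMap (r, σ))) (fun σ => r • (G (polarMap (r, σ))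
        - inner ℝ (σ : EuclideanSpace ℝ (Fin n)) (G (polarMap (r, σ)))
          • (σ : EuclideanSpace ℝ (Fin n)))) := by
  obtain ⟨-, -, φ, hφ, -, -, -, -, hsl⟩ := exists_slice_approx hε h
  filter_upwards [hsl] with r hr
  obtain ⟨m1, m2, s1, s2⟩ := hr
  have hs : Continuous fun σ : Sph n => (σ : EuclideanSpace ℝ (Fin n)) := continuous_subtype_val
  let L : EuclideanSpace ℝ (Fin n) →L[ℝ] EuclideanSpace ℝ (Fin n) :=
    r • ContinuousLinearMap.id ℝ _
  have hL : ∀ y, (0 : EuclideanSpace ℝ (Fin n)) + L y = r • y := fun y => by simp [L]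
  have hgrad : ∀ k y, gradient (fun y => φ k (0 + L y)) y = r • gradient (φ k) (r • y) := by
    intro k y
    rw [gradient_comp_affine ((hφ k).differentiable (by simp)), hL]
    refine ext_inner_right ℝ fun w => ?_
    rw [ContinuousLinearMap.adjoint_inner_left]
    simp [L, inner_smul_left, inner_smul_right]
  refine ⟨m2, m1, ?_, fun k y => φ k (0 + L y), fun k =>
    (hφ k).comp (contDiff_const.add L.contDiff), ?_, ?_⟩
  · have ms : AEStronglyMeasurable (fun σ : Sph n => r • (G (polarMap (r, σ))
        - inner ℝ (σ : EuclideanSpace ℝ (Fin n)) (G (polarMap (r, σ)))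
          • (σ : EuclideanSpace ℝ (Fin n)))) β := by
      have hΦ : Continuous fun p : EuclideanSpace ℝ (Fin n) × EuclideanSpace ℝ (Fin n) =>
        r • (p.2 - inner ℝ p.1 p.2 • p.1) := by fun_prop
      exact hΦ.comp_aestronglyMeasurable (hs.aestronglyMeasurable.prodMk m2.1)
    refine memLp_two_of_bounded_mul m2 ms |r| ?_
    intro σ
    rw [norm_smul, Real.norm_eq_abs]
    gcongr
    exact norm_sub_inner_smul_le _ _
  · simpa only [hL] using! s1
  · have s3 : Tendsto (fun k => ‖r‖ₑ * eLpNorm ((fun σ => gradient (φ k) (polarMap (r, σ)))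
          - fun σ => G (polarMap (r, σ))) 2 β) atTop (𝓝 0) := by
      simpa using ENNReal.Tendsto.const_mul s2 (Or.inr (enorm_ne_top (x := r)))
    refine tendsto_of_tendsto_of_tendsto_of_le_of_le tendsto_const_nhds s3
      (fun _ => zero_le) fun k => ?_
    simp only
    rw [← eLpNorm_const_smul]
    refine eLpNorm_mono fun σ => ?_
    simp only [tangentialGradient, hgrad, Pi.smul_apply, Pi.sub_apply]
    have e : r • gradient (φ k) (r • (σ : EuclideanSpace ℝ (Fin n)))
        - inner ℝ (σ : EuclideanSpace ℝ (Fin n)) (r • gradient (φ k) (r • (σ : EuclideanSpace ℝ (Fin n))))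
          • (σ : EuclideanSpace ℝ (Fin n))
        - r • (G (polarMap (r, σ)) - inner ℝ (σ : EuclideanSpace ℝ (Fin n)) (G (polarMap (r, σ)))
          • (σ : EuclideanSpace ℝ (Fin n)))
        = r • ((gradient (φ k) (polarMap (r, σ)) - G (polarMap (r, σ)))
          - inner ℝ (σ : EuclideanSpace ℝ (Fin n)) (gradient (φ k) (polarMap (r, σ))
            - G (polarMap (r, σ))) • (σ : EuclideanSpace ℝ (Fin n))) := by
      simp only [polarMap, inner_smul_right, inner_sub_right]
      module
    rw [e, norm_smul, norm_smul]
    gcongr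
    exact norm_sub_inner_smul_le _ _

end Slices

/-! ### The energy identity on spheres -/

lemma gradient_comp_norm {E : Type*} [NormedAddCommGroup E] [InnerProductSpace ℝ E]
    [FiniteDimensional ℝ E] {η : ℝ → ℝ} {y : E} (hy : y ≠ 0) {η' : ℝ}
    (hη : HasDerivAt η η' ‖y‖) :
    gradient (fun y : E => η ‖y‖) y = η' • (‖y‖⁻¹ • y) := by
  have h0 : ‖y‖ ≠ 0 := norm_ne_zero_iff.2 hy
  have h1 : HasFDerivAt (fun y : E => ‖y‖ ^ 2) (2 • innerSL ℝ y) y :=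
    (hasStrictFDerivAt_norm_sq y).hasFDerivAt
  have h2 := (h1.sqrt (by positivity))
  simp only [Real.sqrt_sq (norm_nonneg _)] at h2
  have h3 := hη.comp_hasFDerivAt y h2
  refine ext_inner_right ℝ fun w => ?_
  have h4 : (η ∘ fun y : E => ‖y‖) = fun y => η ‖y‖ := rfl
  rw [h4] at h3
  rw [inner_gradient_left, h3.fderiv]
  simp only [_root_.smul_apply, smul_eq_mul, nsmul_eq_mul, Nat.cast_ofNat,
    innerSL_apply_apply, inner_smul_left, conj_trivial]
  field_simp

lemma inv_norm_smul_polarMap {n : ℕ} {r : ℝ} (hr : 0 < r) (σ : Sph n) :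
    ‖polarMap (r, σ)‖⁻¹ • polarMap (r, σ) = (σ : EuclideanSpace ℝ (Fin n)) := by
  rw [norm_polarMap hr.le]
  simp only [polarMap]
  rw [smul_smul, inv_mul_cancel₀ hr.ne', one_smul]

section Energy

variable {n : ℕ} {q ε : ℝ} {β : Measure (Sph n)} [IsFiniteMeasure β]
  {v : EuclideanSpace ℝ (Fin n) → ℝ} {G : EuclideanSpace ℝ (Fin n) → EuclideanSpace ℝ (Fin n)}

/-- The density in `r` of the Dirichlet energy, for the measure `r^q dr × β` outside `B_ε`. -/
noncomputable def energyDensity (q ε : ℝ) (β : Measure (Sph n))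
    (G : EuclideanSpace ℝ (Fin n) → EuclideanSpace ℝ (Fin n)) : ℝ → ℝ :=
  (Set.Ioi ε).indicator fun r => r ^ q * ∫ σ, ‖G (polarMap (r, σ))‖ ^ 2 ∂β

/-- The Dirichlet energy in the ball `B_r`. -/
noncomputable def energy (q ε : ℝ) (β : Measure (Sph n))
    (G : EuclideanSpace ℝ (Fin n) → EuclideanSpace ℝ (Fin n)) (r : ℝ) : ℝ :=
  ∫ t in ε..r, energyDensity q ε β G t

/-- The pairing of `v` with its radial derivative on the sphere of radius `r`. -/
noncomputable def radialFlux (β : Measure (Sph n)) (v : EuclideanSpace ℝ (Fin n) → ℝ)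
    (G : EuclideanSpace ℝ (Fin n) → EuclideanSpace ℝ (Fin n)) (r : ℝ) : ℝ :=
  ∫ σ, v (polarMap (r, σ)) * inner ℝ (G (polarMap (r, σ))) (σ : EuclideanSpace ℝ (Fin n)) ∂β

variable (hε : 0 ≤ ε)
  (h : ∀ R : ℝ, H1Lim ((polarMeasure q ε β).restrict (Metric.ball 0 R)) v G)

include hε h

lemma integrableOn_energyDensity_Ioo (R : ℝ) :
    IntegrableOn (fun r => r ^ q * ∫ σ, ‖G (polarMap (r, σ))‖ ^ 2 ∂β) (Set.Ioo ε R) ∧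
    ∫ y in Metric.ball 0 R, ‖G y‖ ^ 2 ∂(polarMeasure q ε β)
      = ∫ r in Set.Ioo ε R, r ^ q * ∫ σ, ‖G (polarMap (r, σ))‖ ^ 2 ∂β :=
  integral_polarMeasure_ball hε (integrable_norm_sq_of_memLp (h R).2.1)

lemma intervalIntegrable_energyDensity (a b : ℝ) :
    IntervalIntegrable (energyDensity q ε β G) volume a b := by
  have h1 := (integrableOn_energyDensity_Ioo hε h (max a b + 1)).1
  rw [intervalIntegrable_iff]
  unfold energyDensity IntegrableOn
  rw [integrable_indicator_iff measurableSet_Ioi, IntegrableOn,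
    Measure.restrict_restrict measurableSet_Ioi]
  refine h1.mono_set fun r hr => ⟨hr.1, ?_⟩
  have := hr.2.2
  exact this.trans_lt (lt_add_one _)

lemma continuous_energy : Continuous (energy q ε β G) :=
  intervalIntegral.continuous_primitive (intervalIntegrable_energyDensity hε h) ε

omit [IsFiniteMeasure β] h in
lemma energyDensity_nonneg (r : ℝ) : 0 ≤ energyDensity q ε β G r := by
  unfold energyDensity
  refine Set.indicator_nonneg (fun r hr => ?_) r
  have := Real.rpow_nonneg (hε.trans (le_of_lt hr)) q
  positivity

lemma energy_sub (r₁ r₂ : ℝ) : energy q ε β G r₂ - energy q ε β G r₁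
    = ∫ t in r₁..r₂, energyDensity q ε β G t :=
  intervalIntegral.integral_interval_sub_left (intervalIntegrable_energyDensity hε h _ _)
    (intervalIntegrable_energyDensity hε h _ _)

lemma energy_mono : Monotone (energy q ε β G) := by
  intro r₁ r₂ h12
  have := intervalIntegral.integral_nonneg (f := energyDensity q ε β G) (μ := volume) h12
    fun t _ => energyDensity_nonneg hε t
  linarith [energy_sub hε h r₁ r₂]

lemma integrableOn_radialFlux (R : ℝ) :
    IntegrableOn (fun r => r ^ q * radialFlux β v G r) (Set.Ioo ε R) := by
  obtain ⟨hv, hG, -⟩ := h R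
  have hr : Measurable fun y : EuclideanSpace ℝ (Fin n) => ‖y‖⁻¹ • y := by fun_prop
  have h1 : MemLp (fun y => inner ℝ (G y) (‖y‖⁻¹ • y)) 2
      ((polarMeasure q ε β).restrict (Metric.ball 0 R)) := by
    refine memLp_two_of_bounded_mul hG (hG.1.inner hr.aestronglyMeasurable) 1 fun y => ?_
    refine (norm_inner_le_norm _ _).trans ?_
    rw [mul_comm, norm_smul, norm_inv, norm_norm]
    gcongr
    exact inv_mul_le_one
  have h2 : Integrable (fun y => v y * inner ℝ (G y) (‖y‖⁻¹ • y))
      ((polarMeasure q ε β).restrict (Metric.ball 0 R)) := hv.integrable_mul h1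
  refine (integral_polarMeasure_ball hε h2).1.congr_fun (fun r hr => ?_) measurableSet_Ioo
  have h0 : 0 < r := hε.trans_lt hr.1
  simp only [radialFlux]
  congr 1
  refine integral_congr_ae (Eventually.of_forall fun σ => ?_)
  simp only [inv_norm_smul_polarMap h0]

omit h in
/-- Testing the equation with `η(|y|) v` and integrating by parts in the radial variable, the flux
of the solution through almost every sphere is the energy inside. -/
theorem ae_radialFlux_eq_energy (hq : -1 < q)
    (hs : IsSol (polarMeasure q ε β) (ContinuousLinearMap.id ℝ _) v G) :
    ∀ᵐ r ∂(volume.restrict (Set.Ioi ε)), r ^ q * radialFlux β v G r = energy q ε β G r := by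
  have hfin := isFiniteMeasureOnCompacts_polarMeasure hq hε β
  have h := hs.1
  rw [ae_restrict_iff' measurableSet_Ioi]
  have hloc : LocallyIntegrableOn (fun r => r ^ q * radialFlux β v G r) (Set.Ioi ε) := by
    rw [locallyIntegrableOn_iff isOpen_Ioi.isLocallyClosed]
    intro K hK hKc
    obtain ⟨R, hR⟩ := hKc.bddAbove
    refine (integrableOn_radialFlux hε h (R + 1)).mono_set fun r hr => ⟨hK hr, ?_⟩
    linarith [hR hr]
  have hzero : ∀ᵐ r, r ∈ Set.Ioi ε → r ^ q * radialFlux β v G r - energy q ε β G r = 0 := by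
    refine isOpen_Ioi.ae_eq_zero_of_integral_contDiff_smul_eq_zero
      (f := fun r => r ^ q * radialFlux β v G r - energy q ε β G r)
      (hloc.sub ((continuous_energy hε h).locallyIntegrable.locallyIntegrableOn _))
      fun ξ hξ hξc hξU => ?_
    obtain ⟨b₀, hb₀⟩ := hξc.isCompact.bddAbove
    set b := max b₀ ε + 1 with hb
    have hεb : ε < b := by rw [hb]; linarith [le_max_right b₀ ε]
    have hξb : ∀ r, b ≤ r → ξ r = 0 := by
      intro r hr
      refine image_eq_zero_of_notMem_tsupport fun hmem => ?_
      have := hb₀ hmem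
      rw [hb] at hr
      linarith [le_max_left b₀ ε]
    have hξε : ∀ r, r ≤ ε → ξ r = 0 := fun r hr =>
      image_eq_zero_of_notMem_tsupport fun hmem => absurd (hξU hmem) (not_lt.2 hr)
    have hξi : ∀ a c, IntervalIntegrable ξ volume a c := fun a c =>
      hξ.continuous.intervalIntegrable a c
    set η : ℝ → ℝ := fun r => ∫ t in b..r, ξ t with hη
    have hηd : ∀ r, HasDerivAt η (ξ r) r := fun r =>
      intervalIntegral.integral_hasDerivAt_right (hξi _ _)
        (hξ.continuous.stronglyMeasurableAtFilter _ _) hξ.continuous.continuousAt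
    have hηs : ContDiff ℝ ∞ η := by
      rw [contDiff_infty_iff_deriv]
      refine ⟨fun r => (hηd r).differentiableAt, ?_⟩
      have : deriv η = ξ := funext fun r => (hηd r).deriv
      rwa [this]
    have hηb : ∀ r, b ≤ r → η r = 0 := by
      intro r hr
      simp only [hη]
      rw [intervalIntegral.integral_congr (g := fun _ => 0)]
      · simp
      · intro t ht
        rw [Set.uIcc_of_le hr] at ht
        exact hξb t ht.1
    -- `η` is constant near `0`, so that `η(|y|)` is smooth
    have hψ : ContDiff ℝ ∞ fun y : EuclideanSpace ℝ (Fin n) => η ‖y‖ := by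
      rw [contDiff_iff_contDiffAt]
      intro y
      by_cases hy : y = 0
      · subst hy
        have h0 : (0 : ℝ) ∉ tsupport ξ := fun hmem => absurd (hξU hmem) (not_lt.2 hε)
        obtain ⟨δ, hδ, hball⟩ := Metric.isOpen_iff.1 (isClosed_tsupport ξ).isOpen_compl 0 h0
        have hev : (fun y : EuclideanSpace ℝ (Fin n) => η ‖y‖) =ᶠ[𝓝 0] fun _ => η 0 := by
          filter_upwards [Metric.ball_mem_nhds _ hδ] with y hy
          rw [Metric.mem_ball, dist_zero_right] at hy
          have e : η ‖y‖ - η 0 = ∫ t in (0 : ℝ)..‖y‖, ξ t :=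
            intervalIntegral.integral_interval_sub_left (hξi _ _) (hξi _ _)
          rw [intervalIntegral.integral_congr (g := fun _ => 0)] at e
          · simp only [intervalIntegral.integral_zero] at e
            linarith
          · intro t ht
            rw [Set.uIcc_of_le (norm_nonneg _)] at ht
            refine image_eq_zero_of_notMem_tsupport (hball ?_)
            rw [Metric.mem_ball, dist_zero_right, Real.norm_eq_abs, abs_of_nonneg ht.1]
            exact ht.2.trans_lt hy
        exact contDiffAt_const.congr_of_eventuallyEq hev
      · exact hηs.contDiffAt.comp y (contDiffAt_norm ℝ hy)
    have hψ0 : ∀ y : EuclideanSpace ℝ (Fin n), y ∉ Metric.ball 0 b → η ‖y‖ = 0 := by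
      intro y hy
      rw [Metric.mem_ball, dist_zero_right, not_lt] at hy
      exact hηb _ hy
    have hψc : HasCompactSupport fun y : EuclideanSpace ℝ (Fin n) => η ‖y‖ := by
      refine HasCompactSupport.of_support_subset_isCompact (isCompact_closedBall 0 b) fun y hy => ?_
      by_contra hcon
      exact hy (hψ0 y fun h => hcon (Metric.ball_subset_closedBall h))
    have hψg : ∀ y : EuclideanSpace ℝ (Fin n), y ≠ 0 →
        gradient (fun y : EuclideanSpace ℝ (Fin n) => η ‖y‖) y = ξ ‖y‖ • (‖y‖⁻¹ • y) :=
      fun y hy => gradient_comp_norm hy (hηd _)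
    obtain ⟨i1, i2, hid⟩ := hs.integral_cutoff hψ hψc
    simp only [ContinuousLinearMap.id_apply, real_inner_self_eq_norm_sq] at i1 i2 hid
    have hb0 : 0 < b := hε.trans_lt hεb
    rw [← setIntegral_eq_integral_of_forall_compl_eq_zero (s := Metric.ball 0 b)
        (fun y hy => by rw [hψ0 y hy, zero_mul]),
      ← setIntegral_eq_integral_of_forall_compl_eq_zero (s := Metric.ball 0 b)
        (f := fun y => v y * _) (fun y hy => by
          have hb' : b ≤ ‖y‖ := by simpa using hy
          have hy0 : y ≠ 0 := norm_pos_iff.1 (hb0.trans_le hb')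
          rw [hψg y hy0, hξb _ hb']; simp),
      (integral_polarMeasure_ball hε i1.restrict).2,
      (integral_polarMeasure_ball hε i2.restrict).2] at hid
    -- both terms as radial integrals
    set e : ℝ → ℝ := fun r => r ^ q * ∫ σ, ‖G (polarMap (r, σ))‖ ^ 2 ∂β with he
    have hei : IntegrableOn e (Set.Ioo ε b) := (integrableOn_energyDensity_Ioo hε h b).1
    have t1 : ∫ r in Set.Ioo ε b, r ^ q * ∫ σ, η ‖polarMap (r, σ)‖ * ‖G (polarMap (r, σ))‖ ^ 2 ∂β
        = ∫ r in Set.Ioo ε b, e r * η r := by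
      refine setIntegral_congr_fun measurableSet_Ioo fun r hr => ?_
      have h0 : 0 < r := hε.trans_lt hr.1
      simp only [norm_polarMap h0.le, he]
      rw [integral_const_mul]
      ring
    have t2 : ∫ r in Set.Ioo ε b, r ^ q * ∫ σ, v (polarMap (r, σ)) * inner ℝ (G (polarMap (r, σ)))
          (gradient (fun y : EuclideanSpace ℝ (Fin n) => η ‖y‖) (polarMap (r, σ))) ∂β
        = ∫ r in Set.Ioo ε b, ξ r * (r ^ q * radialFlux β v G r) := by
      refine setIntegral_congr_fun measurableSet_Ioo fun r hr => ?_
      have h0 : 0 < r := hε.trans_lt hr.1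
      simp only [radialFlux]
      have : ∀ σ : Sph n, v (polarMap (r, σ)) * inner ℝ (G (polarMap (r, σ)))
          (gradient (fun y : EuclideanSpace ℝ (Fin n) => η ‖y‖) (polarMap (r, σ)))
          = ξ r * (v (polarMap (r, σ)) * inner ℝ (G (polarMap (r, σ)))
            (σ : EuclideanSpace ℝ (Fin n))) := by
        intro σ
        have hn := norm_polarMap h0.le σ
        rw [hψg _ (norm_pos_iff.1 (by rw [hn]; exact h0)), inv_norm_smul_polarMap h0, hn,
          inner_smul_right]
        ring
      simp_rw [this]
      rw [integral_const_mul]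
      ring
    rw [t1, t2] at hid
    -- integration by parts, by Fubini
    have t3 : ∫ r in Set.Ioo ε b, e r * η r
        = - ∫ s in Set.Ioo ε b, ξ s * energy q ε β G s := by
      have hξI : IntegrableOn ξ (Set.Ioo ε b) :=
        (hξ.continuous.integrableOn_Icc (a := ε) (b := b)).mono_set Set.Ioo_subset_Icc_self
      have hprod : Integrable (fun p : ℝ × ℝ => if p.1 < p.2 then e p.1 * ξ p.2 else 0)
          ((volume.restrict (Set.Ioo ε b)).prod (volume.restrict (Set.Ioo ε b))) := by
        have := (Integrable.mul_prod hei hξI).indicator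
          (measurableSet_lt measurable_fst measurable_snd)
        refine this.congr (Eventually.of_forall fun p => ?_)
        simp [Set.indicator_apply]
      have hswap := integral_integral_swap (f := fun r s => if r < s then e r * ξ s else 0) hprod
      have l1 : ∀ r ∈ Set.Ioo ε b, ∫ s in Set.Ioo ε b, (if r < s then e r * ξ s else 0)
          = -(e r * η r) := by
        intro r hr
        have : ∀ s, (if r < s then e r * ξ s else 0) = (Set.Ioi r).indicator (fun s => e r * ξ s) s :=
          fun s => by simp [Set.indicator_apply]
        simp_rw [this]
        rw [setIntegral_indicator measurableSet_Ioi, integral_const_mul]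
        have : Set.Ioo ε b ∩ Set.Ioi r = Set.Ioo r b := by
          ext s
          simp only [Set.mem_inter_iff, Set.mem_Ioo, Set.mem_Ioi]
          exact ⟨fun h => ⟨h.2, h.1.2⟩, fun h => ⟨⟨hr.1.trans h.1, h.2⟩, h.1⟩⟩
        rw [this, ← integral_Ioc_eq_integral_Ioo, ← intervalIntegral.integral_of_le hr.2.le]
        simp only [hη]
        rw [intervalIntegral.integral_symm]
        ring
      have l2 : ∀ s ∈ Set.Ioo ε b, ∫ r in Set.Ioo ε b, (if r < s then e r * ξ s else 0)
          = ξ s * energy q ε β G s := by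
        intro s hs
        have : ∀ r, (if r < s then e r * ξ s else 0) = (Set.Iio s).indicator (fun r => e r * ξ s) r :=
          fun r => by simp [Set.indicator_apply]
        simp_rw [this]
        rw [setIntegral_indicator measurableSet_Iio, integral_mul_const]
        have : Set.Ioo ε b ∩ Set.Iio s = Set.Ioo ε s := by
          ext r
          simp only [Set.mem_inter_iff, Set.mem_Ioo, Set.mem_Iio]
          exact ⟨fun h => ⟨h.1.1, h.2⟩, fun h => ⟨⟨h.1, h.2.trans hs.2⟩, h.2⟩⟩
        rw [this, mul_comm]
        congr 1
        rw [energy, intervalIntegral.integral_of_le hs.1.le, integral_Ioc_eq_integral_Ioo]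
        refine setIntegral_congr_fun measurableSet_Ioo fun r hr => ?_
        simp only [energyDensity, he]
        rw [Set.indicator_of_mem (show r ∈ Set.Ioi ε from hr.1)]
      rw [setIntegral_congr_fun measurableSet_Ioo l1, setIntegral_congr_fun measurableSet_Ioo l2,
        integral_neg] at hswap
      linarith
    have j1 : IntegrableOn (fun r => ξ r * (r ^ q * radialFlux β v G r)) (Set.Ioo ε b) := by
      obtain ⟨C, hC⟩ := hξc.exists_bound_of_continuous hξ.continuous
      exact (integrableOn_radialFlux hε h b).bdd_mul hξ.continuous.aestronglyMeasurable
        (Eventually.of_forall hC)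
    have j2 : IntegrableOn (fun r => ξ r * energy q ε β G r) (Set.Ioo ε b) := by
      have := (hξ.continuous.mul (continuous_energy hε h)).integrableOn_Icc (a := ε) (b := b)
        (μ := volume)
      exact this.mono_set Set.Ioo_subset_Icc_self
    rw [t3] at hid
    rw [← setIntegral_eq_integral_of_forall_compl_eq_zero (s := Set.Ioo ε b)]
    · simp only [smul_eq_mul, mul_sub]
      rw [integral_sub j1 j2]
      linarith
    · intro r hr
      have : ξ r = 0 := by
        by_cases hr1 : r ≤ ε
        · exact hξε r hr1
        · refine hξb r ?_
          by_contra hr2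
          exact hr ⟨not_le.1 hr1, not_le.1 hr2⟩
      rw [this, zero_smul]
  filter_upwards [hzero] with r hr hr'
  linarith [hr hr']

end Energy

/-! ### Vanishing of the energy of slowly growing solutions -/

lemma ae_Ioi_of_forall_nat {q ε : ℝ} (hε : 0 ≤ ε) {p : ℝ → Prop}
    (h : ∀ R : ℕ, ∀ᵐ r ∂((radialMeasure q ε).restrict (Set.Iio (R : ℝ))), p r) :
    ∀ᵐ r ∂(volume.restrict (Set.Ioi ε)), p r := by
  rw [← ae_radialMeasure_iff (q := q) hε]
  have h1 := ae_all_iff.2 fun R : ℕ => (ae_restrict_iff' measurableSet_Iio).1 (h R)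
  filter_upwards [h1] with r hr
  obtain ⟨R, hR⟩ := exists_nat_gt r
  exact hr R hR

lemma ae_Ioi_neBot (ε : ℝ) : (ae (volume.restrict (Set.Ioi ε))).NeBot := by
  rw [ae_neBot]
  intro h
  have : volume (Set.Ioi ε) = 0 := by rw [← Measure.restrict_apply_univ, h]; rfl
  simp at this

section

variable {n : ℕ} {q ε : ℝ} {β : Measure (Sph n)} [IsFiniteMeasure β]
  {v : EuclideanSpace ℝ (Fin n) → ℝ} {G : EuclideanSpace ℝ (Fin n) → EuclideanSpace ℝ (Fin n)}

/-- `ae_integral_sq_sub` for functions that are in `H¹` of all balls. -/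
lemma ae_integral_sq_sub_Ioi (hε : 0 ≤ ε)
    (h : ∀ R : ℝ, H1Lim ((polarMeasure q ε β).restrict (Metric.ball 0 R)) v G) :
    ∀ᵐ r₁ ∂(volume.restrict (Set.Ioi ε)), ∀ᵐ r₂ ∂(volume.restrict (Set.Ioi ε)),
      (∫ σ, v (polarMap (r₂, σ)) ^ 2 ∂β) - ∫ σ, v (polarMap (r₁, σ)) ^ 2 ∂β
      = 2 * ∫ r in r₁..r₂, radialFlux β v G r := by
  have h1 : ∀ᵐ r₁ : ℝ ∂(radialMeasure q ε), ∀ R : ℕ, r₁ < (R : ℝ) →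
      ∀ᵐ r₂ ∂((radialMeasure q ε).restrict (Set.Iio (R : ℝ))),
      (∫ σ, v (polarMap (r₂, σ)) ^ 2 ∂β) - ∫ σ, v (polarMap (r₁, σ)) ^ 2 ∂β
      = 2 * ∫ r in r₁..r₂, radialFlux β v G r :=
    ae_all_iff.2 fun R => (ae_restrict_iff' measurableSet_Iio).1 (ae_integral_sq_sub hε (h R))
  rw [ae_radialMeasure_iff hε] at h1
  filter_upwards [h1] with r₁ hr₁
  rw [← ae_radialMeasure_iff (q := q) hε]
  have h2 : ∀ᵐ r₂ : ℝ ∂(radialMeasure q ε), ∀ R : ℕ, r₁ < (R : ℝ) → r₂ < (R : ℝ) →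
      (∫ σ, v (polarMap (r₂, σ)) ^ 2 ∂β) - ∫ σ, v (polarMap (r₁, σ)) ^ 2 ∂β
      = 2 * ∫ r in r₁..r₂, radialFlux β v G r := by
    refine ae_all_iff.2 fun R => ?_
    by_cases hR : r₁ < (R : ℝ)
    · filter_upwards [(ae_restrict_iff' measurableSet_Iio).1 (hr₁ R hR)] with r₂ hr₂ _ h3
      exact hr₂ h3
    · exact Eventually.of_forall fun _ h => absurd h hR
  filter_upwards [h2] with r₂ hr₂
  obtain ⟨R, hR⟩ := exists_nat_gt (max r₁ r₂)
  exact hr₂ R ((le_max_left _ _).trans_lt hR) ((le_max_right _ _).trans_lt hR)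

/-- The mean of a solution over spheres does not depend on the radius. -/
lemma exists_ae_mean_eq (hε : 0 ≤ ε) (hq : -1 < q)
    (hs : IsSol (polarMeasure q ε β) (ContinuousLinearMap.id ℝ _) v G) :
    ∃ c : ℝ, ∀ᵐ r ∂(volume.restrict (Set.Ioi ε)), ∫ σ, v (polarMap (r, σ)) ∂β = c := by
  have hfin := isFiniteMeasureOnCompacts_polarMeasure hq hε β
  have hne := ae_Ioi_neBot ε
  -- compare the identities for `v` and `v + 1`
  have hs1 := hs.sub (isSol_const (polarMeasure q ε β) (ContinuousLinearMap.id ℝ _) (-1))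
  rw [sub_zero] at hs1
  have f0 := ae_radialFlux_eq_energy hε hq hs
  have f1 := ae_radialFlux_eq_energy hε hq hs1
  have hflux : ∀ᵐ r ∂(volume.restrict (Set.Ioi ε)),
      radialFlux β (v - fun _ => -1) G r = radialFlux β v G r := by
    filter_upwards [f0, f1, ae_restrict_mem measurableSet_Ioi] with r h0 h1 hr
    have : r ^ q ≠ 0 := (Real.rpow_pos_of_pos (hε.trans_lt hr) q).ne'
    exact mul_left_cancel₀ this (h1.trans h0.symm)
  have hsl := ae_Ioi_of_forall_nat (q := q) hε fun R => ae_isSphereH1Lim_slice hε (hs.1 R)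
  have hsq : ∀ᵐ r ∂(volume.restrict (Set.Ioi ε)),
      ∫ σ, (v - fun _ => (-1 : ℝ) : EuclideanSpace ℝ (Fin n) → ℝ) (polarMap (r, σ)) ^ 2 ∂β
        = (∫ σ, v (polarMap (r, σ)) ^ 2 ∂β) + 2 * (∫ σ, v (polarMap (r, σ)) ∂β) + β.real Set.univ := by
    filter_upwards [hsl] with r hr
    have m := hr.2.1
    have m1 : Integrable (fun σ => v (polarMap (r, σ))) β := m.integrable (by norm_num)
    have m2 : Integrable (fun σ => v (polarMap (r, σ)) ^ 2) β := m.integrable_sq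
    have : ∀ σ, (v - fun _ => (-1 : ℝ) : EuclideanSpace ℝ (Fin n) → ℝ) (polarMap (r, σ)) ^ 2
        = v (polarMap (r, σ)) ^ 2 + 2 * v (polarMap (r, σ)) + 1 := by
      intro σ; simp only [Pi.sub_apply]; ring
    simp_rw [this]
    have m3 : Integrable (fun σ => v (polarMap (r, σ)) ^ 2 + 2 * v (polarMap (r, σ))) β :=
      m2.add (m1.const_mul 2)
    rw [integral_add m3 (integrable_const _),
      integral_add m2 (m1.const_mul 2), integral_const_mul]
    simp
  obtain ⟨r₁, h1, h2, h3, hr₁⟩ := ((ae_integral_sq_sub_Ioi hε hs.1).and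
    ((ae_integral_sq_sub_Ioi hε hs1.1).and (hsq.and (ae_restrict_mem measurableSet_Ioi)))).exists
  refine ⟨∫ σ, v (polarMap (r₁, σ)) ∂β, ?_⟩
  filter_upwards [h1, h2, hsq, ae_restrict_mem measurableSet_Ioi] with r₂ g1 g2 g3 hr₂
  have e : ∫ r in r₁..r₂, radialFlux β (v - fun _ => -1) G r = ∫ r in r₁..r₂, radialFlux β v G r := by
    refine intervalIntegral.integral_congr_ae ?_
    filter_upwards [(ae_restrict_iff' measurableSet_Ioi).1 hflux] with r hr hmem
    refine hr ?_
    exact (lt_min hr₁ hr₂).trans hmem.1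
  rw [e] at g2
  linarith

lemma le_of_ae_le_of_continuousOn {f g : ℝ → ℝ} {ε : ℝ} (hf : ContinuousOn f (Set.Ioi ε))
    (hg : ContinuousOn g (Set.Ioi ε)) (h : ∀ᵐ r ∂(volume.restrict (Set.Ioi ε)), f r ≤ g r) :
    ∀ r, ε < r → f r ≤ g r := by
  intro r hr
  by_contra hcon
  rw [not_le] at hcon
  have hopen : IsOpen (Set.Ioi ε ∩ (fun r => f r - g r) ⁻¹' Set.Ioi 0) :=
    (hf.sub hg).isOpen_inter_preimage isOpen_Ioi isOpen_Ioi
  rw [ae_restrict_iff' measurableSet_Ioi] at h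
  have h0 : volume (Set.Ioi ε ∩ (fun r => f r - g r) ⁻¹' Set.Ioi 0) = 0 := by
    refine measure_mono_null (fun t ht => ?_) h
    simp only [Set.mem_compl_iff, Set.mem_ofPred_eq, not_forall, not_le]
    exact ⟨ht.1, sub_pos.1 ht.2⟩
  have hmem : r ∈ Set.Ioi ε ∩ (fun r => f r - g r) ⁻¹' Set.Ioi 0 := ⟨hr, sub_pos.2 hcon⟩
  rw [hopen.eq_empty_of_measure_zero h0] at hmem
  exact hmem

/-- Under the Poincaré inequality with constant `μ` on the sphere, a solution growing like `r^γ`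
with `γ < s` and `s² + (q - 1) s < μ` has vanishing gradient. -/
theorem gradient_eq_zero_of_growth (hε : 0 ≤ ε) (hq : -1 < q)
    (hs : IsSol (polarMeasure q ε β) (ContinuousLinearMap.id ℝ _) v G) {μ s γ C : ℝ} (hγ : 0 < γ)
    (hsγ : γ < s) (hδ : 0 < μ - s ^ 2 - s * (q - 1))
    (hP : ∀ g K, IsSphereH1Lim β g K → ∫ σ, g σ ∂β = 0 →
      μ * ∫ σ, g σ ^ 2 ∂β ≤ ∫ σ, ‖K σ‖ ^ 2 ∂β)
    (hgrow : ∀ᵐ y ∂(polarMeasure q ε β), |v y| ≤ C * (1 + ‖y‖ ^ γ)) :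
    G =ᵐ[polarMeasure q ε β] 0 := by
  have hfin := isFiniteMeasureOnCompacts_polarMeasure hq hε β
  have hne := ae_Ioi_neBot ε
  -- subtract the mean
  obtain ⟨c, hc⟩ := exists_ae_mean_eq hε hq hs
  set c' := c / β.real Set.univ with hc'
  have hs' := hs.sub (isSol_const (polarMeasure q ε β) (ContinuousLinearMap.id ℝ _) c')
  rw [sub_zero] at hs'
  set w : EuclideanSpace ℝ (Fin n) → ℝ := v - fun _ => c' with hw
  have hslv := ae_Ioi_of_forall_nat (q := q) hε fun R => ae_isSphereH1Lim_slice hε (hs.1 R)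
  have hslw := ae_Ioi_of_forall_nat (q := q) hε fun R => ae_isSphereH1Lim_slice hε (hs'.1 R)
  have hmean : ∀ᵐ r ∂(volume.restrict (Set.Ioi ε)), ∫ σ, w (polarMap (r, σ)) ∂β = 0 := by
    filter_upwards [hc, hslv] with r hr hr2
    have m1 : Integrable (fun σ => v (polarMap (r, σ))) β := hr2.2.1.integrable (by norm_num)
    simp only [hw, Pi.sub_apply]
    rw [integral_sub m1 (integrable_const _), hr, integral_const, smul_eq_mul, hc']
    by_cases hβ : β.real Set.univ = 0
    · have : β = 0 := by
        rw [← Measure.measure_univ_eq_zero]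
        exact (measureReal_eq_zero_iff (measure_ne_top _ _)).1 hβ
      rw [← hr, this]; simp
    · field_simp
      ring
  set D := |C| + |c'| with hD
  have hgw : ∀ᵐ r ∂(volume.restrict (Set.Ioi ε)), ∀ᵐ σ ∂β, w (polarMap (r, σ)) ^ 2
      ≤ (D * (1 + r ^ γ)) ^ 2 := by
    have h1 := ae_of_ae_map continuous_polarMap.aemeasurable hgrow
    have h2 := Measure.ae_ae_of_ae_prod h1
    rw [ae_radialMeasure_iff hε] at h2
    filter_upwards [h2, ae_restrict_mem measurableSet_Ioi] with r hr hr0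
    have hr0' : 0 ≤ r := hε.trans (le_of_lt hr0)
    filter_upwards [hr] with σ hσ
    rw [norm_polarMap hr0'] at hσ
    rw [← sq_abs]
    have hrγ : 0 ≤ r ^ γ := Real.rpow_nonneg hr0' γ
    have : |w (polarMap (r, σ))| ≤ D * (1 + r ^ γ) := by
      calc |w (polarMap (r, σ))| ≤ |v (polarMap (r, σ))| + |c'| := abs_sub _ _
        _ ≤ |C| * (1 + r ^ γ) + |c'| * (1 + r ^ γ) := by
            refine add_le_add (hσ.trans ?_) ?_
            · exact mul_le_mul_of_nonneg_right (le_abs_self C) (by positivity)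
            · exact le_mul_of_one_le_right (abs_nonneg _) (by linarith)
        _ = _ := by rw [hD]; ring
    gcongr
  -- the square mean `H`, its continuous representative, and the energy `F`
  set H : ℝ → ℝ := fun r => ∫ σ, w (polarMap (r, σ)) ^ 2 ∂β with hH
  set F : ℝ → ℝ := energy q ε β G with hF
  have hFlux := ae_radialFlux_eq_energy hε hq hs'
  have hFcont : Continuous F := continuous_energy hε hs'.1
  have hFmono : Monotone F := energy_mono hε hs'.1
  obtain ⟨r₀, hr₀, hr₀ε⟩ := ((ae_integral_sq_sub_Ioi hε hs'.1).and
    (ae_restrict_mem measurableSet_Ioi)).exists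
  have hpos : ∀ {r}, ε < r → 0 < r := fun h => hε.trans_lt h
  have hrc : ∀ p : ℝ, ContinuousOn (fun r : ℝ => r ^ p) (Set.Ioi ε) := fun p r hr =>
    (Real.continuousAt_rpow_const _ _ (Or.inl (hpos hr).ne')).continuousWithinAt
  set p : ℝ → ℝ := fun r => r ^ (-q) * F r with hp
  have hpc : ContinuousOn p (Set.Ioi ε) := (hrc _).mul hFcont.continuousOn
  set Ht : ℝ → ℝ := fun r => H r₀ + 2 * ∫ t in r₀..r, p t with hHt
  have hpi : ∀ r, ε < r → IntervalIntegrable p volume r₀ r := fun r hr =>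
    (hpc.mono fun t ht => (lt_min hr₀ε hr).trans_le ht.1).intervalIntegrable
  have hHd : ∀ r, ε < r → HasDerivAt Ht (2 * r ^ (-q) * F r) r := by
    intro r hr
    have h1 := intervalIntegral.integral_hasDerivAt_right (hpi r hr)
      (hpc.stronglyMeasurableAtFilter isOpen_Ioi r hr) (hpc.continuousAt (Ioi_mem_nhds hr))
    refine ((h1.const_mul 2).const_add (H r₀)).congr_deriv ?_
    simp only [hp]; ring
  have hHtc : ContinuousOn Ht (Set.Ioi ε) := fun r hr => (hHd r hr).continuousAt.continuousWithinAt
  have hHH : ∀ᵐ r ∂(volume.restrict (Set.Ioi ε)), H r = Ht r := by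
    filter_upwards [hr₀, ae_restrict_mem measurableSet_Ioi] with r hr hrε
    have e : ∫ t in r₀..r, radialFlux β w G t = ∫ t in r₀..r, p t := by
      refine intervalIntegral.integral_congr_ae ?_
      filter_upwards [(ae_restrict_iff' measurableSet_Ioi).1 hFlux] with t ht hmem
      have htε : ε < t := (lt_min hr₀ε hrε).trans hmem.1
      have h0 := hpos htε
      change radialFlux β w G t = t ^ (-q) * energy q ε β G t
      rw [← ht htε, ← mul_assoc, ← Real.rpow_add h0]
      simp
    rw [e] at hr
    simp only [hHt, hH]
    linarith
  have hrγc : ContinuousOn (fun r : ℝ => (D * (1 + r ^ γ)) ^ 2 * β.real Set.univ) (Set.Ioi ε) :=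
    (((continuousOn_const.add (hrc γ)).const_smul D).pow 2).mul continuousOn_const
  have hH0 : ∀ r, ε < r → 0 ≤ Ht r := by
    refine le_of_ae_le_of_continuousOn continuousOn_const hHtc ?_
    filter_upwards [hHH] with r hr
    rw [← hr]
    exact integral_nonneg fun σ => sq_nonneg _
  have hHg : ∀ r, ε < r → Ht r ≤ (D * (1 + r ^ γ)) ^ 2 * β.real Set.univ := by
    refine le_of_ae_le_of_continuousOn hHtc hrγc ?_
    filter_upwards [hHH, hgw, hslw] with r hr hr2 hr3
    rw [← hr]
    refine (integral_mono_ae hr3.2.1.integrable_sq (integrable_const _) hr2).trans (le_of_eq ?_)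
    rw [integral_const, smul_eq_mul, mul_comm]
  -- the differential inequality for the energy
  have hineq : ∀ r₁ r₂, ε < r₁ → r₁ ≤ r₂ →
      ∫ r in r₁..r₂, (2 * s * F r / r + (μ - s ^ 2) * r ^ (q - 2) * Ht r) ≤ F r₂ - F r₁ := by
    intro r₁ r₂ h1 h12
    rw [hF, energy_sub hε hs'.1 r₁ r₂]
    have hsub : Set.uIcc r₁ r₂ ⊆ Set.Ioi ε := by
      rw [Set.uIcc_of_le h12]; exact fun t ht => h1.trans_le ht.1
    have hinvc : ContinuousOn (fun r : ℝ => r⁻¹) (Set.Ioi ε) := fun r hr =>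
      (continuousAt_inv₀ (hpos hr).ne').continuousWithinAt
    have hcont : ContinuousOn (fun r => 2 * s * F r / r + (μ - s ^ 2) * r ^ (q - 2) * Ht r)
        (Set.Ioi ε) := by
      simp only [div_eq_mul_inv]
      exact ((continuousOn_const.mul hFcont.continuousOn).mul hinvc).add
        ((continuousOn_const.mul (hrc _)).mul hHtc)
    refine intervalIntegral.integral_mono_ae_restrict h12 (hcont.mono hsub).intervalIntegrable
      (intervalIntegrable_energyDensity hε hs'.1 _ _) ?_
    have hsub' : Set.Icc r₁ r₂ ⊆ Set.Ioi ε := fun t ht => h1.trans_le ht.1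
    refine ae_restrict_of_ae_restrict_of_subset hsub' ?_
    filter_upwards [hHH, hFlux, hslw, hmean, ae_restrict_mem measurableSet_Ioi]
      with r hrH hrF hrs hrm hr
    have h0 := hpos hr
    obtain ⟨mG, hsph⟩ := hrs
    have mw := hsph.1
    have hPoin := hP _ _ hsph hrm
    -- the radial derivative on the sphere of radius `r`
    set ρ : Sph n → ℝ := fun σ => inner ℝ (G (polarMap (r, σ))) (σ : EuclideanSpace ℝ (Fin n))
      with hρ
    have mρ : MemLp ρ 2 β := by
      refine memLp_two_of_bounded_mul mG
        (mG.1.inner (continuous_subtype_val.aestronglyMeasurable)) 1 fun σ => ?_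
      refine (norm_inner_le_norm _ _).trans ?_
      simp
    have i1 : Integrable (fun σ => ‖G (polarMap (r, σ))‖ ^ 2) β := integrable_norm_sq_of_memLp mG
    have i2 : Integrable (fun σ => ρ σ ^ 2) β := mρ.integrable_sq
    have i3 : Integrable (fun σ => w (polarMap (r, σ)) ^ 2) β := mw.integrable_sq
    have i4 : Integrable (fun σ => w (polarMap (r, σ)) * ρ σ) β := mw.integrable_mul mρ
    have e1 : ∀ σ : Sph n, ‖r • (G (polarMap (r, σ))
        - inner ℝ (σ : EuclideanSpace ℝ (Fin n)) (G (polarMap (r, σ)))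
          • (σ : EuclideanSpace ℝ (Fin n)))‖ ^ 2 = r ^ 2 * (‖G (polarMap (r, σ))‖ ^ 2 - ρ σ ^ 2) := by
      intro σ
      rw [norm_smul, mul_pow, norm_sub_inner_smul_sq, Real.norm_eq_abs, sq_abs]
    simp_rw [e1] at hPoin
    rw [integral_const_mul, integral_sub i1 i2] at hPoin
    -- `(ρ - (s / r) w)² ≥ 0` on the sphere
    have hsq : 2 * (s / r) * (∫ σ, w (polarMap (r, σ)) * ρ σ ∂β)
        - (s / r) ^ 2 * (∫ σ, w (polarMap (r, σ)) ^ 2 ∂β) ≤ ∫ σ, ρ σ ^ 2 ∂β := by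
      rw [← integral_const_mul, ← integral_const_mul, ← integral_sub (i4.const_mul _)
        (i3.const_mul _)]
      refine integral_mono ((i4.const_mul _).sub (i3.const_mul _)) i2 fun σ => ?_
      have := sq_nonneg (ρ σ - (s / r) * w (polarMap (r, σ)))
      simp only
      nlinarith
    have hflux' : r ^ q * ∫ σ, w (polarMap (r, σ)) * ρ σ ∂β = F r := hrF
    have hH' : ∫ σ, w (polarMap (r, σ)) ^ 2 ∂β = Ht r := hrH
    rw [energyDensity, Set.indicator_of_mem hr]
    rw [hH'] at hPoin hsq
    have hrq : 0 < r ^ q := Real.rpow_pos_of_pos h0 q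
    have e2 : r ^ (q - 2) = r ^ q / r ^ 2 := by
      rw [Real.rpow_sub h0]; norm_num
    have h5 : μ * Ht r / r ^ 2 ≤ (∫ σ, ‖G (polarMap (r, σ))‖ ^ 2 ∂β) - ∫ σ, ρ σ ^ 2 ∂β := by
      rw [div_le_iff₀ (by positivity)]
      linarith
    have h6 : 2 * (s / r) * (∫ σ, w (polarMap (r, σ)) * ρ σ ∂β) - (s / r) ^ 2 * Ht r
        + μ * Ht r / r ^ 2 ≤ ∫ σ, ‖G (polarMap (r, σ))‖ ^ 2 ∂β := by linarith
    have h7 := mul_le_mul_of_nonneg_left h6 hrq.le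
    refine le_trans (le_of_eq ?_) h7
    rw [← hF, ← hflux', e2]
    field_simp
    ring
  have hF0 : ∀ r, ε < r → F r = 0 := by
    refine energy_eq_zero_of_growth (H := Ht) (C := D ^ 2 * β.real Set.univ) hε hγ hsγ hδ ?_ hH0
      (hFmono.monotoneOn _) hFcont.continuousOn hHd hineq ?_
    · intro r hr
      have : F ε = 0 := by simp [hF, energy]
      rw [← this]
      exact hFmono hr.le
    · intro r hr
      refine (hHg r hr).trans (le_of_eq ?_)
      ring
  -- zero energy in every ball is a zero gradient
  refine ae_of_forall_ae_restrict_ball fun R hR => ?_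
  set R' := max R ε + 1 with hR'
  have hεR' : ε < R' := by rw [hR']; linarith [le_max_right R ε]
  have hRR' : R ≤ R' := by rw [hR']; linarith [le_max_left R ε]
  refine ae_restrict_of_ae_restrict_of_subset (Metric.ball_subset_ball hRR') ?_
  have h1 := (integrableOn_energyDensity_Ioo hε hs'.1 R').2
  have h2 : ∫ r in Set.Ioo ε R', r ^ q * ∫ σ, ‖G (polarMap (r, σ))‖ ^ 2 ∂β = F R' := by
    simp only [hF, energy]
    rw [intervalIntegral.integral_of_le hεR'.le, integral_Ioc_eq_integral_Ioo]
    refine setIntegral_congr_fun measurableSet_Ioo fun r hr => ?_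
    simp only [energyDensity]
    rw [Set.indicator_of_mem (show r ∈ Set.Ioi ε from hr.1)]
  rw [h2, hF0 R' hεR'] at h1
  have h3 := (integral_eq_zero_iff_of_nonneg (fun y => by positivity)
    (integrable_norm_sq_of_memLp (hs'.1 R').2.1)).1 h1
  filter_upwards [h3] with y hy
  simpa using hy

end

/-! ### Functions with vanishing weak gradient -/

lemma restrict_le_smul_restrict {X : Type*} [MeasurableSpace X] {μ ν : Measure X} {c : ENNReal}
    {K B : Set X}
    (hK : MeasurableSet K) (hKB : K ⊆ B) (h : μ.restrict K ≤ c • ν) :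
    μ.restrict K ≤ c • ν.restrict B := by
  rw [← Measure.restrict_smul]
  have := Measure.restrict_mono hKB h
  rwa [Measure.restrict_restrict hK, Set.inter_self] at this

section Constant

variable {E : Type*} [NormedAddCommGroup E] [InnerProductSpace ℝ E] [FiniteDimensional ℝ E]
  [MeasurableSpace E] [BorelSpace E]

omit [BorelSpace E] in
lemma H1Lim.of_le_smul {κ μ : Measure E} {u : E → ℝ} {G : E → E} (h : H1Lim μ u G)
    {c : ENNReal} (hc : c ≠ ⊤) (hκ : κ ≤ c • μ) : H1Lim κ u G := by
  obtain ⟨h1, h2, φ, h3, h4, h5⟩ := h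
  exact ⟨(h1.smul_measure hc).mono_measure hκ, (h2.smul_measure hc).mono_measure hκ, φ,
    fun k => ⟨(h3 k).1, ((h3 k).2.1.smul_measure hc).mono_measure hκ,
      ((h3 k).2.2.smul_measure hc).mono_measure hκ⟩,
    tendsto_eLpNorm_of_le_smul hc hκ h4, tendsto_eLpNorm_of_le_smul hc hκ h5⟩

/-- A function with vanishing weak gradient in a ball agrees with almost all of its translates
there, so it is constant near the centre. -/
lemma ae_eq_const_of_h1Lim_closedBall {u : E → ℝ} {x : E} {δ : ℝ} (hδ : 0 < δ)
    (h : H1Lim (volume.restrict (Metric.closedBall x (3 * δ))) u 0) :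
    ∃ c : ℝ, ∀ᵐ z ∂(volume.restrict (Metric.ball x δ)), u z = c := by
  obtain ⟨u', hu'm, hu'⟩ := h.1.1
  have h' : H1Lim (volume.restrict (Metric.closedBall x (3 * δ))) u' 0 :=
    h.congr hu' (EventuallyEq.refl _ _)
  have hsub : Metric.ball x δ ⊆ Metric.closedBall x (3 * δ) :=
    Metric.ball_subset_closedBall.trans (Metric.closedBall_subset_closedBall (by linarith))
  have hu'2 := ae_restrict_of_ae_restrict_of_subset hsub hu'
  suffices ∃ c : ℝ, ∀ᵐ z ∂(volume.restrict (Metric.ball x δ)), u' z = c by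
    obtain ⟨c, hc⟩ := this
    exact ⟨c, by filter_upwards [hc, hu'2] with z h1 h2; rw [h2, h1]⟩
  have hinv : ∀ h ∈ Metric.ball (0 : E) (2 * δ), ∀ᵐ z ∂(volume.restrict (Metric.ball x δ)),
      u' (z + h) = u' z := by
    intro h hh
    rw [Metric.mem_ball, dist_zero_right] at hh
    have h1 := h'.eLpNorm_translate_sub_le (μ := volume.restrict (Metric.ball x δ)) h ?_
    · have h0 : eLpNorm (0 : E → E) 2 (volume.restrict (Metric.closedBall x (3 * δ))) = 0 :=
        eLpNorm_zero
      rw [h0, mul_zero, nonpos_iff_eq_zero, eLpNorm_eq_zero_iff _ (by norm_num)] at h1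
      · filter_upwards [h1] with z hz
        simpa [sub_eq_zero] using hz
      · exact ((hu'm.measurable.comp (measurable_add_const h)).sub
          hu'm.measurable).aestronglyMeasurable
    · intro t ht
      have hmp := measurePreserving_add_right (volume : Measure E) (t • h)
      have hemb : MeasurableEmbedding (fun z : E => z + t • h) := measurableEmbedding_addRight _
      have hs : Metric.ball x δ ⊆ (fun z : E => z + t • h) ⁻¹' Metric.closedBall x (3 * δ) := by
        intro z hz
        simp only [Set.mem_preimage, Metric.mem_closedBall, Metric.mem_ball, dist_eq_norm] at hz ⊢
        have h2 : ‖t • h‖ ≤ 2 * δ := by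
          rw [norm_smul, Real.norm_eq_abs, abs_of_nonneg ht.1]
          nlinarith [ht.2, norm_nonneg h]
        have e : z + t • h - x = (z - x) + t • h := by abel
        rw [e]
        exact (norm_add_le _ _).trans (by linarith)
      calc (volume.restrict (Metric.ball x δ)).map (fun z => z + t • h)
          ≤ (volume.restrict ((fun z : E => z + t • h) ⁻¹' Metric.closedBall x (3 * δ))).map
              (fun z => z + t • h) :=
            Measure.map_mono (Measure.restrict_mono_set _ hs) hemb.measurable
        _ = volume.restrict (Metric.closedBall x (3 * δ)) :=
            (hmp.restrict_preimage_emb hemb _).map_eq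
  have hmeas : MeasurableSet {p : E × E | u' (p.2 + p.1) = u' p.2} :=
    measurableSet_eq_fun (hu'm.measurable.comp (measurable_snd.add measurable_fst))
      (hu'm.measurable.comp measurable_snd)
  have hae : ∀ᵐ h ∂(volume.restrict (Metric.ball (0 : E) (2 * δ))),
      ∀ᵐ z ∂(volume.restrict (Metric.ball x δ)), u' (z + h) = u' z := by
    filter_upwards [ae_restrict_mem Metric.isOpen_ball.measurableSet] with h hh using hinv h hh
  rw [Measure.ae_ae_comm hmeas] at hae
  have hne : (ae (volume.restrict (Metric.ball x δ))).NeBot := by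
    rw [ae_neBot]
    intro h0
    rw [Measure.restrict_eq_zero] at h0
    exact (Metric.measure_ball_pos volume x hδ).ne' h0
  obtain ⟨z, hz, hzx⟩ := (hae.and (ae_restrict_mem Metric.isOpen_ball.measurableSet)).exists
  refine ⟨u' z, ?_⟩
  rw [ae_restrict_iff' Metric.isOpen_ball.measurableSet] at hz ⊢
  have h3 := (measurePreserving_add_right (volume : Measure E) (-z)).quasiMeasurePreserving.ae hz
  filter_upwards [h3] with w hw hwx
  have := hw (by
    rw [Metric.mem_ball] at hzx hwx
    rw [Metric.mem_ball, dist_zero_right, ← sub_eq_add_neg, ← dist_eq_norm]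
    have := dist_triangle_right w z x
    linarith)
  simpa using this

/-- A function with zero weak gradient is constant on a connected open set where Lebesgue measure is
locally controlled by `ν`. -/
lemma ae_eq_const_of_gradient_eq_zero {ν : Measure E} {u : E → ℝ} {U : Set E} (hU : IsOpen U)
    (hUc : IsPreconnected U) (hν : ∀ K ⊆ U, IsCompact K → ∃ c : ENNReal, c ≠ ⊤ ∧
      volume.restrict K ≤ c • ν) (h : ∀ R : ℝ, H1Lim (ν.restrict (Metric.ball 0 R)) u 0) :
    ∃ c : ℝ, ∀ᵐ z, z ∈ U → u z = c := by
  have hloc : ∀ x ∈ U, ∃ c : ℝ, ∃ δ : ℝ, 0 < δ ∧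
      ∀ᵐ z ∂(volume.restrict (Metric.ball x δ)), u z = c := by
    intro x hx
    obtain ⟨r, hr, hrU⟩ := Metric.nhds_basis_closedBall.mem_iff.1 (hU.mem_nhds hx)
    obtain ⟨c, hc, hcK⟩ := hν _ hrU (isCompact_closedBall x r)
    obtain ⟨R, hR⟩ := (Metric.isBounded_closedBall (x := x) (r := r)).subset_ball (0 : E)
    have h1 := restrict_le_smul_restrict Metric.isClosed_closedBall.measurableSet hR hcK
    have e : r = 3 * (r / 3) := by ring
    have h2 := (h R).of_le_smul hc h1
    rw [e] at h2
    obtain ⟨c, hc⟩ := ae_eq_const_of_h1Lim_closedBall (by positivity) h2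
    exact ⟨c, r / 3, by positivity, hc⟩
  choose! f δ hδ hf using hloc
  have huniq : ∀ x (s : ℝ) (c c' : ℝ), 0 < s → (∀ᵐ z ∂(volume.restrict (Metric.ball x s)), u z = c) →
      (∀ᵐ z ∂(volume.restrict (Metric.ball x s)), u z = c') → c = c' := by
    intro x s c c' hs h1 h2
    have hne : (ae ((volume : Measure E).restrict (Metric.ball x s))).NeBot := by
      rw [ae_neBot]
      intro h0
      rw [Measure.restrict_eq_zero] at h0
      exact (Metric.measure_ball_pos volume x hs).ne' h0
    obtain ⟨z, hz, hz'⟩ := (h1.and h2).exists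
    exact hz.symm.trans hz'
  have hlc : IsLocallyConstant fun x : U => f x := by
    rw [IsLocallyConstant.iff_eventually_eq]
    intro x
    have h1 : ∀ᶠ y : E in 𝓝 (x : E), y ∈ U → f y = f x := by
      filter_upwards [Metric.ball_mem_nhds (x : E) (hδ x x.2)] with y hy hyU
      obtain ⟨s, hs, hsub⟩ := Metric.isOpen_iff.1 (Metric.isOpen_ball.inter Metric.isOpen_ball) y
        ⟨hy, Metric.mem_ball_self (hδ y hyU)⟩
      exact huniq y s _ _ hs
        (ae_restrict_of_ae_restrict_of_subset (hsub.trans Set.inter_subset_right) (hf y hyU))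
        (ae_restrict_of_ae_restrict_of_subset (hsub.trans Set.inter_subset_left) (hf x x.2))
    filter_upwards [continuous_subtype_val.continuousAt.eventually h1] with y hy using hy y.2
  have hUp : PreconnectedSpace U := Subtype.preconnectedSpace hUc
  rcases U.eq_empty_or_nonempty with hemp | ⟨x₀, hx₀⟩
  · exact ⟨0, by simp [hemp]⟩
  refine ⟨f x₀, ?_⟩
  have hconst : ∀ x ∈ U, f x = f x₀ := fun x hx =>
    hlc.apply_eq_of_preconnectedSpace ⟨x, hx⟩ ⟨x₀, hx₀⟩
  have h0 : volume {z | z ∈ U ∧ u z ≠ f x₀} = 0 := by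
    refine measure_null_of_locally_null _ fun x hx => ?_
    refine ⟨_, inter_mem_nhdsWithin _ (Metric.ball_mem_nhds x (hδ x hx.1)), ?_⟩
    have h2 := hf x hx.1
    rw [hconst x hx.1, ae_restrict_iff' Metric.isOpen_ball.measurableSet] at h2
    refine measure_mono_null ?_ h2
    rintro z ⟨⟨-, hz⟩, hzb⟩
    simp only [Set.mem_compl_iff, Set.mem_ofPred_eq, Classical.not_imp]
    exact ⟨hzb, hz⟩
  filter_upwards [compl_mem_ae_iff.2 h0] with z hz hzU
  by_contra hne
  exact hz ⟨hzU, hne⟩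

end Constant

lemma isPreconnected_setOf_lt_norm {n : ℕ} (hn : 2 ≤ n) {ε : ℝ} (hε : 0 ≤ ε) :
    IsPreconnected {y : EuclideanSpace ℝ (Fin n) | ε < ‖y‖} := by
  have h1 : IsPreconnected (Metric.sphere (0 : EuclideanSpace ℝ (Fin n)) 1) :=
    isPreconnected_sphere (by
      rw [← Module.finrank_eq_rank, finrank_euclideanSpace_fin]; exact_mod_cast hn) _ _
  have h2 := (isPreconnected_Ioi (a := ε)).prod h1
  have h3 := h2.image (fun p : ℝ × EuclideanSpace ℝ (Fin n) => p.1 • p.2)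
    (by fun_prop : Continuous _).continuousOn
  convert h3
  ext y
  simp only [Set.mem_ofPred_eq, Set.mem_image, Set.mem_prod, Set.mem_Ioi, Prod.exists,
    mem_sphere_iff_norm, sub_zero]
  constructor
  · intro hy
    have h0 : ‖y‖ ≠ 0 := (hε.trans_lt hy).ne'
    exact ⟨‖y‖, ‖y‖⁻¹ • y, ⟨hy, by rw [norm_smul, norm_inv, norm_norm, inv_mul_cancel₀ h0]⟩,
      by rw [smul_smul, mul_inv_cancel₀ h0, one_smul]⟩
  · rintro ⟨r, σ, ⟨hr, hσ⟩, rfl⟩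
    rw [norm_smul, hσ, mul_one, Real.norm_eq_abs]
    exact hr.trans_le (le_abs_self r)

/-! ### Solutions that do not depend on some of the variables -/

section Reduction

variable {E X F : Type*}
  [NormedAddCommGroup E] [InnerProductSpace ℝ E] [FiniteDimensional ℝ E]
  [MeasurableSpace E] [BorelSpace E]
  [NormedAddCommGroup X] [InnerProductSpace ℝ X] [FiniteDimensional ℝ X]
  [MeasurableSpace X] [BorelSpace X]
  [NormedAddCommGroup F] [InnerProductSpace ℝ F] [FiniteDimensional ℝ F]
  [MeasurableSpace F] [BorelSpace F]
  {ν : Measure E} {ν' : Measure F} {J : (X × F) ≃L[ℝ] E} {c : ENNReal}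

/-- The component in `X` of a point, in the linear coordinates `J`. -/
def fstCLM (J : (X × F) ≃L[ℝ] E) : E →L[ℝ] X :=
  (ContinuousLinearMap.fst ℝ X F).comp (J.symm : E →L[ℝ] X × F)

/-- The component in `F` of a point, in the linear coordinates `J`. -/
def sndCLM (J : (X × F) ≃L[ℝ] E) : E →L[ℝ] F :=
  (ContinuousLinearMap.snd ℝ X F).comp (J.symm : E →L[ℝ] X × F)

/-- The inclusion of `F`, in the linear coordinates `J`. -/
def inrCLM (J : (X × F) ≃L[ℝ] E) : F →L[ℝ] E := (J : (X × F) →L[ℝ] E).comp (.inr ℝ X F)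

omit [FiniteDimensional ℝ E] [MeasurableSpace E] [BorelSpace E] [FiniteDimensional ℝ X]
  [MeasurableSpace X] [BorelSpace X] [FiniteDimensional ℝ F] [MeasurableSpace F] [BorelSpace F] in
@[simp] lemma fstCLM_apply_mk (p : X × F) : fstCLM J (J p) = p.1 := by simp [fstCLM]

omit [FiniteDimensional ℝ E] [MeasurableSpace E] [BorelSpace E] [FiniteDimensional ℝ X]
  [MeasurableSpace X] [BorelSpace X] [FiniteDimensional ℝ F] [MeasurableSpace F] [BorelSpace F] in
@[simp] lemma sndCLM_apply_mk (p : X × F) : sndCLM J (J p) = p.2 := by simp [sndCLM]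

omit [FiniteDimensional ℝ E] in
lemma exists_map_prod_restrict_le [SFinite ν'] (hJ : ((volume : Measure X).prod ν').map J = c • ν)
    (r : ℝ) : ∃ R : ℝ,
    (((volume : Measure X).restrict (Metric.ball 0 r)).prod (ν'.restrict (Metric.ball 0 r))).map J
      ≤ c • ν.restrict (Metric.ball 0 R) := by
  have hb : Bornology.IsBounded (J '' (Metric.ball (0 : X) r ×ˢ Metric.ball (0 : F) r)) :=
    (J : (X × F) →L[ℝ] E).lipschitz.isBounded_image (Metric.isBounded_ball.prod Metric.isBounded_ball)
  obtain ⟨R, hR⟩ := hb.subset_ball (0 : E)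
  refine ⟨R, ?_⟩
  rw [Measure.prod_restrict, ← Measure.restrict_smul, ← hJ,
    Measure.restrict_map J.continuous.measurable Metric.isOpen_ball.measurableSet]
  refine Measure.map_mono (Measure.restrict_mono_set _ ?_) J.continuous.measurable
  exact fun p hp => hR (Set.mem_image_of_mem _ hp)

omit [FiniteDimensional ℝ E] in
lemma exists_restrict_map_sndCLM_le [SFinite ν'] (hc : c ≠ 0) (hc' : c ≠ ⊤)
    (hJ : ((volume : Measure X).prod ν').map J = c • ν) (R : ℝ) :
    ∃ (k : ENNReal) (r : ℝ), k ≠ ⊤ ∧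
      (ν.restrict (Metric.ball 0 R)).map (sndCLM J) ≤ k • ν'.restrict (Metric.ball 0 r) := by
  have hb : Bornology.IsBounded (J.symm '' Metric.ball (0 : E) R) :=
    (J.symm : E →L[ℝ] (X × F)).lipschitz.isBounded_image Metric.isBounded_ball
  obtain ⟨r, hr⟩ := hb.subset_ball (0 : X × F)
  refine ⟨c⁻¹ * volume (Metric.ball (0 : X) r), r,
    ENNReal.mul_ne_top (ENNReal.inv_ne_top.2 hc) measure_ball_lt_top.ne, ?_⟩
  have hν : ν = c⁻¹ • ((volume : Measure X).prod ν').map J := by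
    rw [hJ, smul_smul, ENNReal.inv_mul_cancel hc hc', one_smul]
  rw [hν, Measure.restrict_smul, Measure.map_smul,
    Measure.restrict_map J.continuous.measurable Metric.isOpen_ball.measurableSet,
    Measure.map_map (sndCLM J).continuous.measurable J.continuous.measurable, mul_smul]
  have h1 : (J : X × F → E) ⁻¹' Metric.ball 0 R ⊆ Metric.ball 0 r ×ˢ Metric.ball 0 r := by
    intro p hp
    have := hr ⟨J p, hp, J.symm_apply_apply p⟩
    rwa [← ball_prod_same] at this
  have h2 : (sndCLM J : E → F) ∘ (J : X × F → E) = Prod.snd := by ext p; simp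
  rw [h2]
  have h3 := Measure.map_mono (Measure.restrict_mono_set ((volume : Measure X).prod ν') h1)
    (measurable_snd : Measurable (Prod.snd : X × F → F))
  rw [← Measure.prod_restrict, Measure.map_snd_prod, Measure.restrict_apply_univ] at h3
  gcongr

/-- Slices of an `H¹` function are `H¹` functions. -/
lemma ae_h1Lim_slice [SFinite ν'] (hc' : c ≠ ⊤)
    (hJ : ((volume : Measure X).prod ν').map J = c • ν) {u : E → ℝ} {G : E → E}
    (h : ∀ R : ℝ, H1Lim (ν.restrict (Metric.ball 0 R)) u G) :
    ∀ᵐ x : X, ∀ R : ℝ, H1Lim (ν'.restrict (Metric.ball 0 R)) (fun y => u (J (x, y)))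
      (fun y => (inrCLM J).adjoint (G (J (x, y)))) := by
  have key : ∀ r : ℝ, ∀ᵐ x ∂((volume : Measure X).restrict (Metric.ball 0 r)),
      H1Lim (ν'.restrict (Metric.ball 0 r)) (fun y => u (J (x, y)))
        (fun y => (inrCLM J).adjoint (G (J (x, y)))) := by
    intro r
    obtain ⟨R, hR⟩ := exists_map_prod_restrict_le hJ r
    obtain ⟨h1, h2, φ, h3, h4, h5⟩ := (h R).of_le_smul hc' hR
    set κ := ((volume : Measure X).restrict (Metric.ball 0 r)).prod (ν'.restrict (Metric.ball 0 r))
      with hκ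
    have hJm : Measurable (J : X × F → E) := J.continuous.measurable
    have m1 := memLp_comp_of_map hJm h1
    have m2 := memLp_comp_of_map hJm h2
    have m3 := fun k => memLp_comp_of_map hJm (h3 k).2.1
    have m4 := fun k => memLp_comp_of_map hJm (h3 k).2.2
    have t1 : Tendsto (fun k => eLpNorm (fun p => φ k (J p) - u (J p)) 2 κ) atTop (𝓝 0) := by
      refine h4.congr fun k => ?_
      rw [eLpNorm_map_measure ((h3 k).2.1.1.sub h1.1) hJm.aemeasurable]
      rfl
    have t2 : Tendsto (fun k => eLpNorm (fun p => gradient (φ k) (J p) - G (J p)) 2 κ)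
        atTop (𝓝 0) := by
      refine h5.congr fun k => ?_
      rw [eLpNorm_map_measure ((h3 k).2.2.1.sub h2.1) hJm.aemeasurable]
      rfl
    obtain ⟨ns, hns, hsl⟩ := exists_subseq_tendsto_slice_eLpNorm
      (fun k => ((m3 k).sub m1).1) (fun k => ((m4 k).sub m2).1) t1 t2
    filter_upwards [hsl, ae_memLp_slice m1, ae_memLp_slice m2,
      ae_all_iff.2 fun k => ae_memLp_slice (m3 k), ae_all_iff.2 fun k => ae_memLp_slice (m4 k)]
      with x hx x1 x2 x3 x4
    have hadj : ∀ f : F → E, MemLp f 2 (ν'.restrict (Metric.ball 0 r)) →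
        MemLp (fun y => (inrCLM J).adjoint (f y)) 2 (ν'.restrict (Metric.ball 0 r)) := fun f hf =>
      memLp_two_of_bounded_mul hf
        ((inrCLM J).adjoint.continuous.comp_aestronglyMeasurable hf.1) _
        fun y => (inrCLM J).adjoint.le_opNorm _
    have haff : ∀ y, J (x, y) = J (x, 0) + inrCLM J y := fun y => by
      rw [inrCLM, ContinuousLinearMap.comp_apply, ContinuousLinearMap.inr_apply,
        ContinuousLinearEquiv.coe_coe, ← map_add]; simp
    have hg : ∀ k, gradient (fun y => φ k (J (x, y)))
        = fun y => (inrCLM J).adjoint (gradient (φ k) (J (x, y))) := by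
      intro k
      ext1 y
      have := gradient_comp_affine (f := φ k) ((h3 k).1.differentiable (by simp)) (inrCLM J)
        (J (x, 0)) y
      have e : (fun y => φ k (J (x, y))) = fun y => φ k (J (x, 0) + inrCLM J y) :=
        funext fun y => by rw [haff y]
      rw [e, this, ← haff y]
    refine ⟨x1, hadj _ x2, fun j y => φ (ns j) (J (x, y)), fun j => ⟨?_, x3 _, ?_⟩, hx.1, ?_⟩
    · exact (h3 _).1.comp (J.contDiff.comp (contDiff_prodMk_right x))
    · rw [hg]; exact hadj _ (x4 _)
    · simp_rw [hg]
      have hz : Tendsto (fun j => ENNReal.ofReal ‖(inrCLM J).adjoint‖ *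
          eLpNorm (fun y => gradient (φ (ns j)) (J (x, y)) - G (J (x, y))) 2
            (ν'.restrict (Metric.ball 0 r))) atTop (𝓝 0) := by
        have := ENNReal.Tendsto.const_mul (a := ENNReal.ofReal ‖(inrCLM J).adjoint‖) hx.2
          (Or.inr ENNReal.ofReal_ne_top)
        rwa [mul_zero] at this
      refine tendsto_of_tendsto_of_tendsto_of_le_of_le tendsto_const_nhds hz (fun _ => zero_le) ?_
      intro j
      refine eLpNorm_le_mul_eLpNorm_of_ae_le_mul (Eventually.of_forall fun y => ?_) 2
      rw [Pi.sub_apply, ← map_sub]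
      exact (inrCLM J).adjoint.le_opNorm _
  have h1 : ∀ N : ℕ, ∀ᵐ x : X, H1Lim (ν'.restrict (Metric.ball 0 N)) (fun y => u (J (x, y)))
        (fun y => (inrCLM J).adjoint (G (J (x, y)))) := by
    intro N
    refine ae_of_forall_ae_restrict_ball fun R _ => ?_
    refine ae_restrict_of_ae_restrict_of_subset (Metric.ball_subset_ball (le_max_left R N)) ?_
    filter_upwards [key (max R N)] with x hx
    exact hx.mono_measure (Measure.restrict_mono_set _ (Metric.ball_subset_ball (le_max_right R N)))
  filter_upwards [ae_all_iff.2 h1] with x hx R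
  obtain ⟨N, hN⟩ := exists_nat_ge R
  exact (hx N).mono_measure (Measure.restrict_mono_set _ (Metric.ball_subset_ball hN))

/-- The pullback of an `H¹` function of `y` is an `H¹` function, with the pulled back gradient. -/
lemma h1Lim_comp_sndCLM [SFinite ν'] (hc : c ≠ 0) (hc' : c ≠ ⊤)
    (hJ : ((volume : Measure X).prod ν').map J = c • ν) {V : F → ℝ} {K : F → F}
    (h : ∀ R : ℝ, H1Lim (ν'.restrict (Metric.ball 0 R)) V K) (R : ℝ) :
    H1Lim (ν.restrict (Metric.ball 0 R)) (fun z => V (sndCLM J z))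
      (fun z => (sndCLM J).adjoint (K (sndCLM J z))) := by
  obtain ⟨k, r, hk, hkr⟩ := exists_restrict_map_sndCLM_le hc hc' hJ R
  obtain ⟨h1, h2, φ, h3, h4, h5⟩ := (h r).of_le_smul hk hkr
  set κ := ν.restrict (Metric.ball 0 R) with hκ
  have hm : Measurable (sndCLM J) := (sndCLM J).continuous.measurable
  have hadj : ∀ f : F → F, MemLp f 2 (κ.map (sndCLM J)) →
      MemLp (fun z => (sndCLM J).adjoint (f (sndCLM J z))) 2 κ := fun f hf =>
    memLp_two_of_bounded_mul (memLp_comp_of_map hm hf)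
      ((sndCLM J).adjoint.continuous.comp_aestronglyMeasurable (memLp_comp_of_map hm hf).1) _
      fun y => (sndCLM J).adjoint.le_opNorm _
  have hg : ∀ k, gradient (fun z => φ k (sndCLM J z))
      = fun z => (sndCLM J).adjoint (gradient (φ k) (sndCLM J z)) := by
    intro k
    ext1 z
    have := gradient_comp_affine (f := φ k) ((h3 k).1.differentiable (by simp)) (sndCLM J) 0 z
    simpa using this
  refine ⟨memLp_comp_of_map hm h1, hadj _ h2, fun k z => φ k (sndCLM J z), fun k => ⟨?_, ?_, ?_⟩,
    ?_, ?_⟩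
  · exact (h3 k).1.comp (sndCLM J).contDiff
  · exact memLp_comp_of_map hm (h3 k).2.1
  · rw [hg]; exact hadj _ (h3 k).2.2
  · refine h4.congr fun k => ?_
    rw [eLpNorm_map_measure ((h3 k).2.1.1.sub h1.1) hm.aemeasurable]
    rfl
  · have hz : Tendsto (fun k => ENNReal.ofReal ‖(sndCLM J).adjoint‖ *
        eLpNorm (gradient (φ k) - K) 2 (κ.map (sndCLM J))) atTop (𝓝 0) := by
      have := ENNReal.Tendsto.const_mul (a := ENNReal.ofReal ‖(sndCLM J).adjoint‖) h5
        (Or.inr ENNReal.ofReal_ne_top)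
      rwa [mul_zero] at this
    refine tendsto_of_tendsto_of_tendsto_of_le_of_le tendsto_const_nhds hz (fun _ => zero_le) ?_
    intro k
    simp only
    rw [eLpNorm_map_measure ((h3 k).2.2.1.sub h2.1) hm.aemeasurable]
    refine eLpNorm_le_mul_eLpNorm_of_ae_le_mul (Eventually.of_forall fun z => ?_) 2
    rw [Pi.sub_apply, hg, ← map_sub]
    exact (sndCLM J).adjoint.le_opNorm _

omit [FiniteDimensional ℝ E] in
lemma ae_iff_ae_prod (hc : c ≠ 0) (hJ : ((volume : Measure X).prod ν').map J = c • ν)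
    {p : E → Prop} : (∀ᵐ z ∂ν, p z) ↔ ∀ᵐ q ∂((volume : Measure X).prod ν'), p (J q) := by
  have e : (∀ᵐ z ∂ν, p z) ↔ ∀ᵐ z ∂(c • ν), p z := by
    rw [Measure.ae_ennreal_smul_measure_eq hc]
  rw [e, ← hJ]
  exact J.toHomeomorph.measurableEmbedding.ae_map_iff

omit [FiniteDimensional ℝ E] in
/-- A function that is invariant under each translation along `X`, up to a null set that may
depend on the translation, agrees with almost every one of its slices. -/
lemma ae_ae_eq_slice [SFinite ν'] (hc : c ≠ 0)
    (hJ : ((volume : Measure X).prod ν').map J = c • ν) {u : E → ℝ} (hu : AEStronglyMeasurable u ν)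
    (hinv : ∀ h : X, ∀ᵐ z ∂ν, u (z + J (h, 0)) = u z) :
    ∀ᵐ x₀ : X, ∀ᵐ z ∂ν, u z = u (J (x₀, sndCLM J z)) := by
  have hJm : Measurable (J : X × F → E) := J.continuous.measurable
  have hν : ∀ p : E → Prop, (∀ᵐ z ∂ν, p z) ↔ ∀ᵐ q ∂((volume : Measure X).prod ν'), p (J q) :=
    fun p => ae_iff_ae_prod hc hJ
  obtain ⟨w, hwm, hw⟩ := hu
  have hwJ := (hν _).1 hw
  have hwm' : Measurable fun p : X × F => w (J p) := hwm.measurable.comp hJm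
  have h1 : ∀ h : X, ∀ᵐ x : X, ∀ᵐ y ∂ν', w (J (x + h, y)) = w (J (x, y)) := by
    intro h
    suffices ∀ᵐ p ∂((volume : Measure X).prod ν'), w (J (p.1 + h, p.2)) = w (J p) from
      Measure.ae_ae_of_ae_prod this
    have hq : Measure.QuasiMeasurePreserving (fun p : X × F => (p.1 + h, p.2))
        ((volume : Measure X).prod ν') ((volume : Measure X).prod ν') := by
      have h1 := measurePreserving_add_right (volume : Measure X) h
      have h2 := MeasurePreserving.id ν'
      exact (h1.prod h2).quasiMeasurePreserving
    filter_upwards [(hν _).1 (hinv h), hwJ, hq.ae hwJ] with p e1 e2 e3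
    have e4 : J p + J (h, 0) = J (p.1 + h, p.2) :=
      (map_add J _ _).symm.trans (congrArg J (Prod.ext rfl (add_zero _)))
    rw [e4] at e1
    rw [← e3, e1, e2]
  have hms : MeasurableSet {p : X × X | ∀ᵐ y ∂ν', w (J (p.2 + p.1, y)) = w (J (p.2, y))} := by
    have hs : MeasurableSet {q : (X × X) × F | ¬ w (J (q.1.2 + q.1.1, q.2)) = w (J (q.1.2, q.2))} :=
      (measurableSet_eq_fun (hwm'.comp (by fun_prop)) (hwm'.comp (by fun_prop))).compl
    exact measurableSet_eq_fun (measurable_measure_prodMk_left hs) measurable_const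
  have h2 : ∀ᵐ x : X, ∀ᵐ h : X, ∀ᵐ y ∂ν', w (J (x + h, y)) = w (J (x, y)) := by
    rw [← Measure.ae_ae_comm hms]
    exact Eventually.of_forall h1
  filter_upwards [h2, Measure.ae_ae_of_ae_prod hwJ] with x₀ hx₀ hx₀'
  rw [hν]
  have h3 : ∀ᵐ x : X, ∀ᵐ y ∂ν', w (J (x, y)) = w (J (x₀, y)) := by
    have := (measurePreserving_add_left (volume : Measure X) (-x₀)).quasiMeasurePreserving.ae hx₀
    simpa using this
  have h4 : ∀ᵐ p ∂((volume : Measure X).prod ν'), w (J p) = w (J (x₀, p.2)) := by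
    have hm : Measurable fun p : X × F => w (J (x₀, p.2)) :=
      hwm'.comp (measurable_const.prodMk measurable_snd)
    rw [Measure.ae_prod_iff_ae_ae (measurableSet_eq_fun hwm' hm)]
    exact h3
  filter_upwards [h4, hwJ,
    (Measure.quasiMeasurePreserving_snd (μ := (volume : Measure X)) (ν := ν')).ae hx₀'] with p e1 e2 e3
  rw [sndCLM_apply_mk, e2, e1, e3]

omit [FiniteDimensional ℝ E] [MeasurableSpace E] [BorelSpace E] [FiniteDimensional ℝ F]
  [MeasurableSpace F] [BorelSpace F] [InnerProductSpace ℝ F] [NormedAddCommGroup F]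
  [NormedAddCommGroup E] [InnerProductSpace ℝ E] in
lemma integral_fderiv_apply_eq_zero {φ : X → ℝ} (hφ : ContDiff ℝ ∞ φ) (hφc : HasCompactSupport φ)
    (w : X) : ∫ x, fderiv ℝ φ x w = 0 := by
  have hd : Continuous fun x => fderiv ℝ φ x w :=
    (hφ.continuous_fderiv (by simp)).clm_apply continuous_const
  have hdc : HasCompactSupport fun x => fderiv ℝ φ x w :=
    (hφc.fderiv (𝕜 := ℝ)).comp_left (g := fun L : X →L[ℝ] ℝ => L w) rfl
  have := integral_mul_fderiv_eq_neg_fderiv_mul_of_integrable (μ := (volume : Measure X))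
    (f := fun _ => (1 : ℝ)) (g := φ) (v := w) (by simp)
    (by simpa using hd.integrable_of_hasCompactSupport hdc)
    (by simpa using hφ.continuous.integrable_of_hasCompactSupport hφc)
    (fun x _ => differentiableAt_const _) fun x _ => hφ.differentiable (by simp) x
  simpa using this

/-- Derivatives along `X` have vanishing integral. -/
lemma integral_inner_inl_gradient_eq_zero [SFinite ν'] (hc : c ≠ 0) (hc' : c ≠ ⊤)
    [IsFiniteMeasureOnCompacts ν]
    (hJ : ((volume : Measure X).prod ν').map J = c • ν) {φ : E → ℝ} (hφ : ContDiff ℝ ∞ φ)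
    (hφc : HasCompactSupport φ) (w : X) :
    ∫ z, inner ℝ (J (w, 0)) (gradient φ z) ∂ν = 0 := by
  have hme : MeasurableEmbedding (J : X × F → E) := J.toHomeomorph.measurableEmbedding
  have hint : Integrable (fun z => inner ℝ (J (w, 0)) (gradient φ z)) ν :=
    Integrable.const_inner _ ((continuous_gradient hφ).integrable_of_hasCompactSupport
      (hasCompactSupport_gradient hφc))
  have hint' := hint.smul_measure hc'
  rw [← hJ, hme.integrable_map_iff] at hint'
  have h1 := hme.integral_map (μ := (volume : Measure X).prod ν')
    (fun z => inner ℝ (J (w, 0)) (gradient φ z))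
  rw [hJ, integral_smul_measure] at h1
  have h2 := integral_prod_symm _ hint'
  simp only [Function.comp_def] at h2
  rw [h2] at h1
  have h3 : ∀ y, ∫ x, inner ℝ (J (w, 0)) (gradient φ (J (x, y))) = 0 := by
    intro y
    have hsl : ContDiff ℝ ∞ fun x => φ (J (x, y)) :=
      hφ.comp (J.contDiff.comp (contDiff_prodMk_left y))
    have hslc : HasCompactSupport fun x => φ (J (x, y)) := by
      have h4 : HasCompactSupport fun p : X × F => φ (J p) := hφc.comp_homeomorph J.toHomeomorph
      refine HasCompactSupport.intro (h4.isCompact.image continuous_fst) fun x hx => ?_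
      by_contra hne
      exact hx ⟨(x, y), subset_tsupport _ hne, rfl⟩
    rw [← integral_fderiv_apply_eq_zero hsl hslc w]
    refine integral_congr_ae (Eventually.of_forall fun x => ?_)
    have hd : HasFDerivAt (fun x => φ (J (x, y)))
        ((fderiv ℝ φ (J (x, y))).comp ((J : X × F →L[ℝ] E).comp (.inl ℝ X F))) x := by
      have h5 : HasFDerivAt (fun x : X => (x, y)) (.inl ℝ X F) x := hasFDerivAt_prodMk_left x y
      exact ((hφ.differentiable (by simp) _).hasFDerivAt).comp x
        ((J : X × F →L[ℝ] E).hasFDerivAt.comp x h5)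
    simp only
    rw [hd.fderiv, real_inner_comm, inner_gradient_left]
    simp
  simp only [h3, integral_zero, smul_eq_mul] at h1
  exact (mul_eq_zero.1 h1).resolve_left (ENNReal.toReal_ne_zero.2 ⟨hc, hc'⟩)

/-- Testing with products `χ(x) ψ(y)`: the terms with `∇χ` integrate to zero, and what remains is
the weak equation for the slice. -/
lemma integral_inner_gradient_eq_zero_of_comp_sndCLM [SFinite ν'] (hct : c ≠ ⊤)
    [IsFiniteMeasureOnCompacts ν] [IsFiniteMeasureOnCompacts ν']
    (hJ : ((volume : Measure X).prod ν').map J = c • ν) {A : E →L[ℝ] E}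
    (hA : ∀ g g' : F, inner ℝ (A ((sndCLM J).adjoint g)) ((sndCLM J).adjoint g') = inner ℝ g g')
    {u : E → ℝ} {K : F → F} (hs : IsSol ν A u fun z => (sndCLM J).adjoint (K (sndCLM J z)))
    (hK : ∀ R : ℝ, MemLp K 2 (ν'.restrict (Metric.ball 0 R)))
    {ψ : F → ℝ} (hψ : ContDiff ℝ ∞ ψ) (hψc : HasCompactSupport ψ) :
    ∫ y, inner ℝ (K y) (gradient ψ y) ∂ν' = 0 := by
  let χ : ContDiffBump (0 : X) := ⟨1, 2, by norm_num, by norm_num⟩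
  have hχ : ContDiff ℝ ∞ χ := χ.contDiff
  have hχc : HasCompactSupport χ := χ.hasCompactSupport
  have hχ0 : 0 < ∫ x, χ x := χ.integral_pos
  set φ : E → ℝ := fun z => χ (fstCLM J z) * ψ (sndCLM J z) with hφdef
  have hφ : ContDiff ℝ ∞ φ :=
    (hχ.comp (fstCLM J).contDiff).mul (hψ.comp (sndCLM J).contDiff)
  have hφc : HasCompactSupport φ := by
    have h1 : HasCompactSupport fun p : X × F => χ p.1 * ψ p.2 := by
      refine HasCompactSupport.intro (hχc.isCompact.prod hψc.isCompact) fun p hp => ?_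
      rw [Set.mem_prod, not_and_or] at hp
      rcases hp with hp | hp
      · rw [image_eq_zero_of_notMem_tsupport hp, zero_mul]
      · rw [image_eq_zero_of_notMem_tsupport hp, mul_zero]
    have h2 := h1.comp_homeomorph J.symm.toHomeomorph
    exact h2
  have hgφ : ∀ x y, gradient φ (J (x, y)) = χ x • (sndCLM J).adjoint (gradient ψ y)
      + ψ y • (fstCLM J).adjoint (gradient χ x) := by
    intro x y
    have e1 := gradient_comp_affine (f := χ) (hχ.differentiable (by simp)) (fstCLM J) 0 (J (x, y))
    have e2 := gradient_comp_affine (f := ψ) (hψ.differentiable (by simp)) (sndCLM J) 0 (J (x, y))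
    simp only [zero_add] at e1 e2
    have d1 : Differentiable ℝ fun z => χ (fstCLM J z) :=
      (hχ.comp (fstCLM J).contDiff).differentiable (by simp)
    have d2 : Differentiable ℝ fun z => ψ (sndCLM J z) :=
      (hψ.comp (sndCLM J).contDiff).differentiable (by simp)
    rw [hφdef, gradient_mul' d1 d2, e1, e2]
    simp
  set w : F → X := fun y => ψ y • fstCLM J (A ((sndCLM J).adjoint (K y))) with hw
  have hpt : ∀ x y, inner ℝ (A ((sndCLM J).adjoint (K (sndCLM J (J (x, y))))))
      (gradient φ (J (x, y))) = χ x * inner ℝ (K y) (gradient ψ y)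
        + inner ℝ (w y) (gradient χ x) := by
    intro x y
    rw [hgφ, inner_add_right, inner_smul_right, inner_smul_right, sndCLM_apply_mk, hA,
      ContinuousLinearMap.adjoint_inner_right, hw, inner_smul_left]
    simp
  obtain ⟨R, hR⟩ := exists_tsupport_subset_ball hψc
  have hgR : ∀ y ∉ Metric.ball (0 : F) R, gradient ψ y = 0 := by
    intro y hy
    have : fderiv ℝ ψ y = 0 := image_eq_zero_of_notMem_tsupport
        (fun h => hy (hR (tsupport_fderiv_subset ℝ h)))
    simp [gradient, this]
  have ia : Integrable (fun y => inner ℝ (K y) (gradient ψ y)) ν' := by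
    have h1 := integrable_inner_of_memLp (hK R)
      (memLp_restrict_ball_of_continuous (ν := ν') (continuous_gradient hψ) R)
    refine (integrableOn_iff_integrable_of_support_subset fun y hy => ?_).1 h1
    by_contra hy'
    exact hy (by simp [hgR y hy'])
  have iw : Integrable w ν' := by
    let T : F →L[ℝ] X := (fstCLM J).comp (A.comp (sndCLM J).adjoint)
    have hTK : MemLp (fun y => T (K y)) 2 (ν'.restrict (Metric.ball 0 R)) :=
      memLp_two_of_bounded_mul (hK R) (T.continuous.comp_aestronglyMeasurable (hK R).1) ‖T‖
        fun y => T.le_opNorm _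
    have h1 : IntegrableOn w (Metric.ball 0 R) ν' :=
      memLp_one_iff_integrable.1
        (hTK.smul (memLp_restrict_ball_of_continuous (ν := ν') hψ.continuous R))
    refine (integrableOn_iff_integrable_of_support_subset fun y hy => ?_).1 h1
    by_contra hy'
    exact hy (by simp [hw, image_eq_zero_of_notMem_tsupport (fun h => hy' (hR h))])
  have h0 := hs.2 φ hφ hφc
  have hint := hs.integrable_inner_gradient hφ hφc
  have hme : MeasurableEmbedding (J : X × F → E) := J.toHomeomorph.measurableEmbedding
  have hint' := hint.smul_measure hct
  rw [← hJ, hme.integrable_map_iff] at hint'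
  have h0' : ∫ p, inner ℝ (A ((sndCLM J).adjoint (K (sndCLM J (J p))))) (gradient φ (J p))
      ∂((volume : Measure X).prod ν') = 0 := by
    have := hme.integral_map (μ := (volume : Measure X).prod ν')
      (fun z => inner ℝ (A ((sndCLM J).adjoint (K (sndCLM J z)))) (gradient φ z))
    rw [hJ, integral_smul_measure, h0, smul_zero] at this
    exact this.symm
  have hip := integral_prod _ hint'
  simp only [Function.comp_def] at hip
  rw [hip] at h0'
  have hin : ∀ x, ∫ y, inner ℝ (A ((sndCLM J).adjoint (K (sndCLM J (J (x, y))))))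
      (gradient φ (J (x, y))) ∂ν' = χ x * ∫ y, inner ℝ (K y) (gradient ψ y) ∂ν'
        + inner ℝ (∫ y, w y ∂ν') (gradient χ x) := by
    intro x
    simp_rw [hpt]
    rw [integral_add (ia.const_mul _) (iw.inner_const _), integral_const_mul]
    simp_rw [real_inner_comm (gradient χ x)]
    rw [integral_inner iw]
  simp_rw [hin] at h0'
  have hgχ : Integrable (gradient χ : X → X) := (continuous_gradient hχ).integrable_of_hasCompactSupport
    (hasCompactSupport_gradient hχc)
  have hz : ∫ x, inner ℝ (∫ y, w y ∂ν') (gradient χ x) = 0 := by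
    simp_rw [real_inner_comm (gradient χ _) (∫ y, w y ∂ν'), inner_gradient_left]
    exact integral_fderiv_apply_eq_zero hχ hχc _
  rw [integral_add (hχ.continuous.integrable_of_hasCompactSupport hχc |>.mul_const _)
    (hgχ.const_inner _), hz, add_zero, integral_mul_const] at h0'
  exact (mul_eq_zero.1 h0').resolve_left hχ0.ne'

/-- A solution that is invariant under translations along `X` is given by one of its slices, and
this slice solves the equation with coefficients `sndCLM J ∘ A ∘ (sndCLM J)†`, here the identity. -/
theorem exists_isSol_slice [SFinite ν'] (hc : c ≠ 0) (hc' : c ≠ ⊤)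
    [IsFiniteMeasureOnCompacts ν] [IsFiniteMeasureOnCompacts ν']
    (hJ : ((volume : Measure X).prod ν').map J = c • ν) {A : E →L[ℝ] E}
    (hA : ∀ g g' : F, inner ℝ (A ((sndCLM J).adjoint g)) ((sndCLM J).adjoint g') = inner ℝ g g')
    {u : E → ℝ} {G : E → E} (hs : IsSol ν A u G)
    (huniq : ∀ G', (∀ R : ℝ, H1Lim (ν.restrict (Metric.ball 0 R)) u G') → G' =ᵐ[ν] G)
    (hu : AEStronglyMeasurable u ν) (hinv : ∀ h : X, ∀ᵐ z ∂ν, u (z + J (h, 0)) = u z)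
    {p : E → Prop} (hp : ∀ᵐ z ∂ν, p z) :
    ∃ (x₀ : X) (K : F → F), IsSol ν' (ContinuousLinearMap.id ℝ F) (fun y => u (J (x₀, y))) K ∧
      (∀ᵐ z ∂ν, u z = u (J (x₀, sndCLM J z))) ∧ ∀ᵐ y ∂ν', p (J (x₀, y)) := by
  have hpJ : ∀ᵐ x : X, ∀ᵐ y ∂ν', p (J (x, y)) :=
    Measure.ae_ae_of_ae_prod (p := fun q => p (J q)) ((ae_iff_ae_prod hc hJ).1 hp)
  obtain ⟨x₀, hx, hslice, hpx⟩ := ((ae_h1Lim_slice hc' hJ hs.1).and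
    ((ae_ae_eq_slice hc hJ hu hinv).and hpJ)).exists
  refine ⟨x₀, fun y => (inrCLM J).adjoint (G (J (x₀, y))), ⟨hx, fun ψ hψ hψc => ?_⟩, hslice, hpx⟩
  have h1 : ∀ R : ℝ, H1Lim (ν.restrict (Metric.ball 0 R)) u fun z =>
      (sndCLM J).adjoint ((inrCLM J).adjoint (G (J (x₀, sndCLM J z)))) := fun R =>
    (h1Lim_comp_sndCLM hc hc' hJ hx R).congr
      (ae_restrict_of_ae (hslice.mono fun z hz => hz.symm)) (EventuallyEq.refl _ _)
  have h2 := huniq _ h1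
  have hs' : IsSol ν A u fun z =>
      (sndCLM J).adjoint ((inrCLM J).adjoint (G (J (x₀, sndCLM J z)))) := by
    refine ⟨h1, fun φ hφ hφc => ?_⟩
    rw [← hs.2 φ hφ hφc]
    refine integral_congr_ae ?_
    filter_upwards [h2] with z hz
    rw [hz]
  exact integral_inner_gradient_eq_zero_of_comp_sndCLM hc' hJ hA
    (K := fun y => (inrCLM J).adjoint (G (J (x₀, y)))) hs' (fun R => (hx R).2.1) hψ hψc

end Reduction

/-! ### Measures that are products in suitable linear coordinates -/

lemma eq_inv_smul_map {X Y : Type*} [MeasurableSpace X] [MeasurableSpace Y] {κ : Measure X}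
    {f : X → Y} {ν : Measure Y} {c : ENNReal} (hc : c ≠ 0) (hc' : c ≠ ⊤) (hJ : κ.map f = c • ν) :
    ν = c⁻¹ • κ.map f := by
  rw [hJ, smul_smul, ENNReal.inv_mul_cancel hc hc', one_smul]

section ProductMeasure

variable {E X F : Type*}
  [NormedAddCommGroup E] [InnerProductSpace ℝ E] [FiniteDimensional ℝ E]
  [MeasurableSpace E] [BorelSpace E]
  [NormedAddCommGroup X] [InnerProductSpace ℝ X] [FiniteDimensional ℝ X]
  [MeasurableSpace X] [BorelSpace X]
  [NormedAddCommGroup F] [InnerProductSpace ℝ F] [FiniteDimensional ℝ F]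
  [MeasurableSpace F] [BorelSpace F]
  {ν : Measure E} {ν' : Measure F} {J : (X × F) ≃L[ℝ] E} {c : ENNReal}

omit [FiniteDimensional ℝ E] in
lemma measurePreserving_add_of_map_prod [SFinite ν'] (hc : c ≠ 0) (hc' : c ≠ ⊤)
    (hJ : ((volume : Measure X).prod ν').map J = c • ν) (h : X) :
    MeasurePreserving (fun z => z + J (h, 0)) ν ν := by
  have h1 := measurePreserving_add_right (volume : Measure X) h
  have h2 := MeasurePreserving.id ν'
  have h3 := h1.prod h2
  have hm : Measurable fun z : E => z + J (h, 0) := measurable_add_const _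
  refine ⟨hm, ?_⟩
  rw [eq_inv_smul_map hc hc' hJ, Measure.map_smul, Measure.map_map hm J.continuous.measurable]
  have e : (fun z => z + J (h, 0)) ∘ (J : X × F → E) = J ∘ Prod.map (fun x => x + h) id := by
    ext p
    exact (map_add J _ _).symm.trans (congrArg J (Prod.ext rfl (add_zero _)))
  rw [e, ← Measure.map_map J.continuous.measurable h3.measurable, h3.map_eq]

omit [FiniteDimensional ℝ E] in
lemma isFiniteMeasureOnCompacts_of_map_prod [SFinite ν'] [IsFiniteMeasureOnCompacts ν']
    (hc : c ≠ 0) (hc' : c ≠ ⊤) (hJ : ((volume : Measure X).prod ν').map J = c • ν) :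
    IsFiniteMeasureOnCompacts ν := by
  refine ⟨fun K hK => ?_⟩
  rw [eq_inv_smul_map hc hc' hJ, Measure.smul_apply, smul_eq_mul,
    J.toHomeomorph.measurableEmbedding.map_apply (f := (J : X × F → E))]
  refine ENNReal.mul_lt_top (ENNReal.inv_lt_top.2 (pos_iff_ne_zero.2 hc)) ?_
  exact IsCompact.measure_lt_top (J.toHomeomorph.isCompact_preimage.2 hK)

omit [FiniteDimensional ℝ E] in
lemma exists_measure_ball_le [SFinite ν'] (hc : c ≠ 0) (hc' : c ≠ ⊤)
    (hJ : ((volume : Measure X).prod ν').map J = c • ν) {C s : ℝ} (hC : 0 ≤ C)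
    (hν' : ∀ R : ℝ, 1 ≤ R → ν' (Metric.ball 0 R) ≤ ENNReal.ofReal (C * R ^ s)) :
    ∃ D : ℝ, 0 ≤ D ∧ ∀ R : ℝ, 1 ≤ R →
      ν (Metric.ball 0 R) ≤ ENNReal.ofReal (D * R ^ (Module.finrank ℝ X + s)) := by
  set L : ℝ := max ‖(J.symm : E →L[ℝ] X × F)‖ 1 with hL
  have hL1 : 1 ≤ L := le_max_right _ _
  set k := Module.finrank ℝ X with hk
  refine ⟨(c⁻¹).toReal * (L ^ k * (volume (Metric.ball (0 : X) 1)).toReal * (C * L ^ s)),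
    by positivity, fun R hR => ?_⟩
  have hR0 : 0 < R := by linarith
  have hsub : (J : X × F → E) ⁻¹' Metric.ball 0 R ⊆ Metric.ball 0 (L * R) ×ˢ Metric.ball 0 (L * R) := by
    intro p hp
    rw [ball_prod_same, Metric.mem_ball]
    have h1 := (J.symm : E →L[ℝ] X × F).le_opNorm (J p)
    simp only [ContinuousLinearEquiv.coe_coe, J.symm_apply_apply] at h1
    rw [Set.mem_preimage, Metric.mem_ball, dist_zero_right] at hp
    rw [show ((0 : X), (0 : F)) = 0 from rfl, dist_zero_right]
    calc ‖p‖ ≤ L * ‖J p‖ := h1.trans (by gcongr; exact le_max_left _ _)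
      _ < L * R := by gcongr
  rw [eq_inv_smul_map hc hc' hJ, Measure.smul_apply, smul_eq_mul,
    J.toHomeomorph.measurableEmbedding.map_apply (f := (J : X × F → E))]
  have hLR : 1 ≤ L * R := one_le_mul_of_one_le_of_one_le hL1 hR
  calc c⁻¹ * ((volume : Measure X).prod ν') ((J : X × F → E) ⁻¹' Metric.ball 0 R)
      ≤ c⁻¹ * (volume (Metric.ball (0 : X) (L * R)) * ν' (Metric.ball 0 (L * R))) := by
        gcongr
        exact (measure_mono hsub).trans (Measure.prod_prod _ _).le
    _ ≤ c⁻¹ * (ENNReal.ofReal ((L * R) ^ k) * volume (Metric.ball (0 : X) 1)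
          * ENNReal.ofReal (C * (L * R) ^ s)) := by
        gcongr
        · rw [Measure.addHaar_ball_of_pos _ _ (by positivity)]
        · exact hν' _ hLR
    _ = ENNReal.ofReal ((c⁻¹).toReal * (L ^ k * (volume (Metric.ball (0 : X) 1)).toReal
          * (C * L ^ s)) * R ^ ((k : ℝ) + s)) := by
        rw [← ENNReal.ofReal_toReal (ENNReal.inv_ne_top.2 hc),
          ← ENNReal.ofReal_toReal (measure_ball_lt_top (μ := (volume : Measure X)) (x := 0)
            (r := 1)).ne, ← ENNReal.ofReal_mul (by positivity), ← ENNReal.ofReal_mul (by positivity),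
          ← ENNReal.ofReal_mul (by positivity), ENNReal.toReal_ofReal (by positivity),
          ENNReal.toReal_ofReal (by positivity)]
        congr 1
        rw [Real.rpow_add hR0, Real.rpow_natCast, Real.mul_rpow (by positivity) hR0.le, mul_pow]
        ring

end ProductMeasure

/-- Polynomial growth of the measure and of the function on balls gives polynomial growth in `L²`. -/
lemma exists_eLpNorm_le_of_growth {E : Type*} [NormedAddCommGroup E] [MeasurableSpace E]
    [OpensMeasurableSpace E] {ν : Measure E} {D s : ℝ} (hD : 0 ≤ D)
    (hν : ∀ R : ℝ, 1 ≤ R → ν (Metric.ball 0 R) ≤ ENNReal.ofReal (D * R ^ s)) {u : E → ℝ}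
    {c γ : ℝ} (hc : 0 ≤ c) (hγ : 0 ≤ γ) (hu : ∀ᵐ z ∂ν, |u z| ≤ c * (1 + ‖z‖ ^ γ)) :
    ∃ (M : ℝ) (p : ℕ), 0 ≤ M ∧ ∀ R : ℝ, 1 ≤ R →
      eLpNorm u 2 (ν.restrict (Metric.ball 0 R)) ≤ ENNReal.ofReal (M * R ^ p) := by
  obtain ⟨p, hp⟩ := exists_nat_ge (s / 2 + γ)
  refine ⟨D ^ (1 / 2 : ℝ) * (2 * c), p, by positivity, fun R hR => ?_⟩
  have hR0 : 0 < R := by linarith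
  have h1 : ∀ᵐ z ∂(ν.restrict (Metric.ball 0 R)), ‖u z‖ ≤ 2 * c * R ^ γ := by
    filter_upwards [ae_restrict_of_ae hu, ae_restrict_mem Metric.isOpen_ball.measurableSet]
      with z hz hzR
    rw [Metric.mem_ball, dist_zero_right] at hzR
    have h2 : ‖z‖ ^ γ ≤ R ^ γ := Real.rpow_le_rpow (norm_nonneg _) hzR.le hγ
    have h3 : 1 ≤ R ^ γ := Real.one_le_rpow hR hγ
    rw [Real.norm_eq_abs]
    nlinarith
  have h2 := eLpNorm_le_of_ae_bound (p := 2) h1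
  refine h2.trans ?_
  rw [Measure.restrict_apply_univ]
  calc (ν (Metric.ball 0 R)) ^ (ENNReal.toReal 2)⁻¹ * ENNReal.ofReal (2 * c * R ^ γ)
      ≤ (ENNReal.ofReal (D * R ^ s)) ^ (ENNReal.toReal 2)⁻¹ * ENNReal.ofReal (2 * c * R ^ γ) := by
        gcongr; exact hν R hR
    _ = ENNReal.ofReal (D ^ (1 / 2 : ℝ) * (2 * c) * R ^ (s / 2 + γ)) := by
        rw [ENNReal.ofReal_rpow_of_nonneg (by positivity) (by positivity),
          ← ENNReal.ofReal_mul (by positivity), Real.mul_rpow hD (by positivity),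
          ← Real.rpow_mul hR0.le, Real.rpow_add hR0]
        congr 1
        simp only [ENNReal.toReal_ofNat, one_div]
        rw [← div_eq_mul_inv]
        ring
    _ ≤ ENNReal.ofReal (D ^ (1 / 2 : ℝ) * (2 * c) * R ^ p) := by
        rw [← Real.rpow_natCast]
        gcongr

lemma radialMeasure_Iio_le {q ε : ℝ} (hq : -1 < q) (hε : 0 ≤ ε) {R : ℝ} (hR : 0 ≤ R) :
    radialMeasure q ε (Set.Iio R) ≤ ENNReal.ofReal (R ^ (q + 1) / (q + 1)) := by
  rw [← Measure.restrict_apply_univ, radialMeasure_restrict_Iio, withDensity_apply _ .univ,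
    Measure.restrict_univ]
  calc ∫⁻ r in Set.Ioo ε R, ENNReal.ofReal (r ^ q)
      ≤ ∫⁻ r in Set.Ioc 0 R, ENNReal.ofReal (r ^ q) :=
        lintegral_mono_set ((Set.Ioo_subset_Ioo_left hε).trans Set.Ioo_subset_Ioc_self)
    _ = ENNReal.ofReal (∫ r in Set.Ioc 0 R, r ^ q) := by
        rw [ofReal_integral_eq_lintegral_ofReal]
        · exact (intervalIntegrable_iff_integrableOn_Ioc_of_le hR).1
            (intervalIntegral.intervalIntegrable_rpow' hq)
        · filter_upwards [ae_restrict_mem measurableSet_Ioc] with r hr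
          exact Real.rpow_nonneg hr.1.le _
    _ = ENNReal.ofReal (R ^ (q + 1) / (q + 1)) := by
        rw [← intervalIntegral.integral_of_le hR, integral_rpow (Or.inl hq),
          Real.zero_rpow (by linarith), sub_zero]

lemma polarMeasure_ball_le {n : ℕ} {q ε : ℝ} (hq : -1 < q) (hε : 0 ≤ ε) (β : Measure (Sph n))
    [IsFiniteMeasure β] {R : ℝ} (hR : 0 ≤ R) : polarMeasure q ε β (Metric.ball 0 R)
      ≤ ENNReal.ofReal ((β Set.univ).toReal / (q + 1) * R ^ (q + 1)) := by
  rw [← Measure.restrict_apply_univ, polarMeasure_restrict_ball hε,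
    Measure.map_apply continuous_polarMap.measurable .univ, Set.preimage_univ,
    ← Set.univ_prod_univ, Measure.prod_prod, Measure.restrict_apply_univ]
  have h0 : 0 ≤ R ^ (q + 1) := Real.rpow_nonneg hR _
  have h1 : 0 < q + 1 := by linarith
  calc _ ≤ ENNReal.ofReal (R ^ (q + 1) / (q + 1)) * ENNReal.ofReal (β Set.univ).toReal := by
        rw [ENNReal.ofReal_toReal (measure_ne_top _ _)]
        gcongr
        exact radialMeasure_Iio_le hq hε hR
    _ = _ := by
        rw [← ENNReal.ofReal_mul (by positivity)]
        congr 1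
        ring

/-! ### Polar coordinates for homogeneous weights -/

instance (n : ℕ) : IsFiniteMeasure (surfaceMeasure n) := by
  unfold surfaceMeasure; infer_instance

lemma lintegral_eq_lintegral_polarMap {n : ℕ} [NeZero n] {f : EuclideanSpace ℝ (Fin n) → ENNReal}
    (hf : Measurable f) : ∫⁻ y, f y = ∫⁻ r in Set.Ioi (0 : ℝ), ∫⁻ σ,
      ENNReal.ofReal (r ^ (n - 1)) * f (polarMap (r, σ)) ∂(surfaceMeasure n) := by
  have hfr : Module.finrank ℝ (EuclideanSpace ℝ (Fin n)) = n := finrank_euclideanSpace_fin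
  have hmp := (volume : Measure (EuclideanSpace ℝ (Fin n))).measurePreserving_homeomorphUnitSphereProd
  have hsing : MeasurableSet ({0}ᶜ : Set (EuclideanSpace ℝ (Fin n))) :=
    (measurableSet_singleton _).compl
  have h1 : ∫⁻ y, f y = ∫⁻ y : ({0}ᶜ : Set (EuclideanSpace ℝ (Fin n))), f y
      ∂((volume : Measure (EuclideanSpace ℝ (Fin n))).comap (↑)) := by
    rw [lintegral_subtype_comap hsing, restrict_compl_singleton]
  have h2 : ∀ y : ({0}ᶜ : Set (EuclideanSpace ℝ (Fin n))), f y
      = (fun p : Sph n × Set.Ioi (0 : ℝ) => f (polarMap (p.2, p.1)))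
        (homeomorphUnitSphereProd (EuclideanSpace ℝ (Fin n)) y) := by
    intro y
    have : (homeomorphUnitSphereProd (EuclideanSpace ℝ (Fin n))).symm
        (homeomorphUnitSphereProd (EuclideanSpace ℝ (Fin n)) y) = y := by simp
    conv_lhs => rw [← this]
    have h0 : ‖(y : EuclideanSpace ℝ (Fin n))‖ ≠ 0 := norm_ne_zero_iff.2 y.2
    simp [polarMap, smul_smul, mul_inv_cancel₀ h0]
  have hm : Measurable fun p : Sph n × Set.Ioi (0 : ℝ) => f (polarMap (p.2, p.1)) :=
    hf.comp (continuous_polarMap.measurable.comp (by fun_prop))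
  rw [h1, lintegral_congr h2, hmp.lintegral_comp hm, lintegral_prod_symm _ hm.aemeasurable, hfr,
    Measure.volumeIoiPow, lintegral_withDensity_eq_lintegral_mul _ (by fun_prop)
      (Measurable.lintegral_prod_left' hm)]
  have hm2 : Measurable fun r : ℝ => ∫⁻ σ,
      ENNReal.ofReal (r ^ (n - 1)) * f (polarMap (r, σ)) ∂(surfaceMeasure n) := by
    refine Measurable.lintegral_prod_right' (f := fun p : ℝ × Sph n =>
      ENNReal.ofReal (p.1 ^ (n - 1)) * f (polarMap (p.1, p.2))) ?_
    exact (by fun_prop : Measurable fun p : ℝ × Sph n => ENNReal.ofReal (p.1 ^ (n - 1))).mul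
      (hf.comp continuous_polarMap.measurable)
  rw [← lintegral_subtype_comap measurableSet_Ioi]
  refine lintegral_congr fun r => ?_
  rw [Pi.mul_apply, ← lintegral_const_mul]
  · rfl
  · exact hf.comp (continuous_polarMap.measurable.comp (by fun_prop))

/-- A weight that is homogeneous of degree `a` gives a measure that is a product in polar
coordinates. -/
lemma withDensity_eq_polarMeasure {n : ℕ} [NeZero n] {a ε : ℝ} (hε : 0 ≤ ε)
    {w : EuclideanSpace ℝ (Fin n) → ℝ} (hw : Measurable w) {b : Sph n → ℝ} (hb : Measurable b)
    (hhom : ∀ r : ℝ, 0 < r → ∀ σ : Sph n, w (polarMap (r, σ)) = r ^ a * b σ) :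
    (volume.restrict {y : EuclideanSpace ℝ (Fin n) | ε < ‖y‖}).withDensity
        (fun y => ENNReal.ofReal (w y))
      = polarMeasure (n + a - 1) ε ((surfaceMeasure n).withDensity fun σ => ENNReal.ofReal (b σ)) := by
  have hΩ : MeasurableSet {y : EuclideanSpace ℝ (Fin n) | ε < ‖y‖} :=
    measurableSet_lt measurable_const measurable_norm
  refine Measure.ext_of_lintegral _ fun f hf => ?_
  have hfp : Measurable fun p : ℝ × Sph n => f (polarMap p) :=
    hf.comp continuous_polarMap.measurable
  have hwr : Measurable fun y => ENNReal.ofReal (w y) := hw.ennreal_ofReal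
  have hbr : Measurable fun σ => ENNReal.ofReal (b σ) := hb.ennreal_ofReal
  rw [lintegral_withDensity_eq_lintegral_mul _ hwr hf, ← lintegral_indicator hΩ,
    lintegral_eq_lintegral_polarMap ((hwr.mul hf).indicator hΩ), polarMeasure,
    lintegral_map hf continuous_polarMap.measurable, lintegral_prod _ hfp.aemeasurable, radialMeasure,
    lintegral_withDensity_eq_lintegral_mul _ (by fun_prop) (Measurable.lintegral_prod_right' hfp)]
  have hs : Set.Ioi ε ∩ Set.Ioi (0 : ℝ) = Set.Ioi ε := by
    rw [Set.Ioi_inter_Ioi, max_eq_left hε]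
  rw [← hs, ← setLIntegral_indicator measurableSet_Ioi]
  refine setLIntegral_congr_fun measurableSet_Ioi fun r hr => ?_
  have hr0 : (0 : ℝ) < r := hr
  by_cases h : ε < r
  · have hfσ : Measurable fun σ : Sph n => f (polarMap (r, σ)) :=
      hfp.comp (measurable_const.prodMk measurable_id)
    rw [Set.indicator_of_mem (by exact h), Pi.mul_apply,
      lintegral_withDensity_eq_lintegral_mul _ hbr hfσ, ← lintegral_const_mul]
    · refine lintegral_congr fun σ => ?_
      rw [Set.indicator_of_mem (by
        rw [Set.mem_ofPred_eq, norm_polarMap hr0.le]; exact h), Pi.mul_apply, Pi.mul_apply,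
        hhom r hr0, ← mul_assoc, ← mul_assoc, ENNReal.ofReal_mul (by positivity), ← mul_assoc,
        ← ENNReal.ofReal_mul (by positivity)]
      congr 3
      have e : (n : ℝ) + a - 1 = ((n - 1 : ℕ) : ℝ) + a := by
        rw [Nat.cast_sub (NeZero.one_le)]; push_cast; ring
      rw [e, Real.rpow_add hr0, Real.rpow_natCast]
    · exact hbr.mul hfσ
  · rw [Set.indicator_of_notMem (by exact h)]
    refine (lintegral_congr fun σ => ?_).trans lintegral_zero
    rw [Set.indicator_of_notMem (by
      rw [Set.mem_ofPred_eq, norm_polarMap hr0.le]; exact h), mul_zero]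

/-! ### Linear coordinates in which the hole is a cylinder -/

section Coordinates

variable {m n : ℕ} {lam Lam a ε : ℝ} {A : Matrix (Fin m ⊕ Fin n) (Fin m ⊕ Fin n) ℝ}

/-- The continuous linear map of a matrix. -/
noncomputable abbrev matCLM {ι : Type*} [Fintype ι] [DecidableEq ι] (A : Matrix ι ι ℝ) :
    EuclideanSpace ℝ ι →L[ℝ] EuclideanSpace ℝ ι :=
  toEuclideanCLM (𝕜 := ℝ) A

lemma inner_matCLM {ι : Type*} [Fintype ι] [DecidableEq ι] (A : Matrix ι ι ℝ)
    (ξ η : EuclideanSpace ℝ ι) : inner ℝ (matCLM A ξ) η = (A *ᵥ ξ.ofLp) ⬝ᵥ η.ofLp := by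
  rw [EuclideanSpace.inner_eq_star_dotProduct, ofLp_toEuclideanCLM, dotProduct_comm]
  simp

lemma inner_matCLM_comm {ι : Type*} [Fintype ι] [DecidableEq ι] {A : Matrix ι ι ℝ} (hA : A.IsSymm)
    (ξ η : EuclideanSpace ℝ ι) : inner ℝ (matCLM A ξ) η = inner ℝ ξ (matCLM A η) := by
  rw [inner_matCLM, real_inner_comm, inner_matCLM, dotProduct_comm, dotProduct_mulVec,
    ← mulVec_transpose, hA.eq]

lemma le_inner_matCLM (hA : IsElliptic lam Lam A) (ξ : Space m n) :
    lam * ‖ξ‖ ^ 2 ≤ inner ℝ (matCLM A ξ) ξ := by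
  rw [inner_matCLM]; exact (hA.2.2.2 ξ).1

lemma mulVec_inr_eq (A : Matrix (Fin m ⊕ Fin n) (Fin m ⊕ Fin n) ℝ) (x : Fin m → ℝ) (y : Fin n → ℝ)
    (i : Fin n) : (A *ᵥ Sum.elim x y) (Sum.inr i)
      = (A.toBlocks₂₁ *ᵥ x) i + (blockThree A *ᵥ y) i := by
  simp [mulVec, dotProduct, toBlocks₂₁, toBlocks₂₂, blockThree]

lemma posDef_blockThree (hA : IsElliptic lam Lam A) : (blockThree A).PosDef := by
  have hs : (blockThree A).IsHermitian := by
    ext i j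
    simpa [blockThree, toBlocks₂₂] using hA.2.2.1.apply (Sum.inr j) (Sum.inr i) |>.symm
  refine PosDef.of_dotProduct_mulVec_pos hs fun y hy => ?_
  have h1 := (hA.2.2.2 (WithLp.toLp 2 (Sum.elim 0 y))).1
  have h2 : 0 < ‖(WithLp.toLp 2 (Sum.elim 0 y) : Space m n)‖ := by
    rw [norm_pos_iff]
    intro h0
    refine hy (funext fun i => ?_)
    simpa using congrFun (congrArg WithLp.ofLp h0) (Sum.inr i)
  have h3 : (A *ᵥ Sum.elim 0 y) ⬝ᵥ Sum.elim (0 : Fin m → ℝ) y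
      = star y ⬝ᵥ blockThree A *ᵥ y := by
    rw [dotProduct_comm]
    simp only [dotProduct, Fintype.sum_sum_type, mulVec_inr_eq]
    simp
  rw [← h3]
  have := hA.1
  exact lt_of_lt_of_le (by positivity) h1

open scoped MatrixOrder in
/-- The symmetric square root of `A₃`. -/
lemma exists_sqrt_blockThree (hA : IsElliptic lam Lam A) :
    ∃ S : EuclideanSpace ℝ (Fin n) ≃L[ℝ] EuclideanSpace ℝ (Fin n),
      (∀ x y, inner ℝ (S x) y = inner ℝ x (S y)) ∧ ∀ y, S (S y) = matCLM (blockThree A) y := by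
  have hB := posDef_blockThree hA
  set T := CFC.sqrt (blockThree A) with hT
  have hTT : T * T = blockThree A :=
    CFC.sqrt_mul_sqrt_self _ (nonneg_iff_posSemidef.2 hB.posSemidef)
  have hTs : T.IsSymm := (nonneg_iff_posSemidef.1 (CFC.sqrt_nonneg (blockThree A))).1
  have hdet : IsUnit T.det := by
    have := (isUnit_iff_isUnit_det _).1 hB.isUnit
    rw [← hTT, det_mul] at this
    exact isUnit_of_mul_isUnit_left this
  refine ⟨ContinuousLinearEquiv.equivOfInverse (matCLM T) (matCLM T⁻¹) (fun x => ?_) fun x => ?_,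
    fun x y => ?_, fun y => ?_⟩
  · change (matCLM T⁻¹ * matCLM T) x = x
    rw [← map_mul, nonsing_inv_mul _ hdet, map_one]; rfl
  · change (matCLM T * matCLM T⁻¹) x = x
    rw [← map_mul, mul_nonsing_inv _ hdet, map_one]; rfl
  · exact inner_matCLM_comm hTs x y
  · change (matCLM T * matCLM T) y = _
    rw [← map_mul, hTT]

variable {S : EuclideanSpace ℝ (Fin n) ≃L[ℝ] EuclideanSpace ℝ (Fin n)}

/-- The coordinates `(x, y') ↦ (x, S y')`. -/
noncomputable def coordEquiv (m : ℕ) (S : EuclideanSpace ℝ (Fin n) ≃L[ℝ] EuclideanSpace ℝ (Fin n)) :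
    (EuclideanSpace ℝ (Fin m) × EuclideanSpace ℝ (Fin n)) ≃L[ℝ] Space m n :=
  ((ContinuousLinearEquiv.refl ℝ _).prodCongr S).trans EuclideanSpace.sumEquivProd.symm

lemma ofLp_coordEquiv (x : EuclideanSpace ℝ (Fin m)) (y : EuclideanSpace ℝ (Fin n)) :
    (coordEquiv m S (x, y)).ofLp = Sum.elim x.ofLp (S y).ofLp := by
  ext i
  cases i <;> rfl

lemma yPart_coordEquiv (x : EuclideanSpace ℝ (Fin m)) (y : EuclideanSpace ℝ (Fin n)) :
    yPart (coordEquiv m S (x, y)) = S y := by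
  ext i
  simp [yPart, ofLp_coordEquiv]

lemma sndCLM_coordEquiv (z : Space m n) : sndCLM (coordEquiv m S) z = S.symm (yPart z) := rfl

lemma continuous_yPart : Continuous (yPart : Space m n → EuclideanSpace ℝ (Fin n)) := by
  unfold yPart
  fun_prop

/-- In the new coordinates the hole is the straight cylinder `‖y‖ ≤ ε`. -/
lemma mem_hole_iff (hA : IsElliptic lam Lam A) (hε : 0 ≤ ε)
    (hS : ∀ x y, inner ℝ (S x) y = inner ℝ x (S y)) (hSS : ∀ y, S (S y) = matCLM (blockThree A) y)
    {z : Space m n} : z ∈ hole A ε ↔ ‖S.symm (yPart z)‖ ≤ ε := by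
  have hdet : IsUnit (blockThree A).det := (isUnit_iff_isUnit_det _).1 (posDef_blockThree hA).isUnit
  set y := yPart z with hy
  have h1 : (blockThree A)⁻¹ *ᵥ y.ofLp = (S.symm (S.symm y)).ofLp := by
    have : y = matCLM (blockThree A) (S.symm (S.symm y)) := by rw [← hSS]; simp
    conv_lhs => rw [this]
    rw [ofLp_toEuclideanCLM, mulVec_mulVec, nonsing_inv_mul _ hdet, one_mulVec]
  have h2 : ((blockThree A)⁻¹ *ᵥ y.ofLp) ⬝ᵥ y.ofLp = ‖S.symm y‖ ^ 2 := by
    have h3 : inner ℝ (S.symm (S.symm y)) y = (S.symm (S.symm y)).ofLp ⬝ᵥ y.ofLp := by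
      rw [EuclideanSpace.inner_eq_star_dotProduct, dotProduct_comm]; simp
    rw [h1, ← h3, ← real_inner_self_eq_norm_sq]
    conv_lhs => rw [← S.apply_symm_apply y, ← hS]
    simp
  change ((blockThree A)⁻¹ *ᵥ y.ofLp) ⬝ᵥ y.ofLp ≤ ε ^ 2 ↔ _
  rw [h2, sq_le_sq₀ (norm_nonneg _) hε]

lemma isClosed_hole (hA : IsElliptic lam Lam A) (hε : 0 ≤ ε) : IsClosed (hole A ε) := by
  obtain ⟨S, hS, hSS⟩ := exists_sqrt_blockThree hA
  have : hole A ε = {z | ‖S.symm (yPart z)‖ ≤ ε} := Set.ext fun z => mem_hole_iff hA hε hS hSS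
  rw [this]
  exact isClosed_le (S.symm.continuous.comp continuous_yPart).norm continuous_const

lemma norm_yPart_pos (hA : IsElliptic lam Lam A) (hε : 0 ≤ ε) {z : Space m n} (hz : z ∉ hole A ε) :
    0 < ‖yPart z‖ := by
  obtain ⟨S, hS, hSS⟩ := exists_sqrt_blockThree hA
  rw [norm_pos_iff]
  rintro h0
  refine hz ((mem_hole_iff hA hε hS hSS).2 ?_)
  rw [h0, map_zero, norm_zero]
  exact hε

/-- In the coordinates given by `S`, the `(y, y)` block of `A` becomes the identity. -/
lemma inner_matCLM_adjoint_sndCLM (hS : ∀ x y, inner ℝ (S x) y = inner ℝ x (S y))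
    (hSS : ∀ y, S (S y) = matCLM (blockThree A) y) (g g' : EuclideanSpace ℝ (Fin n)) :
    inner ℝ (matCLM A ((sndCLM (coordEquiv m S)).adjoint g))
      ((sndCLM (coordEquiv m S)).adjoint g') = inner ℝ g g' := by
  have hS' : ∀ x y, inner ℝ (S.symm x) y = inner ℝ x (S.symm y) := fun x y => by
    conv_lhs => rw [← S.apply_symm_apply y]
    rw [← hS, S.apply_symm_apply]
  have hadj : ∀ g, (sndCLM (coordEquiv m S)).adjoint g
      = WithLp.toLp 2 (Sum.elim (0 : Fin m → ℝ) (S.symm g).ofLp) := by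
    intro g
    refine ext_inner_right ℝ fun z => ?_
    rw [ContinuousLinearMap.adjoint_inner_left, sndCLM_coordEquiv, ← hS',
      EuclideanSpace.inner_eq_star_dotProduct, EuclideanSpace.inner_eq_star_dotProduct]
    simp [dotProduct, yPart]
  have h1 : yPart (matCLM A ((sndCLM (coordEquiv m S)).adjoint g)) = S g := by
    have e : S g = matCLM (blockThree A) (S.symm g) := by rw [← hSS]; simp
    rw [hadj, e]
    ext i
    change (A *ᵥ Sum.elim (0 : Fin m → ℝ) (S.symm g).ofLp) (Sum.inr i) = (blockThree A *ᵥ (S.symm g).ofLp) i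
    rw [mulVec_inr_eq]
    simp
  rw [ContinuousLinearMap.adjoint_inner_right, sndCLM_coordEquiv, h1]
  simp

/-! ### The weighted measure -/

/-- The weight `|S y'|^a` on the complement of a ball of `ℝⁿ`. -/
noncomputable def sliceMeasure {n : ℕ} (a ε : ℝ)
    (S : EuclideanSpace ℝ (Fin n) ≃L[ℝ] EuclideanSpace ℝ (Fin n)) :
    Measure (EuclideanSpace ℝ (Fin n)) :=
  (volume.restrict {y : EuclideanSpace ℝ (Fin n) | ε < ‖y‖}).withDensity
    fun y => ENNReal.ofReal (‖S y‖ ^ a)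

instance {n : ℕ} (a ε : ℝ) (S : EuclideanSpace ℝ (Fin n) ≃L[ℝ] EuclideanSpace ℝ (Fin n)) :
    SFinite (sliceMeasure a ε S) := by unfold sliceMeasure; infer_instance

lemma measurable_norm_rpow {X F : Type*} [MeasurableSpace X] [NormedAddCommGroup F]
    [MeasurableSpace F] [BorelSpace F] {f : X → F} (hf : Measurable f) (a : ℝ) :
    Measurable fun y => ENNReal.ofReal (‖f y‖ ^ a) :=
  (hf.norm.pow_const a).ennreal_ofReal

lemma map_withDensity_comp {X Y : Type*} [MeasurableSpace X] [MeasurableSpace Y] {κ : Measure X}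
    {f : X → Y} (hf : Measurable f) {w : Y → ENNReal} (hw : Measurable w) {H : Set Y}
    (hH : MeasurableSet H) :
    ((κ.restrict (f ⁻¹' H)).withDensity fun x => w (f x)).map f
      = ((κ.map f).restrict H).withDensity w := by
  ext s hs
  rw [Measure.map_apply hf hs, withDensity_apply _ (hf hs), withDensity_apply _ hs,
    Measure.restrict_restrict (hf hs), Measure.restrict_restrict hs, ← Set.preimage_inter,
    setLIntegral_map (hs.inter hH) hw hf]

/-- In the coordinates `(x, y) ↦ (x, S y)` the weighted measure is, up to a Jacobian factor, the
product of Lebesgue measure in `x` and `sliceMeasure`. -/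
lemma exists_map_prod_sliceMeasure (hA : IsElliptic lam Lam A) (hε : 0 ≤ ε) (a : ℝ)
    (hS : ∀ x y, inner ℝ (S x) y = inner ℝ x (S y)) (hSS : ∀ y, S (S y) = matCLM (blockThree A) y) :
    ∃ c : ENNReal, c ≠ 0 ∧ c ≠ ⊤ ∧
      ((volume : Measure (EuclideanSpace ℝ (Fin m))).prod (sliceMeasure a ε S)).map
        (coordEquiv m S) = c • weightedMeasure a (hole A ε)ᶜ := by
  have hJm : Measurable (coordEquiv m S) := (coordEquiv m S).continuous.measurable
  have hyM : Measurable (yPart : Space m n → _) := continuous_yPart.measurable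
  set κ := (volume : Measure (EuclideanSpace ℝ (Fin m))).prod
    (volume : Measure (EuclideanSpace ℝ (Fin n))) with hκ
  have hκH : κ.IsAddHaarMeasure := by rw [hκ]; infer_instance
  have hκJ : (κ.map (coordEquiv m S)).IsAddHaarMeasure := (coordEquiv m S).isAddHaarMeasure_map κ
  set k := Measure.addHaarScalarFactor (κ.map (coordEquiv m S)) (volume : Measure (Space m n))
    with hk
  have hk0 : 0 < k := Measure.addHaarScalarFactor_pos_of_isAddHaarMeasure _ _
  have hkm : κ.map (coordEquiv m S) = (k : ENNReal) • volume :=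
    Measure.isAddLeftInvariant_eq_smul (κ.map (coordEquiv m S)) volume
  refine ⟨k, by exact_mod_cast hk0.ne', ENNReal.coe_ne_top, ?_⟩
  have hΩ : MeasurableSet {y : EuclideanSpace ℝ (Fin n) | ε < ‖y‖} :=
    measurableSet_lt measurable_const measurable_norm
  have hw := measurable_norm_rpow (X := EuclideanSpace ℝ (Fin n)) S.continuous.measurable a
  have hw2 := measurable_norm_rpow hyM a
  have e1 : (volume : Measure (EuclideanSpace ℝ (Fin m))).prod (sliceMeasure a ε S)
      = (κ.restrict (coordEquiv m S ⁻¹' (hole A ε)ᶜ)).withDensity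
        fun p => ENNReal.ofReal (‖yPart (coordEquiv m S p)‖ ^ a) := by
    rw [sliceMeasure, prod_withDensity_right hw, ← Measure.restrict_univ
      (μ := (volume : Measure (EuclideanSpace ℝ (Fin m)))), Measure.prod_restrict]
    congr 2
    ext p
    rw [Set.mem_preimage, Set.mem_compl_iff, mem_hole_iff hA hε hS hSS, ← Prod.mk.eta (p := p),
      yPart_coordEquiv]
    simp
  rw [e1, map_withDensity_comp hJm hw2 (isClosed_hole hA hε).isOpen_compl.measurableSet, hkm,
    Measure.restrict_smul, withDensity_smul_measure]
  rfl

/-- The weight on the sphere in the definition of `muOne`, as a measure. -/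
noncomputable def sphereMeasure {n : ℕ} (a : ℝ) (B : Matrix (Fin n) (Fin n) ℝ) : Measure (Sph n) :=
  (surfaceMeasure n).withDensity fun σ => ENNReal.ofReal (sphereWeight a B σ)

lemma sphereWeight_eq (hS : ∀ x y, inner ℝ (S x) y = inner ℝ x (S y))
    {B : Matrix (Fin n) (Fin n) ℝ} (hSS : ∀ y, S (S y) = matCLM B y) (σ : Sph n) :
    sphereWeight a B σ = ‖S σ‖ ^ a := by
  unfold sphereWeight
  rw [← inner_matCLM, ← hSS, hS, real_inner_self_eq_norm_sq, Real.sqrt_sq (norm_nonneg _)]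

lemma continuous_norm_rpow_sphere : Continuous fun σ : Sph n => ‖S σ‖ ^ a := by
  refine (S.continuous.comp continuous_subtype_val).norm.rpow_const fun σ => Or.inl ?_
  rw [norm_ne_zero_iff]
  intro h
  have h0 : (σ : EuclideanSpace ℝ (Fin n)) = 0 := S.map_eq_zero_iff.1 h
  have h1 : ‖(σ : EuclideanSpace ℝ (Fin n))‖ = 1 := by simp
  rw [h0, norm_zero] at h1
  exact zero_ne_one h1

lemma exists_bounds_norm_rpow_sphere (a : ℝ)
    (S : EuclideanSpace ℝ (Fin n) ≃L[ℝ] EuclideanSpace ℝ (Fin n)) :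
    ∃ b₀ b₁ : ℝ, 0 < b₀ ∧ 0 < b₁ ∧ ∀ σ : Sph n, b₀ ≤ ‖S σ‖ ^ a ∧ ‖S σ‖ ^ a ≤ b₁ := by
  have hc := continuous_norm_rpow_sphere (S := S) (a := a)
  have hpos : ∀ σ : Sph n, 0 < ‖S σ‖ ^ a := fun σ => by
    refine Real.rpow_pos_of_pos (norm_pos_iff.2 fun h => ?_) a
    have h0 : (σ : EuclideanSpace ℝ (Fin n)) = 0 := S.map_eq_zero_iff.1 h
    have h1 : ‖(σ : EuclideanSpace ℝ (Fin n))‖ = 1 := by simp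
    rw [h0, norm_zero] at h1
    exact zero_ne_one h1
  rcases isEmpty_or_nonempty (Sph n) with h | h
  · exact ⟨1, 1, one_pos, one_pos, fun σ => (IsEmpty.false σ).elim⟩
  obtain ⟨σ₀, -, h0⟩ := isCompact_univ.exists_isMinOn Set.univ_nonempty hc.continuousOn
  obtain ⟨σ₁, -, h1⟩ := isCompact_univ.exists_isMaxOn Set.univ_nonempty hc.continuousOn
  exact ⟨_, _, hpos σ₀, hpos σ₁, fun σ => ⟨h0 (Set.mem_univ σ), h1 (Set.mem_univ σ)⟩⟩

/-- The weight `‖S y‖ ^ a` is homogeneous of degree `a`, so `sliceMeasure` splits in polar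
coordinates with the radial exponent `n + a - 1`. -/
lemma sliceMeasure_eq_polarMeasure [NeZero n] (hε : 0 ≤ ε) (a : ℝ)
    (hS : ∀ x y, inner ℝ (S x) y = inner ℝ x (S y))
    {B : Matrix (Fin n) (Fin n) ℝ} (hSS : ∀ y, S (S y) = matCLM B y) :
    sliceMeasure a ε S = polarMeasure (n + a - 1) ε (sphereMeasure a B) := by
  refine withDensity_eq_polarMeasure hε (S.continuous.measurable.norm.pow_const a) ?_ ?_
  · rw [show sphereWeight a B = fun σ : Sph n => ‖S (σ : EuclideanSpace ℝ (Fin n))‖ ^ a from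
      funext (sphereWeight_eq hS hSS)]
    exact continuous_norm_rpow_sphere.measurable
  · intro r hr σ
    rw [sphereWeight_eq hS hSS, polarMap, map_smul, norm_smul, Real.norm_eq_abs, abs_of_pos hr,
      Real.mul_rpow hr.le (norm_nonneg _)]

lemma isFiniteMeasure_sphereMeasure (a : ℝ) (hS : ∀ x y, inner ℝ (S x) y = inner ℝ x (S y))
    {B : Matrix (Fin n) (Fin n) ℝ} (hSS : ∀ y, S (S y) = matCLM B y) :
    IsFiniteMeasure (sphereMeasure a B) := by
  obtain ⟨b₀, b₁, -, -, hb⟩ := exists_bounds_norm_rpow_sphere a S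
  refine isFiniteMeasure_withDensity (ne_of_lt ?_)
  calc ∫⁻ σ, ENNReal.ofReal (sphereWeight a B σ) ∂(surfaceMeasure n)
      ≤ ∫⁻ _, ENNReal.ofReal b₁ ∂(surfaceMeasure n) := by
        gcongr with σ
        rw [sphereWeight_eq hS hSS]
        exact (hb σ).2
    _ < ⊤ := by
        rw [lintegral_const]
        exact ENNReal.mul_lt_top ENNReal.ofReal_lt_top (measure_lt_top _ _)

lemma exists_restrict_le_smul_withDensity {E : Type*} [TopologicalSpace E] [MeasurableSpace E]
    [BorelSpace E] [T2Space E] {μ : Measure E} {K Ω : Set E} (hK : IsCompact K) (hKΩ : K ⊆ Ω)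
    {w : E → ℝ} (hw : ContinuousOn w K) (hpos : ∀ x ∈ K, 0 < w x) :
    ∃ c : ENNReal, c ≠ ⊤ ∧
      μ.restrict K ≤ c • (μ.restrict Ω).withDensity fun x => ENNReal.ofReal (w x) := by
  obtain ⟨b, hb, hle⟩ := hK.exists_forall_le' hw hpos
  have hb' : ENNReal.ofReal b ≠ 0 := by simpa using hb
  exact ⟨(ENNReal.ofReal b)⁻¹, ENNReal.inv_ne_top.2 hb', restrict_le_smul_withDensity
    hK.measurableSet hKΩ hb' ENNReal.ofReal_ne_top fun x hx => ENNReal.ofReal_le_ofReal (hle x hx)⟩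

lemma exists_restrict_le_smul_weightedMeasure (hA : IsElliptic lam Lam A) (hε : 0 ≤ ε) (a : ℝ)
    {K : Set (Space m n)} (hK : IsCompact K) (hKΩ : K ⊆ (hole A ε)ᶜ) :
    ∃ c : ENNReal, c ≠ ⊤ ∧ volume.restrict K ≤ c • weightedMeasure a (hole A ε)ᶜ := by
  have h0 : ∀ z ∈ K, 0 < ‖yPart z‖ := fun z hz => norm_yPart_pos hA hε (hKΩ hz)
  exact exists_restrict_le_smul_withDensity hK hKΩ
    (continuous_yPart.norm.continuousOn.rpow_const fun z hz => Or.inl (h0 z hz).ne')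
    fun z hz => Real.rpow_pos_of_pos (h0 z hz) a

lemma exists_restrict_le_smul_sliceMeasure (hε : 0 ≤ ε) (a : ℝ)
    {K : Set (EuclideanSpace ℝ (Fin n))} (hK : IsCompact K)
    (hKΩ : K ⊆ {y : EuclideanSpace ℝ (Fin n) | ε < ‖y‖}) :
    ∃ c : ENNReal, c ≠ ⊤ ∧ volume.restrict K ≤ c • sliceMeasure a ε S := by
  have h0 : ∀ y ∈ K, 0 < ‖S y‖ := fun y hy => by
    refine norm_pos_iff.2 fun h => ?_
    have h1 := hKΩ hy
    rw [S.map_eq_zero_iff.1 h, Set.mem_ofPred_eq, norm_zero] at h1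
    exact absurd h1 (not_lt.2 hε)
  exact exists_restrict_le_smul_withDensity hK hKΩ
    (S.continuous.norm.continuousOn.rpow_const fun y hy => Or.inl (h0 y hy).ne')
    fun y hy => Real.rpow_pos_of_pos (h0 y hy) a

lemma ae_weightedMeasure_iff (hA : IsElliptic lam Lam A) (hε : 0 ≤ ε) (a : ℝ)
    {p : Space m n → Prop} :
    (∀ᵐ z ∂(weightedMeasure a (hole A ε)ᶜ), p z) ↔ ∀ᵐ z, z ∉ hole A ε → p z := by
  unfold weightedMeasure
  rw [ae_withDensity_iff (measurable_norm_rpow continuous_yPart.measurable a),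
    ae_restrict_iff' (isClosed_hole hA hε).isOpen_compl.measurableSet]
  refine eventually_congr (Eventually.of_forall fun z => imp_congr_right fun hz => ?_)
  have : ENNReal.ofReal (‖yPart z‖ ^ a) ≠ 0 := by
    simpa using Real.rpow_pos_of_pos (norm_yPart_pos hA hε hz) a
  simp [this]

lemma ae_sliceMeasure_iff (hε : 0 ≤ ε) (a : ℝ) {p : EuclideanSpace ℝ (Fin n) → Prop} :
    (∀ᵐ y ∂(sliceMeasure a ε S), p y) ↔ ∀ᵐ y, ε < ‖y‖ → p y := by
  unfold sliceMeasure
  rw [ae_withDensity_iff (measurable_norm_rpow S.continuous.measurable a),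
    ae_restrict_iff' (measurableSet_lt measurable_const measurable_norm)]
  refine eventually_congr (Eventually.of_forall fun y => imp_congr_right fun hy => ?_)
  have h0 : S y ≠ 0 := fun h => by
    rw [S.map_eq_zero_iff.1 h, Set.mem_ofPred_eq, norm_zero] at hy
    exact absurd hy (not_lt.2 hε)
  have : ENNReal.ofReal (‖S y‖ ^ a) ≠ 0 := by
    simpa using Real.rpow_pos_of_pos (norm_pos_iff.2 h0) a
  simp [this]

end Coordinates

/-! ### A global gradient for entire solutions -/

section Gluing

variable {m n : ℕ} {lam Lam a ε : ℝ} {A : Matrix (Fin m ⊕ Fin n) (Fin m ⊕ Fin n) ℝ}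
  {u : Space m n → ℝ} {G G' : Space m n → Space m n}

lemma weightedMeasure_restrict_ball (a : ℝ) (A : Matrix (Fin m ⊕ Fin n) (Fin m ⊕ Fin n) ℝ)
    (ε R : ℝ) : (weightedMeasure a (hole A ε)ᶜ).restrict (Metric.ball 0 R)
      = weightedMeasure a (Metric.ball 0 R \ hole A ε) := by
  unfold weightedMeasure
  rw [restrict_withDensity Metric.isOpen_ball.measurableSet,
    Measure.restrict_restrict Metric.isOpen_ball.measurableSet, Set.sdiff_eq]

lemma ae_gradient_eq_of_ball (hA : IsElliptic lam Lam A) (hε : 0 ≤ ε) {R : ℝ}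
    (h : H1Lim ((weightedMeasure a (hole A ε)ᶜ).restrict (Metric.ball 0 R)) u G)
    (h' : H1Lim ((weightedMeasure a (hole A ε)ᶜ).restrict (Metric.ball 0 R)) u G') :
    ∀ᵐ z ∂(weightedMeasure a (hole A ε)ᶜ), z ∈ Metric.ball 0 R → G z = G' z := by
  rw [ae_weightedMeasure_iff hA hε]
  have hU : IsOpen ((hole A ε)ᶜ ∩ Metric.ball (0 : Space m n) R) :=
    (isClosed_hole hA hε).isOpen_compl.inter Metric.isOpen_ball
  have h1 := h.gradient_unique h' hU fun K hK hKc => by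
    obtain ⟨c, hc, hcK⟩ := exists_restrict_le_smul_weightedMeasure hA hε a hKc
      (hK.trans Set.inter_subset_left)
    exact ⟨c, hc, restrict_le_smul_restrict hKc.measurableSet (hK.trans Set.inter_subset_right) hcK⟩
  filter_upwards [h1] with z hz h2 h3 using hz ⟨h2, h3⟩

/-- The weak gradient is determined by the function: off the hole the weight is locally bounded
below, so it is the distributional gradient. -/
lemma ae_gradient_eq (hA : IsElliptic lam Lam A) (hε : 0 ≤ ε)
    (h : ∀ R : ℝ, H1Lim ((weightedMeasure a (hole A ε)ᶜ).restrict (Metric.ball 0 R)) u G)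
    (h' : ∀ R : ℝ, H1Lim ((weightedMeasure a (hole A ε)ᶜ).restrict (Metric.ball 0 R)) u G') :
    G' =ᵐ[weightedMeasure a (hole A ε)ᶜ] G := by
  refine ae_of_forall_ae_restrict_ball fun R _ => ?_
  rw [ae_restrict_iff' Metric.isOpen_ball.measurableSet]
  exact ae_gradient_eq_of_ball hA hε (h' R) (h R)

lemma integral_weightedMeasure (a : ℝ) {Ω : Set (Space m n)} (f : Space m n → ℝ) :
    ∫ z, f z ∂(weightedMeasure a Ω) = ∫ z in Ω, ‖yPart z‖ ^ a * f z := by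
  unfold weightedMeasure
  rw [integral_withDensity_eq_integral_toReal_smul
    (measurable_norm_rpow continuous_yPart.measurable a)
    (Eventually.of_forall fun _ => ENNReal.ofReal_lt_top)]
  refine integral_congr_ae (Eventually.of_forall fun z => ?_)
  simp only [smul_eq_mul]
  rw [ENNReal.toReal_ofReal (Real.rpow_nonneg (norm_nonneg _) _)]

/-- The gradients of an entire solution in balls fit together to a global one. -/
lemma exists_isSol (hA : IsElliptic lam Lam A) (hε : 0 ≤ ε) (hu : IsEntireSolution a A ε u) :
    ∃ G, IsSol (weightedMeasure a (hole A ε)ᶜ) (matCLM A) u G := by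
  choose! K hK hKt using hu
  set ν := weightedMeasure a (hole A ε)ᶜ with hν
  have hH : ∀ R : ℝ, 0 < R → H1Lim (ν.restrict (Metric.ball 0 R)) u (K R) := by
    intro R hR
    rw [hν, weightedMeasure_restrict_ball]
    exact hK R hR
  have hcomp : ∀ᵐ z ∂ν, ∀ N M : ℕ, N ≤ M → z ∈ Metric.ball 0 ((N : ℝ) + 1) →
      K (N + 1) z = K (M + 1) z := by
    refine ae_all_iff.2 fun N => ae_all_iff.2 fun M => ?_
    by_cases hNM : N ≤ M
    · have h1 : (N : ℝ) + 1 ≤ M + 1 := by exact_mod_cast Nat.succ_le_succ hNM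
      filter_upwards [ae_gradient_eq_of_ball hA hε (hH (N + 1) (by positivity))
        ((hH (M + 1) (by positivity)).mono_measure
          (Measure.restrict_mono_set _ (Metric.ball_subset_ball h1)))] with z hz _ hzN
      exact hz hzN
    · exact Eventually.of_forall fun z h => absurd h hNM
  set G : Space m n → Space m n := fun z => K ((⌊‖z‖⌋₊ : ℝ) + 1) z with hG
  have hGM : ∀ M : ℕ, ∀ᵐ z ∂ν, z ∈ Metric.ball 0 ((M : ℝ) + 1) → K (M + 1) z = G z := by
    intro M
    filter_upwards [hcomp] with z hz hzM
    rw [Metric.mem_ball, dist_zero_right] at hzM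
    refine (hz ⌊‖z‖⌋₊ M ?_ ?_).symm
    · have : ⌊‖z‖⌋₊ < M + 1 := (Nat.floor_lt (norm_nonneg _)).2 (by exact_mod_cast hzM)
      omega
    · rw [Metric.mem_ball, dist_zero_right]
      exact Nat.lt_floor_add_one _
  have hGM' : ∀ M : ℕ, K (M + 1) =ᵐ[ν.restrict (Metric.ball 0 ((M : ℝ) + 1))] G := fun M =>
    (ae_restrict_iff' Metric.isOpen_ball.measurableSet).2 (hGM M)
  refine ⟨G, fun R => ?_, fun φ hφ hφc => ?_⟩
  · obtain ⟨M, hM⟩ := exists_nat_ge R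
    exact ((hH (M + 1) (by positivity)).congr (EventuallyEq.refl _ _) (hGM' M)).mono_measure
      (Measure.restrict_mono_set _ (Metric.ball_subset_ball (by linarith)))
  · obtain ⟨R, hR⟩ := exists_tsupport_subset_ball hφc
    obtain ⟨M, hM⟩ := exists_nat_ge R
    have hsub : tsupport φ ⊆ Metric.ball 0 ((M : ℝ) + 1) :=
      hR.trans (Metric.ball_subset_ball (by linarith))
    have h1 := hKt (M + 1) (by positivity) φ hφ hφc hsub
    rw [← integral_weightedMeasure, ← weightedMeasure_restrict_ball, ← hν] at h1
    simp_rw [← inner_matCLM] at h1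
    have h2 : ∫ z in Metric.ball 0 ((M : ℝ) + 1), inner ℝ (matCLM A (G z)) (gradient φ z) ∂ν = 0 := by
      rw [← h1]
      refine integral_congr_ae ?_
      filter_upwards [hGM' M] with z hz
      rw [hz]
    rw [← h2]
    refine (setIntegral_eq_integral_of_forall_compl_eq_zero fun z hz => ?_).symm
    have : fderiv ℝ φ z = 0 := image_eq_zero_of_notMem_tsupport
        (fun h => hz (hsub (tsupport_fderiv_subset ℝ h)))
    simp [gradient, this]

end Gluing

/-! ### Liouville theorem for solutions that depend only on `y` -/

lemma IsSol.aestronglyMeasurable {E : Type*} [NormedAddCommGroup E] [InnerProductSpace ℝ E]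
    [FiniteDimensional ℝ E] [MeasurableSpace E] [BorelSpace E] {ν : Measure E} {A : E →L[ℝ] E}
    {u : E → ℝ} {G : E → E} (h : IsSol ν A u G) : AEStronglyMeasurable u ν := by
  have h1 : AEStronglyMeasurable u (ν.restrict (⋃ k : ℕ, Metric.ball (0 : E) k)) :=
    aestronglyMeasurable_iUnion_iff.2 fun k => (h.1 k).1.1
  rwa [Metric.iUnion_ball_nat, Measure.restrict_univ] at h1

section Poincare

variable {n : ℕ} {a : ℝ} {B : Matrix (Fin n) (Fin n) ℝ}
  {S : EuclideanSpace ℝ (Fin n) ≃L[ℝ] EuclideanSpace ℝ (Fin n)}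

lemma sphereWeight_nonneg (a : ℝ) (B : Matrix (Fin n) (Fin n) ℝ) (σ : Sph n) :
    0 ≤ sphereWeight a B σ :=
  Real.rpow_nonneg (Real.sqrt_nonneg _) a

lemma muOne_nonneg (a : ℝ) (B : Matrix (Fin n) (Fin n) ℝ) : 0 ≤ muOne a B := by
  refine Real.sInf_nonneg ?_
  rintro q ⟨g, K, -, -, -, rfl⟩
  exact div_nonneg
    (integral_nonneg fun σ => mul_nonneg (sphereWeight_nonneg a B σ) (sq_nonneg _))
    (integral_nonneg fun σ => mul_nonneg (sphereWeight_nonneg a B σ) (sq_nonneg _))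

lemma measurable_sphereWeight (hS : ∀ x y, inner ℝ (S x) y = inner ℝ x (S y))
    (hSS : ∀ y, S (S y) = matCLM B y) : Measurable (sphereWeight a B) := by
  rw [show sphereWeight a B = fun σ : Sph n => ‖S (σ : EuclideanSpace ℝ (Fin n))‖ ^ a from
    funext (sphereWeight_eq hS hSS)]
  exact continuous_norm_rpow_sphere.measurable

lemma integral_sphereMeasure (hS : ∀ x y, inner ℝ (S x) y = inner ℝ x (S y))
    (hSS : ∀ y, S (S y) = matCLM B y) (f : Sph n → ℝ) :
    ∫ σ, f σ ∂(sphereMeasure a B) = ∫ σ, sphereWeight a B σ * f σ ∂(surfaceMeasure n) := by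
  unfold sphereMeasure
  rw [integral_withDensity_eq_integral_toReal_smul (measurable_sphereWeight hS hSS).ennreal_ofReal
    (Eventually.of_forall fun _ => ENNReal.ofReal_lt_top)]
  refine integral_congr_ae (Eventually.of_forall fun σ => ?_)
  simp only [smul_eq_mul]
  rw [ENNReal.toReal_ofReal (sphereWeight_nonneg a B σ)]

lemma exists_surfaceMeasure_le_smul (a : ℝ) (hS : ∀ x y, inner ℝ (S x) y = inner ℝ x (S y))
    (hSS : ∀ y, S (S y) = matCLM B y) :
    ∃ c : ENNReal, c ≠ ⊤ ∧ surfaceMeasure n ≤ c • sphereMeasure a B := by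
  obtain ⟨b₀, b₁, hb₀, -, hb⟩ := exists_bounds_norm_rpow_sphere a S
  have h0 : ENNReal.ofReal b₀ ≠ 0 := by simpa using hb₀
  refine ⟨(ENNReal.ofReal b₀)⁻¹, ENNReal.inv_ne_top.2 h0, ?_⟩
  have := restrict_le_smul_withDensity (μ := surfaceMeasure n) (K := Set.univ) (Ω := Set.univ)
    (w := fun σ => ENNReal.ofReal (sphereWeight a B σ)) .univ subset_rfl h0 ENNReal.ofReal_ne_top
    fun σ _ => ENNReal.ofReal_le_ofReal (by rw [sphereWeight_eq hS hSS]; exact (hb σ).1)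
  simpa only [Measure.restrict_univ] using! this

/-- The Poincaré inequality with constant `μ₁`. -/
lemma muOne_mul_integral_sq_le (hS : ∀ x y, inner ℝ (S x) y = inner ℝ x (S y))
    (hSS : ∀ y, S (S y) = matCLM B y) {g : Sph n → ℝ} {K : Sph n → EuclideanSpace ℝ (Fin n)}
    (h : IsSphereH1Lim (sphereMeasure a B) g K) (hg : ∫ σ, g σ ∂(sphereMeasure a B) = 0) :
    muOne a B * ∫ σ, g σ ^ 2 ∂(sphereMeasure a B) ≤ ∫ σ, ‖K σ‖ ^ 2 ∂(sphereMeasure a B) := by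
  have hR : 0 ≤ ∫ σ, ‖K σ‖ ^ 2 ∂(sphereMeasure a B) := integral_nonneg fun σ => sq_nonneg _
  by_cases h0 : g =ᵐ[surfaceMeasure n] 0
  · have h1 : g =ᵐ[sphereMeasure a B] 0 := (withDensity_absolutelyContinuous _ _).ae_le h0
    have h2 : ∫ σ, g σ ^ 2 ∂(sphereMeasure a B) = 0 := by
      refine (integral_congr_ae ?_).trans (integral_zero _ _)
      filter_upwards [h1] with σ hσ
      simp [hσ]
    rwa [h2, mul_zero]
  rcases (integral_nonneg fun σ => sq_nonneg (g σ) :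
    0 ≤ ∫ σ, g σ ^ 2 ∂(sphereMeasure a B)).eq_or_lt with hD | hD
  · rwa [← hD, mul_zero]
  rw [← le_div_iff₀ hD]
  obtain ⟨c, hc, hle⟩ := exists_surfaceMeasure_le_smul a hS hSS
  obtain ⟨h1, h2, φ, h3, h4, h5⟩ := h
  refine csInf_le ⟨0, ?_⟩ ⟨g, K, ⟨(h1.smul_measure hc).mono_measure hle,
    (h2.smul_measure hc).mono_measure hle, φ, h3, tendsto_eLpNorm_of_le_smul hc hle h4,
    tendsto_eLpNorm_of_le_smul hc hle h5⟩, h0, ?_, ?_⟩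
  · rintro q ⟨g, K, -, -, -, rfl⟩
    exact div_nonneg
      (integral_nonneg fun σ => mul_nonneg (sphereWeight_nonneg a B σ) (sq_nonneg _))
      (integral_nonneg fun σ => mul_nonneg (sphereWeight_nonneg a B σ) (sq_nonneg _))
  · rw [← integral_sphereMeasure hS hSS]; exact hg
  · rw [integral_sphereMeasure hS hSS, integral_sphereMeasure hS hSS]

end Poincare

/-- An exponent below the positive root of `s ^ 2 + b s = μ` leaves room for a slightly larger one
at which the quadratic is still below `μ`. -/
lemma exists_exponent_of_lt {μ b γ : ℝ} (hμ : 0 ≤ μ) (hγ : 0 < γ)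
    (h : γ < (-b + √(b ^ 2 + 4 * μ)) / 2) : ∃ s, γ < s ∧ 0 < μ - s ^ 2 - s * b := by
  obtain ⟨s, hs, hs'⟩ := exists_between h
  refine ⟨s, hs, ?_⟩
  have h1 : 2 * s + b < √(b ^ 2 + 4 * μ) := by linarith
  rcases le_or_gt 0 (2 * s + b) with h2 | h2
  · have h3 := (Real.lt_sqrt h2).1 h1
    nlinarith
  · have h3 : 0 < s := hγ.trans hs
    nlinarith

lemma exists_growth_comp {γ c L : ℝ} (hγ : 0 < γ) (hc : 0 ≤ c) (hL : 0 ≤ L) :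
    ∃ C : ℝ, ∀ r t : ℝ, 0 ≤ r → 0 ≤ t → r ≤ L * (1 + t) →
      c * (1 + r ^ γ) ≤ C * (1 + t ^ γ) := by
  refine ⟨c * (1 + L ^ γ * 2 ^ γ), fun r t hr ht h => ?_⟩
  have h1 : r ^ γ ≤ (L * (1 + t)) ^ γ := Real.rpow_le_rpow hr h hγ.le
  have h2 : (1 + t) ^ γ ≤ 2 ^ γ * (1 + t ^ γ) := by
    rcases le_total t 1 with ht1 | ht1
    · calc (1 + t) ^ γ ≤ 2 ^ γ := Real.rpow_le_rpow (by positivity) (by linarith) hγ.le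
        _ ≤ 2 ^ γ * (1 + t ^ γ) := by
          have : 0 ≤ t ^ γ := Real.rpow_nonneg ht _
          exact le_mul_of_one_le_right (by positivity) (by linarith)
    · calc (1 + t) ^ γ ≤ (2 * t) ^ γ := Real.rpow_le_rpow (by positivity) (by linarith) hγ.le
        _ = 2 ^ γ * t ^ γ := Real.mul_rpow (by norm_num) ht
        _ ≤ 2 ^ γ * (1 + t ^ γ) := by gcongr; linarith
  rw [Real.mul_rpow hL (by positivity)] at h1
  have h3 : 0 ≤ L ^ γ := Real.rpow_nonneg hL _
  have h4 : 0 ≤ t ^ γ := Real.rpow_nonneg ht _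
  have h5 : r ^ γ ≤ L ^ γ * (2 ^ γ * (1 + t ^ γ)) := h1.trans (by gcongr)
  calc c * (1 + r ^ γ) ≤ c * ((1 + t ^ γ) + L ^ γ * (2 ^ γ * (1 + t ^ γ))) := by
        gcongr; linarith
    _ = _ := by ring

section Liouville

variable {m n : ℕ} {lam Lam a ε γ c : ℝ} {A : Matrix (Fin m ⊕ Fin n) (Fin m ⊕ Fin n) ℝ}
  {u : Space m n → ℝ} {G : Space m n → Space m n}
  {S : EuclideanSpace ℝ (Fin n) ≃L[ℝ] EuclideanSpace ℝ (Fin n)}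

lemma isFiniteMeasureOnCompacts_sliceMeasure [NeZero n] (ha : 0 < a + n) (hε : 0 ≤ ε)
    (hS : ∀ x y, inner ℝ (S x) y = inner ℝ x (S y))
    {B : Matrix (Fin n) (Fin n) ℝ} (hSS : ∀ y, S (S y) = matCLM B y) :
    IsFiniteMeasureOnCompacts (sliceMeasure a ε S) := by
  have := isFiniteMeasure_sphereMeasure a hS hSS
  rw [sliceMeasure_eq_polarMeasure hε a hS hSS]
  exact isFiniteMeasureOnCompacts_polarMeasure (by linarith) hε _

/-- A solution that does not depend on `x` and grows more slowly than `|y| ^ γ₁⁺` is constant. It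
comes from a solution on `ℝ^n` with identity coefficients, whose gradient vanishes by
`gradient_eq_zero_of_growth`. -/
theorem ae_eq_const_of_invariant (hn : 2 ≤ n) (ha : 0 < a + n) (hε : 0 ≤ ε)
    (hA : IsElliptic lam Lam A)
    (hS : ∀ x y, inner ℝ (S x) y = inner ℝ x (S y)) (hSS : ∀ y, S (S y) = matCLM (blockThree A) y)
    (hs : IsSol (weightedMeasure a (hole A ε)ᶜ) (matCLM A) u G)
    (hγ : 0 < γ) (hγ₁ : γ < gammaOne a A) (hc : 0 ≤ c)
    (hgrow : ∀ᵐ z ∂(weightedMeasure a (hole A ε)ᶜ), |u z| ≤ c * (1 + ‖z‖ ^ γ))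
    (hinv : ∀ h, ∀ᵐ z ∂(weightedMeasure a (hole A ε)ᶜ), u (z + coordEquiv m S (h, 0)) = u z) :
    ∃ c₀ : ℝ, ∀ᵐ z ∂(weightedMeasure a (hole A ε)ᶜ), u z = c₀ := by
  have hn0 : NeZero n := ⟨by omega⟩
  obtain ⟨k, hk, hk', hJ⟩ := exists_map_prod_sliceMeasure (m := m) hA hε a hS hSS
  have hfβ := isFiniteMeasure_sphereMeasure a hS hSS
  have hf' := isFiniteMeasureOnCompacts_sliceMeasure ha hε hS hSS
  have hf := isFiniteMeasureOnCompacts_of_map_prod hk hk' hJ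
  have hum : AEStronglyMeasurable u (weightedMeasure a (hole A ε)ᶜ) :=
    hs.aestronglyMeasurable
  obtain ⟨x₀, K, hK, hslice, hg⟩ := exists_isSol_slice hk hk' hJ
    (inner_matCLM_adjoint_sndCLM hS hSS) hs (fun G' hG' => ae_gradient_eq hA hε hs.1 hG') hum hinv
    hgrow
  set V : EuclideanSpace ℝ (Fin n) → ℝ := fun y => u (coordEquiv m S (x₀, y)) with hV
  obtain ⟨s, hsγ, hδ⟩ := exists_exponent_of_lt (b := n + a - 2) (muOne_nonneg a (blockThree A)) hγ
    (by
      unfold gammaOne at hγ₁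
      rw [show ((2 : ℝ) - a - n) ^ 2 = (n + a - 2) ^ 2 by ring] at hγ₁
      rwa [show -((n : ℝ) + a - 2) = 2 - a - n by ring])
  set L : ℝ := ‖(coordEquiv m S :
    (EuclideanSpace ℝ (Fin m) × EuclideanSpace ℝ (Fin n)) →L[ℝ] Space m n)‖ * max ‖x₀‖ 1 with hL
  obtain ⟨C, hC⟩ := exists_growth_comp hγ hc (L := L) (by positivity)
  have hgV : ∀ᵐ y ∂(sliceMeasure a ε S), |V y| ≤ C * (1 + ‖y‖ ^ γ) := by
    filter_upwards [hg] with y hy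
    refine hy.trans (hC _ _ (norm_nonneg _) (norm_nonneg _) ?_)
    have h1 := ContinuousLinearMap.le_opNorm
      (coordEquiv m S : (EuclideanSpace ℝ (Fin m) × EuclideanSpace ℝ (Fin n)) →L[ℝ] Space m n) (x₀, y)
    refine h1.trans ?_
    rw [hL, mul_assoc]
    gcongr
    rw [Prod.norm_mk]
    have h2 := le_max_left ‖x₀‖ 1
    have h3 := le_max_right ‖x₀‖ 1
    have h4 := norm_nonneg y
    refine max_le ?_ ?_ <;> nlinarith
  have hK0 : K =ᵐ[sliceMeasure a ε S] 0 := by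
    rw [sliceMeasure_eq_polarMeasure hε a hS hSS] at hK hgV ⊢
    refine gradient_eq_zero_of_growth hε (by linarith) hK (μ := muOne a (blockThree A)) hγ hsγ ?_
      (fun g K hgK hg0 => muOne_mul_integral_sq_le hS hSS hgK hg0) hgV
    rw [show (n : ℝ) + a - 1 - 1 = n + a - 2 by ring]
    exact hδ
  obtain ⟨c₀, hc₀⟩ := ae_eq_const_of_gradient_eq_zero (ν := sliceMeasure a ε S) (u := V)
    (isOpen_lt continuous_const continuous_norm) (isPreconnected_setOf_lt_norm hn hε)
    (fun K hK hKc => exists_restrict_le_smul_sliceMeasure hε a hKc hK)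
    fun R => (hK.1 R).congr (EventuallyEq.refl _ _) (ae_restrict_of_ae hK0)
  have h5 : ∀ᵐ y ∂(sliceMeasure a ε S), V y = c₀ := (ae_sliceMeasure_iff hε a).2 hc₀
  refine ⟨c₀, ?_⟩
  have h6 : ∀ᵐ z ∂(weightedMeasure a (hole A ε)ᶜ), V (sndCLM (coordEquiv m S) z) = c₀ := by
    rw [ae_iff_ae_prod hk hJ]
    filter_upwards [(Measure.quasiMeasurePreserving_snd
      (μ := (volume : Measure (EuclideanSpace ℝ (Fin m))))).ae h5] with p hp
    rwa [sndCLM_apply_mk]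
  filter_upwards [hslice, h6] with z h1 h2
  rw [h1]
  exact h2

end Liouville

/-! ### Linearity along the invariant directions -/

section Differences

variable {E X : Type*} [NormedAddCommGroup E] [InnerProductSpace ℝ E] [FiniteDimensional ℝ E]
  [MeasurableSpace E] [BorelSpace E] [NormedAddCommGroup X] [NormedSpace ℝ X]
  [FiniteDimensional ℝ X] {ν : Measure E} {e : X →ₗ[ℝ] E} {u : E → ℝ}

omit [FiniteDimensional ℝ E] [FiniteDimensional ℝ X] [BorelSpace E] in
/-- If all second differences along `X` vanish, so do the mixed ones: the point `z + (h + k) / 2` is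
the midpoint of `z`, `z + h + k` and also of `z + h`, `z + k`. -/
lemma ae_mixed_difference_eq_zero
    (hν : ∀ h, MeasurePreserving (fun z => z + e h) ν ν)
    (hu : ∀ h, ∀ᵐ z ∂ν, (fwdDiff (e h))^[2] u z = 0) (h k : X) :
    ∀ᵐ z ∂ν, u (z + e h + e k) - u (z + e h) = u (z + e k) - u z := by
  have hu' : ∀ h, ∀ᵐ z ∂ν, u (z + e h + e h) + u z = 2 * u (z + e h) := by
    intro h
    filter_upwards [hu h] with z hz
    simp only [Function.iterate_succ, Function.iterate_zero, Function.comp_apply, id, fwdDiff] at hz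
    linarith
  have h1 := hu' ((2 : ℝ)⁻¹ • (h + k))
  have h2 := (hν h).quasiMeasurePreserving.ae (hu' ((2 : ℝ)⁻¹ • (k - h)))
  filter_upwards [h1, h2] with z z1 z2
  have e1 : z + e ((2 : ℝ)⁻¹ • (h + k)) + e ((2 : ℝ)⁻¹ • (h + k)) = z + e h + e k := by
    rw [add_assoc, add_assoc, ← map_add, ← map_add, ← add_smul]; norm_num
  have e2 : z + e h + e ((2 : ℝ)⁻¹ • (k - h)) + e ((2 : ℝ)⁻¹ • (k - h)) = z + e k := by
    rw [add_assoc (z + e h), ← map_add, ← add_smul, add_assoc, ← map_add]; norm_num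
  have e3 : z + e h + e ((2 : ℝ)⁻¹ • (k - h)) = z + e ((2 : ℝ)⁻¹ • (h + k)) := by
    rw [add_assoc, ← map_add]
    congr 2
    module
  rw [e1] at z1
  rw [e2, e3] at z2
  linarith

omit [FiniteDimensional ℝ E] in
/-- A locally bounded function whose increments along `X` are constant has increments that depend
linearly on the step. -/
lemma exists_linear_increment (hν0 : ν ≠ 0)
    (hν : ∀ h, MeasurePreserving (fun z => z + e h) ν ν) {g : ℝ → ℝ} (hg : Monotone g)
    (hgrow : ∀ᵐ z ∂ν, |u z| ≤ g ‖z‖) {d : X → ℝ}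
    (hd : ∀ h, ∀ᵐ z ∂ν, u (z + e h) - u z = d h) : ∃ ℓ : X →L[ℝ] ℝ, ∀ h, d h = ℓ h := by
  have hne : (ae ν).NeBot := ae_neBot.2 hν0
  have hadd : ∀ h k, d (h + k) = d h + d k := by
    intro h k
    obtain ⟨z, h1, h2, h3⟩ := ((hd (h + k)).and ((hd h).and
      ((hν h).quasiMeasurePreserving.ae (hd k)))).exists
    rw [map_add, ← add_assoc] at h1
    linarith
  let f : X →+ ℝ := AddMonoidHom.mk' d hadd
  obtain ⟨R, hR⟩ : ∃ R : ℕ, ν (Metric.ball 0 R) ≠ 0 := by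
    by_contra! hcon
    refine hν0 ?_
    rw [← Measure.measure_univ_eq_zero, ← Metric.iUnion_ball_nat (0 : E)]
    exact measure_iUnion_null hcon
  have hne2 : (ae (ν.restrict (Metric.ball 0 R))).NeBot := by
    rw [ae_neBot]
    intro h
    exact hR (Measure.restrict_eq_zero.1 h)
  let e' : X →L[ℝ] E := LinearMap.toContinuousLinearMap e
  have hbd : ∀ h ∈ Metric.ball (0 : X) 1, |d h| ≤ g (R + ‖e'‖) + g R := by
    intro h hh
    rw [Metric.mem_ball, dist_zero_right] at hh
    have hall : ∀ᵐ z ∂ν, u (z + e h) - u z = d h ∧ |u z| ≤ g ‖z‖ ∧ |u (z + e h)| ≤ g ‖z + e h‖ :=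
      (hd h).and (hgrow.and ((hν h).quasiMeasurePreserving.ae hgrow))
    obtain ⟨z, ⟨h1, h2, h3⟩, h4⟩ := ((ae_restrict_of_ae (s := Metric.ball (0 : E) R) hall).and
      (ae_restrict_mem Metric.isOpen_ball.measurableSet)).exists
    rw [Metric.mem_ball, dist_zero_right] at h4
    rw [← h1]
    refine (abs_sub _ _).trans (add_le_add (h3.trans (hg ?_)) (h2.trans (hg h4.le)))
    have h5 : ‖e h‖ ≤ ‖e'‖ := by
      calc ‖e' h‖ ≤ ‖e'‖ * ‖h‖ := e'.le_opNorm h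
        _ ≤ ‖e'‖ * 1 := by gcongr
        _ = ‖e'‖ := mul_one _
    exact (norm_add_le _ _).trans (by linarith)
  have hcont : Continuous f := by
    refine f.continuous_of_isBounded_nhds_zero (Metric.ball_mem_nhds 0 one_pos) ?_
    refine (isBounded_iff_forall_norm_le).2 ⟨g (R + ‖e'‖) + g R, ?_⟩
    rintro _ ⟨h, hh, rfl⟩
    exact hbd h hh
  exact ⟨f.toRealLinearMap hcont, fun h => rfl⟩

end Differences

section Final

variable {m n : ℕ} {lam Lam a ε γ c : ℝ} {A : Matrix (Fin m ⊕ Fin n) (Fin m ⊕ Fin n) ℝ}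
  {u : Space m n → ℝ} {G : Space m n → Space m n}
  {S : EuclideanSpace ℝ (Fin n) ≃L[ℝ] EuclideanSpace ℝ (Fin n)}

lemma coordEquiv_inl (h : EuclideanSpace ℝ (Fin m)) :
    coordEquiv m S (h, 0) = WithLp.toLp 2 (Sum.elim h.ofLp 0) := by
  ext i
  rw [ofLp_coordEquiv, map_zero]
  rfl

/-- A linear form on the `x` variables extends to a linear form on `ℝ^d` whose conormal field `A ξ`
is tangent to the `x` directions: the `y` component of `ξ` is found by inverting `A₃`. -/
lemma exists_matCLM_eq_coordEquiv (hA : IsElliptic lam Lam A)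
    (ℓ : EuclideanSpace ℝ (Fin m) →L[ℝ] ℝ) :
    ∃ (ξ : Space m n) (w : EuclideanSpace ℝ (Fin m)), matCLM A ξ = coordEquiv m S (w, 0) ∧
      ∀ h, inner ℝ ξ (coordEquiv m S (h, 0)) = ℓ h := by
  have hdet : IsUnit (blockThree A).det := (isUnit_iff_isUnit_det _).1 (posDef_blockThree hA).isUnit
  set x := (InnerProductSpace.toDual ℝ (EuclideanSpace ℝ (Fin m))).symm ℓ with hx
  set y := -((blockThree A)⁻¹ *ᵥ (A.toBlocks₂₁ *ᵥ x.ofLp)) with hy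
  refine ⟨WithLp.toLp 2 (Sum.elim x.ofLp y),
    WithLp.toLp 2 fun j => (A *ᵥ Sum.elim x.ofLp y) (Sum.inl j), ?_, fun h => ?_⟩
  · rw [coordEquiv_inl]
    ext i
    rw [ofLp_toEuclideanCLM]
    rcases i with j | i
    · rfl
    · have h1 : blockThree A *ᵥ y = -(A.toBlocks₂₁ *ᵥ x.ofLp) := by
        rw [hy, mulVec_neg, mulVec_mulVec, mul_nonsing_inv _ hdet, one_mulVec]
      change (A *ᵥ Sum.elim x.ofLp y) (Sum.inr i) = 0
      rw [mulVec_inr_eq, h1]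
      simp
  · have h1 : inner ℝ x h = ℓ h := by
      rw [hx, InnerProductSpace.toDual_symm_apply]
    rw [← h1, coordEquiv_inl, EuclideanSpace.inner_eq_star_dotProduct,
      EuclideanSpace.inner_eq_star_dotProduct]
    simp [dotProduct]

/-- A linear function whose conormal field `A ξ` is tangent to the `x` directions is a solution: the
measure is invariant in these directions, so the derivative of a test function along `A ξ` has
integral zero. -/
lemma isSol_inner [IsFiniteMeasureOnCompacts (weightedMeasure a (hole A ε)ᶜ)]
    {k : ENNReal} (hk : k ≠ 0) (hk' : k ≠ ⊤)
    (hJ : ((volume : Measure (EuclideanSpace ℝ (Fin m))).prod (sliceMeasure a ε S)).map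
        (coordEquiv m S) = k • weightedMeasure a (hole A ε)ᶜ)
    {ξ : Space m n} {w : EuclideanSpace ℝ (Fin m)} (hξ : matCLM A ξ = coordEquiv m S (w, 0)) :
    IsSol (weightedMeasure a (hole A ε)ᶜ) (matCLM A) (fun z => inner ℝ ξ z) fun _ => ξ := by
  have hc : ContDiff ℝ ∞ fun z : Space m n => inner ℝ ξ z := contDiff_const.inner ℝ contDiff_id
  have hg : gradient (fun z : Space m n => inner ℝ ξ z) = fun _ => ξ := by
    ext1 z
    exact gradient_inner_left ξ z
  refine ⟨fun R => ?_, fun φ hφ hφc => ?_⟩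
  · rw [← hg]
    exact h1Lim_of_contDiff hc (memLp_restrict_ball_of_continuous hc.continuous R)
      (memLp_restrict_ball_of_continuous (continuous_gradient hc) R)
  · simp_rw [hξ]
    exact integral_inner_inl_gradient_eq_zero hk hk' hJ hφ hφc w

/-- The Liouville theorem for the weighted measure. If `γ < 2`, the increments of `u` along `x` are
solutions independent of `x`, hence constant, and they are matched by a linear solution; the
difference with it is again independent of `x`. -/
theorem ae_eq_linear_of_growth (hn : 2 ≤ n) (ha : 0 < a + n) (hε : 0 ≤ ε)
    (hA : IsElliptic lam Lam A)
    (hs : IsSol (weightedMeasure a (hole A ε)ᶜ) (matCLM A) u G)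
    (hγ : 0 < γ) (hγ₁ : γ < gammaOne a A) (hc : 0 ≤ c)
    (hgrow : ∀ᵐ z ∂(weightedMeasure a (hole A ε)ᶜ), |u z| ≤ c * (1 + ‖z‖ ^ γ)) :
    (γ < 1 → ∃ c₀ : ℝ, ∀ᵐ z ∂(weightedMeasure a (hole A ε)ᶜ), u z = c₀) ∧
    (γ < 2 → ∃ (c₀ : ℝ) (v : Space m n),
      ∀ᵐ z ∂(weightedMeasure a (hole A ε)ᶜ), u z = c₀ + inner ℝ v z) := by
  have hn0 : NeZero n := ⟨by omega⟩
  obtain ⟨S, hS, hSS⟩ := exists_sqrt_blockThree hA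
  obtain ⟨k, hk, hk', hJ⟩ := exists_map_prod_sliceMeasure (m := m) hA hε a hS hSS
  have hfβ := isFiniteMeasure_sphereMeasure a hS hSS
  have hf' := isFiniteMeasureOnCompacts_sliceMeasure ha hε hS hSS
  have hf := isFiniteMeasureOnCompacts_of_map_prod hk hk' hJ
  have hsf : SFinite (weightedMeasure a (hole A ε)ᶜ) := by unfold weightedMeasure; infer_instance
  set ν := weightedMeasure a (hole A ε)ᶜ with hν
  let e : EuclideanSpace ℝ (Fin m) →ₗ[ℝ] Space m n :=
    (coordEquiv m S).toLinearEquiv.toLinearMap.comp (LinearMap.inl ℝ _ _)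
  have he : ∀ h, e h = coordEquiv m S (h, 0) := fun h => rfl
  have hmp : ∀ h, MeasurePreserving (fun z => z + e h) ν ν := fun h =>
    measurePreserving_add_of_map_prod hk hk' hJ h
  -- polynomial growth in `L²` makes differences of high order vanish
  obtain ⟨D, hD, hball⟩ := exists_measure_ball_le hk hk' hJ
    (C := (sphereMeasure a (blockThree A) Set.univ).toReal / (n + a - 1 + 1)) (s := n + a - 1 + 1)
    (div_nonneg ENNReal.toReal_nonneg (by linarith)) fun R hR => by
      rw [sliceMeasure_eq_polarMeasure hε a hS hSS]
      exact polarMeasure_ball_le (by linarith) hε _ (by linarith)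
  obtain ⟨M, p, hM, hL2⟩ := exists_eLpNorm_le_of_growth hD hball hc hγ.le hgrow
  have hdiff : ∀ j : ℕ, γ < j → ∀ h, ∀ᵐ z ∂ν, (fwdDiff (e h))^[j] u z = 0 := by
    intro j hj h
    refine fwdDiff_iterate_eq_zero_of_growth (hmp h) hγ hc hgrow
      (exists_fwdDiff_iterate_eq_zero hA.1 (le_inner_matCLM hA) (fun t => ?_) hs hM hL2) hj
    have := hmp (t • h)
    rwa [map_smul] at this
  have hsmall : γ < 1 → ∃ c₀ : ℝ, ∀ᵐ z ∂ν, u z = c₀ := by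
    intro h1
    refine ae_eq_const_of_invariant hn ha hε hA hS hSS hs hγ hγ₁ hc hgrow fun h => ?_
    filter_upwards [hdiff 1 (by exact_mod_cast h1) h] with z hz
    simpa [fwdDiff, sub_eq_zero, he] using hz
  refine ⟨hsmall, fun h2 => ?_⟩
  rcases lt_or_ge γ 1 with h1 | h1
  · obtain ⟨c₀, hc₀⟩ := hsmall h1
    exact ⟨c₀, 0, by simpa using hc₀⟩
  by_cases hν0 : ν = 0
  · exact ⟨0, 0, by simp [hν0]⟩
  -- first differences are invariant, hence constant
  have hmix := ae_mixed_difference_eq_zero hmp (hdiff 2 (by exact_mod_cast h2))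
  have hconst : ∀ h, ∃ d : ℝ, ∀ᵐ z ∂ν, u (z + e h) - u z = d := by
    intro h
    obtain ⟨C, hC⟩ := exists_growth_comp hγ hc (L := 1 + ‖e h‖) (by positivity)
    have hsol := (hs.translate (hmp h)).sub hs
    have hgr : ∀ᵐ z ∂ν, |((fun z => u (z + e h)) - u) z| ≤ (|C| + c) * (1 + ‖z‖ ^ γ) := by
      filter_upwards [hgrow, (hmp h).quasiMeasurePreserving.ae hgrow] with z z1 z2
      have z3 := hC ‖z + e h‖ ‖z‖ (norm_nonneg _) (norm_nonneg _) (by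
        have := norm_add_le z (e h)
        nlinarith [norm_nonneg z, norm_nonneg (e h)])
      have z4 : 0 ≤ 1 + ‖z‖ ^ γ := by positivity
      have z5 := mul_le_mul_of_nonneg_right (le_abs_self C) z4
      refine (abs_sub _ _).trans ?_
      rw [add_mul]
      linarith
    refine ae_eq_const_of_invariant hn ha hε hA hS hSS hsol hγ hγ₁ (by positivity) hgr fun l => ?_
    filter_upwards [hmix h l] with z hz
    simp only [← he]
    rw [add_right_comm]
    linarith
  choose d hd using hconst
  obtain ⟨ℓ, hℓ⟩ := exists_linear_increment (e := e) (u := u) (d := d) hν0 hmp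
    (g := fun r => c * (1 + (max r 0) ^ γ))
    (fun r s hrs => by
      have : max r 0 ≤ max s 0 := max_le_max_right 0 hrs
      have h3 : (max r 0) ^ γ ≤ (max s 0) ^ γ := Real.rpow_le_rpow (le_max_right _ _) this hγ.le
      simp only
      gcongr)
    (by simpa only [max_eq_left (norm_nonneg _)] using hgrow) hd
  -- subtract the linear solution with the same increments
  obtain ⟨ξ, w, hξ, hξℓ⟩ := exists_matCLM_eq_coordEquiv (S := S) hA ℓ
  have hsol := hs.sub (isSol_inner hk hk' hJ hξ)
  have hgr : ∀ᵐ z ∂ν, |(u - fun z => inner ℝ ξ z) z| ≤ (c + ‖ξ‖) * (1 + ‖z‖ ^ γ) := by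
    filter_upwards [hgrow] with z hz
    have z1 : |inner ℝ ξ z| ≤ ‖ξ‖ * ‖z‖ := abs_real_inner_le_norm ξ z
    have z2 : ‖z‖ ≤ 1 + ‖z‖ ^ γ := by
      rcases le_total ‖z‖ 1 with z3 | z3
      · have : 0 ≤ ‖z‖ ^ γ := by positivity
        linarith
      · have := Real.self_le_rpow_of_one_le z3 h1
        linarith
    have z3 := mul_le_mul_of_nonneg_left z2 (norm_nonneg ξ)
    refine (abs_sub _ _).trans ?_
    rw [add_mul]
    linarith
  obtain ⟨c₀, hc₀⟩ := ae_eq_const_of_invariant hn ha hε hA hS hSS hsol hγ hγ₁ (by positivity) hgr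
    fun h => by
      filter_upwards [hd h] with z hz
      simp only [Pi.sub_apply, inner_add_right, hξℓ, ← hℓ, ← hz, he]
      ring
  refine ⟨c₀, ξ, ?_⟩
  filter_upwards [hc₀] with z hz
  rw [← hz, Pi.sub_apply]
  ring

end Final

end PerforatedLiouville

theorem theorem1p4 (m n : ℕ) (hn : 2 ≤ n) (a : ℝ) (ha : 0 < a + n) (ε : ℝ) (hε : 0 ≤ ε)
    (lam Lam : ℝ) (A : Matrix (Fin m ⊕ Fin n) (Fin m ⊕ Fin n) ℝ)
    (hA : PerforatedLiouville.IsElliptic lam Lam A)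
    (u : PerforatedLiouville.Space m n → ℝ)
    (hu : PerforatedLiouville.IsEntireSolution a A ε u)
    (c γ : ℝ) (hc : 0 < c) (hγ : 0 < γ) (hγ₁ : γ < PerforatedLiouville.gammaOne a A)
    (hgrowth : ∀ᵐ z, z ∉ PerforatedLiouville.hole A ε → |u z| ≤ c * (1 + ‖z‖ ^ γ)) :
    (γ < 2 → ∃ (c₀ : ℝ) (v : PerforatedLiouville.Space m n),
      ∀ᵐ z, z ∉ PerforatedLiouville.hole A ε → u z = c₀ + inner ℝ v z) ∧
    (γ < 1 → ∃ c₀ : ℝ, ∀ᵐ z, z ∉ PerforatedLiouville.hole A ε → u z = c₀) := by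
  obtain ⟨G, hs⟩ := PerforatedLiouville.exists_isSol hA hε hu
  have h := PerforatedLiouville.ae_eq_linear_of_growth hn ha hε hA hs hγ hγ₁ hc.le
    ((PerforatedLiouville.ae_weightedMeasure_iff hA hε a).2 hgrowth)
  simp only [PerforatedLiouville.ae_weightedMeasure_iff hA hε a] at h
  exact ⟨h.2, h.1⟩
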